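/- Let $\Delta>-1$. Write $\Delta=\cos\zeta$ with $\zeta\in(0,\pi)$ if $-1<\Delta<1$, and $\Delta=\cosh\zeta$ with $\zeta>0$ if $\Delta>1$. Define the bare momentum $\mathfrak p$, the bare phase $\theta$ and the Lieb kernel $K=\theta'/(2\pi)$ on $\mathbb R$ as follows. * For $-1<\Delta<1$: $\mathfrak p(\lambda)=\mathrm i\ln\dfrac{\sinh(\mathrm i\zeta/2+\lambda)}{\sinh(\mathrm i\zeta/2-\lambda)}$, $\theta(\lambda)=\mathrm i\ln\dfrac{\sinh(\mathrm i\zeta+\lambda)}{\sinh(\mathrm i\zeta-\lambda)}$, $K(\lambda)=\dfrac{\sin 2\zeta}{2\pi\sinh(\lambda+\mathrm i\zeta)\sinh(\lambda-\mathrm i\zeta)}$. * For $\Delta=1$: $\mathfrak p(\lambda)=\mathrm i\ln\dfrac{\mathrm i/2+\lambda}{\mathrm i/2-\lambda}$, $\theta(\lambda)=\mathrm i\ln\dfrac{\mathrm i+\lambda}{\mathrm i-\lambda}$, $K(\lambda)=\dfrac{1}{\pi(1+\lambda^2)}$. * For $\Delta>1$: $\mathfrak p(\lambda)=\vartheta(\lambda,\zeta/2)$,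 $\theta(\lambda)=\vartheta(\lambda,\zeta)$ with $\vartheta(\lambda,\eta)=\displaystyle\int_0^\lambda\frac{\sinh(2\eta)\,d\mu}{\sin(\mu+\mathrm i\eta)\sin(\mu-\mathrm i\eta)}$, and $K(\lambda)=\dfrac{\sinh 2\zeta}{2\pi\sin(\lambda+\mathrm i\zeta)\sin(\lambda-\mathrm i\zeta)}$. (The principal logarithm is used.) Endpoints below may be infinite; then $[Q_L,Q_R]$ denotes the corresponding closed subinterval of $\mathbb R$, and values of functions at $\pm\infty$, including $\theta(\lambda\mp\infty)=\lim_{x\to\mp\infty}\theta(x)$, are limits. Let $D\in[0,\tfrac12]$. *Two-endpoint problem.* Find $Q_L\in[-\infty,+\infty)$, $Q_R\in(-\infty,+\infty]$ with $Q_L\le Q_R$, and $Q_R-Q_L\le\pi$ if $\Delta>1$, and a function $f:\mathbb R\to\mathbb R$ whose restriction to $[Q_L,Q_R]$ is in $L^2$ or in $L^\infty$, such that for all $\lambda\in\mathbb R$ $$ f(\lambda)+\int_{[Q_L,Q_R]}K(\lambda-\mu)f(\mu)\,d\mu=\frac{\mathfrak p(\lambda)}{2\pi}-\frac{D}{4\pi}\big[\theta(\lambda-Q_R)+\theta(\lambda-Q_L)\big],\qquad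 f(Q_R)=\frac D2,\quad f(Q_L)=-\frac D2. $$ *Symmetric magnetic Fermi boundary problem.* Find $Q\in[0,+\infty]$, with $Q\le\pi/2$ if $\Delta>1$, and a function $p(\cdot|Q):\mathbb R\to\mathbb R$ whose restriction to $[-Q,Q]$ is in $L^2$ or in $L^\infty$, such that for all $\lambda\in\mathbb R$ $$ p(\lambda|Q)+\int_{[-Q,Q]}K(\lambda-\mu)p(\mu|Q)\,d\mu=\frac{\mathfrak p(\lambda)}{2\pi}-\frac{D}{4\pi}\big[\theta(\lambda-Q)+\theta(\lambda+Q)\big],\qquad p(Q|Q)=\frac D2. $$ **Proposition.** The symmetric problem has exactly one solution $(q,p(\cdot|q))$, and the two-endpoint problem has exactly one solution, namely $Q_L=-q$, $Q_R=q$, $f=p(\cdot|q)$. Moreover $q>0$ if $D>0$; and if $D<\tfrac12$, then $q<\pi/2$ for $\Delta>1$ and $q<+\infty$ for $-1<\Delta\le1$. In particular, for $0<D<\tfrac12$ the solution satisfies $Q_L<Q_R$, and $Q_R-Q_L<\pi$ if $\Delta>1$. -/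

import Mathlib

open Filter Topology MeasureTheory

noncomputable section

namespace XXZ

/-- The parameter `ζ`: `Δ = cos ζ` with `ζ ∈ (0, π)` for `-1 < Δ < 1`, and `Δ = cosh ζ` with
`ζ > 0` for `Δ > 1`. (It is not used for `Δ = 1`.) -/
def zeta (Δ : ℝ) : ℝ :=
  if Δ < 1 then Real.arccos Δ else Real.arcosh Δ

/-- The function `i ln (sinh (iη + lam) / sinh (iη - lam))`, for `-1 < Δ < 1`. The argument of the
logarithm has modulus one and avoids `-1` for `η ∈ (0, π)`, so that the value is real and the
principal branch is the continuous one vanishing at `lam = 0`. -/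
def phaseHyp (η lam : ℝ) : ℝ :=
  (Complex.I * Complex.log
    (Complex.sinh (Complex.I * η + lam) / Complex.sinh (Complex.I * η - lam))).re

/-- The function `i ln ((iη + lam) / (iη - lam))`, for `Δ = 1`; it is real as well. -/
def phaseRat (η lam : ℝ) : ℝ :=
  (Complex.I * Complex.log ((Complex.I * η + lam) / (Complex.I * η - lam))).re

/-- The function `∫₀^lam sinh (2η) / (sin (μ + iη) sin (μ - iη)) dμ`, for `Δ > 1`; the denominator
is the real number `|sin (μ + iη)|²`. -/
def phaseTrig (η lam : ℝ) : ℝ :=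
  ∫ μ in (0 : ℝ)..lam,
    (Complex.sinh (2 * η) /
      (Complex.sin (μ + Complex.I * η) * Complex.sin (μ - Complex.I * η))).re

/-- The bare momentum `𝔭`. -/
def bareMomentum (Δ lam : ℝ) : ℝ :=
  if Δ < 1 then phaseHyp (zeta Δ / 2) lam
  else if Δ = 1 then phaseRat (1 / 2) lam
  else phaseTrig (zeta Δ / 2) lam

/-- The bare phase `θ`. -/
def barePhase (Δ lam : ℝ) : ℝ :=
  if Δ < 1 then phaseHyp (zeta Δ) lam
  else if Δ = 1 then phaseRat 1 lam
  else phaseTrig (zeta Δ) lam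

/-- The Lieb kernel `K = θ' / (2π)`, in closed form. The two complex denominators are real. -/
def liebKernel (Δ lam : ℝ) : ℝ :=
  if Δ < 1 then
    (Complex.sin (2 * zeta Δ) /
      (2 * Real.pi * Complex.sinh (lam + Complex.I * zeta Δ)
        * Complex.sinh (lam - Complex.I * zeta Δ))).re
  else if Δ = 1 then 1 / (Real.pi * (1 + lam ^ 2))
  else
    (Complex.sinh (2 * zeta Δ) /
      (2 * Real.pi * Complex.sin (lam + Complex.I * zeta Δ)
        * Complex.sin (lam - Complex.I * zeta Δ))).re

/-- The real interval with the possibly infinite endpoints `QL` and `QR`. -/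
def interval (QL QR : EReal) : Set ℝ :=
  {μ : ℝ | QL ≤ (μ : EReal) ∧ (μ : EReal) ≤ QR}

/-- `θ (lam - Q)`, read as the limit of `θ` at `-∞` if `Q = +∞` and at `+∞` if `Q = -∞`. These
limits exist for `-1 < Δ ≤ 1`; infinite endpoints do not occur for `Δ > 1`. -/
def shiftedPhase (Δ lam : ℝ) : EReal → ℝ
  | ⊥ => limUnder atTop (barePhase Δ)
  | ⊤ => limUnder atBot (barePhase Δ)
  | (Q : ℝ) => barePhase Δ (lam - Q)

/-- `f (Q) = c`, read as a limit if `Q` is infinite. -/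
def HasBoundaryValue (f : ℝ → ℝ) (c : ℝ) : EReal → Prop
  | ⊥ => Tendsto f atBot (𝓝 c)
  | ⊤ => Tendsto f atTop (𝓝 c)
  | (Q : ℝ) => f Q = c

/-- `f` solves, on the whole real line, the integral equation
`f (lam) + ∫_{[QL, QR]} K (lam - μ) f (μ) dμ = 𝔭 (lam) / 2π - D / 4π * (θ (lam - QR) + θ (lam - QL))`.
The restriction of `f` to `[QL, QR]` is to be in `L²`, or in `L^∞`: for bounded intervals this just
means `L²`; on an unbounded interval a nonzero boundary value at infinity rules out `L²`. -/
structure SolvesLieb (Δ D : ℝ) (QL QR : EReal) (f : ℝ → ℝ) : Prop where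
  memLp : MemLp f 2 (volume.restrict (interval QL QR)) ∨
    MemLp f ⊤ (volume.restrict (interval QL QR))
  eqn : ∀ lam : ℝ,
    f lam + ∫ μ in interval QL QR, liebKernel Δ (lam - μ) * f μ =
      bareMomentum Δ lam / (2 * Real.pi)
        - D / (4 * Real.pi) * (shiftedPhase Δ lam QR + shiftedPhase Δ lam QL)

/-- The symmetric magnetic Fermi boundary problem for the unknowns `Q ∈ [0, +∞]` and `g = p(· | Q)`,
where `Q ≤ π / 2` if `Δ > 1`. -/
structure SolvesFermiBoundary (Δ D : ℝ) (Q : EReal) (g : ℝ → ℝ) : Prop where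
  nonneg : 0 ≤ Q
  le_half_period : 1 < Δ → Q ≤ ((Real.pi / 2 : ℝ) : EReal)
  lieb : SolvesLieb Δ D (-Q) Q g
  boundary : HasBoundaryValue g (D / 2) Q

/-- The two-endpoint problem for the unknowns `QL ∈ [-∞, +∞)`, `QR ∈ (-∞, +∞]` and
`f = f(· | QL, QR)`, where `QL ≤ QR`, and `QR - QL ≤ π` if `Δ > 1`. -/
structure SolvesTwoEndpoint (Δ D : ℝ) (QL QR : EReal) (f : ℝ → ℝ) : Prop where
  left_ne_top : QL ≠ ⊤
  right_ne_bot : QR ≠ ⊥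
  le : QL ≤ QR
  length_le : 1 < Δ → QR - QL ≤ (Real.pi : EReal)
  lieb : SolvesLieb Δ D QL QR f
  boundary_right : HasBoundaryValue f (D / 2) QR
  boundary_left : HasBoundaryValue f (-(D / 2)) QL

end XXZ

end

open Filter Topology MeasureTheory

noncomputable section

namespace XXZ

lemma exp_sub_one_le_mul_exp {c : ℝ} (hc : 0 ≤ c) {t : ℝ} (h0 : 0 ≤ t) (h1 : t ≤ 1) :
    Real.exp (c * t) - 1 ≤ c * Real.exp c * t := by
  have h := Real.add_one_le_exp (-(c * t))
  have h2 : Real.exp (c * t) * Real.exp (-(c * t)) = 1 := by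
    rw [← Real.exp_add]; simp
  have h3 : Real.exp (c * t) ≤ Real.exp c := Real.exp_le_exp.2 (by nlinarith)
  nlinarith [Real.exp_pos (c * t), mul_nonneg hc h0, mul_le_mul_of_nonneg_left h3 (mul_nonneg hc h0)]

lemma le_exp_mul_of_abs_deriv_le {G G' : ℝ → ℝ} {c : ℝ} (hG : ∀ x, HasDerivAt G (G' x) x)
    (hpos : ∀ x, 0 < G x) (hb : ∀ x, |G' x| ≤ c * G x) (x y : ℝ) :
    G x ≤ Real.exp (c * |x - y|) * G y := by
  have h := Convex.norm_image_sub_le_of_norm_hasDerivWithin_le (f := fun x => Real.log (G x))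
    (f' := fun x => G' x / G x) (s := Set.univ) (x := y) (y := x) (C := c)
    (fun z _ => ((hG z).log (hpos z).ne').hasDerivWithinAt)
    (fun z _ => by
      rw [Real.norm_eq_abs, abs_div, abs_of_pos (hpos z), div_le_iff₀ (hpos z)]
      exact hb z) convex_univ trivial trivial
  rw [Real.norm_eq_abs, Real.norm_eq_abs] at h
  have h1 : Real.log (G x) ≤ c * |x - y| + Real.log (G y) := by linarith [le_abs_self (Real.log (G x) - Real.log (G y))]
  have h2 := Real.exp_le_exp.2 h1
  rwa [Real.exp_add, Real.exp_log (hpos x), Real.exp_log (hpos y)] at h2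

lemma abs_sub_le_of_abs_deriv_le {G G' : ℝ → ℝ} {c : ℝ} (hc : 0 ≤ c)
    (hG : ∀ x, HasDerivAt G (G' x) x)
    (hpos : ∀ x, 0 < G x) (hb : ∀ x, |G' x| ≤ c * G x) {x y : ℝ} (hxy : |x - y| ≤ 1) :
    |G x - G y| ≤ c * Real.exp c * |x - y| * G y := by
  have hE := exp_sub_one_le_mul_exp hc (abs_nonneg (x - y)) hxy
  have h1 := le_exp_mul_of_abs_deriv_le hG hpos hb x y
  have h2 := le_exp_mul_of_abs_deriv_le hG hpos hb y x
  rw [abs_sub_comm y x] at h2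
  set E := Real.exp (c * |x - y|)
  have hE1 : 1 ≤ E := Real.one_le_exp (mul_nonneg hc (abs_nonneg _))
  have hy := hpos y
  rw [abs_le]
  constructor
  · have : (E - 1) * G y ≤ c * Real.exp c * |x - y| * G y := mul_le_mul_of_nonneg_right hE hy.le
    have h3 : G y - G x ≤ (E - 1) * G y := by
      by_contra hcon
      push Not at hcon
      nlinarith [mul_nonneg (sub_nonneg.2 hE1) (sub_nonneg.2 hE1)]
    linarith
  · have : (E - 1) * G y ≤ c * Real.exp c * |x - y| * G y := mul_le_mul_of_nonneg_right hE hy.le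
    nlinarith

/-- A family of kernels `p y x = N y / (2π (A x + B y))` which are the real parts, at `x + i y`, of
an analytic function `F` on the strip `Im z ∈ J`. -/
structure StripKernel where
  A : ℝ → ℝ
  A' : ℝ → ℝ
  B : ℝ → ℝ
  N : ℝ → ℝ
  F : ℂ → ℂ
  J : Set ℝ
  hasDerivAt_A : ∀ x, HasDerivAt A (A' x) x
  A_nonneg : ∀ x, 0 ≤ A x
  abs_A'_le : ∀ x, |A' x| ≤ 2 * (A x + 1)
  continuous_B : Continuous B
  continuous_N : Continuous N
  isOpen_J : IsOpen J
  ordConnected_J : J.OrdConnected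
  B_pos : ∀ y ∈ J, 0 < B y
  differentiableAt_F : ∀ z : ℂ, z.im ∈ J → DifferentiableAt ℂ F z
  norm_deriv_F_le : ∀ z : ℂ, z.im ∈ J → ‖deriv F z‖ ≤ 1 / (A z.re + B z.im)
  re_F : ∀ z : ℂ, z.im ∈ J → (F z).re = N z.im / (2 * Real.pi * (A z.re + B z.im))

namespace StripKernel
variable (S : StripKernel)

def p (y x : ℝ) : ℝ := S.N y / (2 * Real.pi * (S.A x + S.B y))

lemma A_add_pos {b : ℝ} (hb : 0 < b) (x : ℝ) : 0 < S.A x + b := by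
  linarith [S.A_nonneg x]

lemma continuous_A : Continuous S.A :=
  continuous_iff_continuousAt.2 fun x => (S.hasDerivAt_A x).continuousAt

lemma inv_A_add_le {b : ℝ} (hb : 0 < b) (x : ℝ) :
    1 / (S.A x + b) ≤ (1 / min 1 b) * (1 / (S.A x + 1)) := by
  have h0 : 0 < min 1 b := lt_min one_pos hb
  rw [one_div_mul_one_div]
  apply one_div_le_one_div_of_le (mul_pos h0 (S.A_add_pos one_pos x))
  have := S.A_nonneg x
  nlinarith [min_le_left 1 b, min_le_right 1 b]

lemma abs_A'_le_mul {b : ℝ} (hb : 0 < b) (x : ℝ) : |S.A' x| ≤ 2 / min 1 b * (S.A x + b) := by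
  have h0 : 0 < min 1 b := lt_min one_pos hb
  refine (S.abs_A'_le x).trans ?_
  rw [div_mul_eq_mul_div, le_div_iff₀ h0]
  have := S.A_nonneg x
  nlinarith [min_le_left 1 b, min_le_right 1 b]

lemma growth (x y : ℝ) : S.A x + 1 ≤ Real.exp (2 * |x - y|) * (S.A y + 1) :=
  le_exp_mul_of_abs_deriv_le (G := fun x => S.A x + 1) (fun x => (S.hasDerivAt_A x).add_const 1)
    (fun x => S.A_add_pos one_pos x) S.abs_A'_le x y

lemma continuous_p {y : ℝ} (hy : y ∈ S.J) : Continuous (S.p y) := by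
  unfold p
  refine continuous_const.div (continuous_const.mul (S.continuous_A.add continuous_const)) ?_
  intro x
  have := S.A_add_pos (S.B_pos y hy) x
  positivity

lemma abs_p_eq {y : ℝ} (hy : y ∈ S.J) (x : ℝ) :
    |S.p y x| = |S.N y| / (2 * Real.pi) * (1 / (S.A x + S.B y)) := by
  have := S.A_add_pos (S.B_pos y hy) x
  unfold p
  rw [abs_div, abs_of_pos (by positivity : 0 < 2 * Real.pi * (S.A x + S.B y))]
  field_simp

lemma abs_p_sub_le {y : ℝ} (hy : y ∈ S.J) :
    ∃ C, 0 ≤ C ∧ ∀ x x', |x - x'| ≤ 1 → |S.p y x - S.p y x'| ≤ C * |x - x'| * |S.p y x'| := by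
  have hb := S.B_pos y hy
  set c := 2 / min 1 (S.B y)
  have hc : 0 ≤ c := by positivity
  refine ⟨c * Real.exp c, by positivity, fun x x' hx => ?_⟩
  have h := abs_sub_le_of_abs_deriv_le hc (G := fun x => S.A x + S.B y)
    (fun x => (S.hasDerivAt_A x).add_const _) (fun x => S.A_add_pos hb x)
    (fun x => S.abs_A'_le_mul hb x) (x := x') (y := x) (by rwa [abs_sub_comm])
  have h1 := S.A_add_pos hb x
  have h2 := S.A_add_pos hb x'
  rw [S.abs_p_eq hy x']
  have e : S.p y x - S.p y x' =
      S.N y / (2 * Real.pi) * (((S.A x' + S.B y) - (S.A x + S.B y)) / ((S.A x + S.B y) * (S.A x' + S.B y))) := by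
    unfold p
    field_simp
  rw [e, abs_mul, abs_div, abs_div, abs_of_pos (mul_pos h1 h2),
    abs_of_pos (by positivity : 0 < 2 * Real.pi), abs_sub_comm x x']
  rw [mul_left_comm]
  apply mul_le_mul_of_nonneg_left _ (by positivity)
  rw [mul_one_div, div_le_div_iff₀ (mul_pos h1 h2) h2]
  nlinarith [mul_le_mul_of_nonneg_right h h2.le]

/-- Sets over which the kernels `1 / (A (x - μ) + 1)` are uniformly integrable. -/
structure IsWindow (W : Set ℝ) : Prop where
  integrableOn : ∀ x, IntegrableOn (fun μ => 1 / (S.A (x - μ) + 1)) W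
  bound : ∃ C, 0 ≤ C ∧ ∀ x, ∫ μ in W, 1 / (S.A (x - μ) + 1) ≤ C

/-- The potential `∫_W p_y (x - μ) m (μ) dμ`. -/
def pot (W : Set ℝ) (m : ℝ → ℝ) (y x : ℝ) : ℝ := ∫ μ in W, S.p y (x - μ) * m μ

variable {S} {W : Set ℝ} {m : ℝ → ℝ} {C : ℝ}

lemma abs_p_le {y : ℝ} (hy : y ∈ S.J) (x : ℝ) :
    |S.p y x| ≤ |S.N y| / (2 * Real.pi) * (1 / min 1 (S.B y)) * (1 / (S.A x + 1)) := by
  rw [S.abs_p_eq hy x, mul_assoc]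
  exact mul_le_mul_of_nonneg_left (S.inv_A_add_le (S.B_pos y hy) x) (by positivity)

lemma IsWindow.integrableOn_p (hW : S.IsWindow W) {y : ℝ} (hy : y ∈ S.J) (x : ℝ) :
    IntegrableOn (fun μ => S.p y (x - μ)) W := by
  refine Integrable.mono' ((hW.integrableOn x).const_mul (|S.N y| / (2 * Real.pi) * (1 / min 1 (S.B y)))) ?_ ?_
  · exact ((S.continuous_p hy).comp (continuous_const.sub continuous_id)).aestronglyMeasurable
  · exact Eventually.of_forall fun μ => abs_p_le hy _

lemma IsWindow.integrableOn_p_mul (hW : S.IsWindow W) {y : ℝ} (hy : y ∈ S.J)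
    (hm : Measurable m) (hC : ∀ μ, |m μ| ≤ C) (x : ℝ) :
    IntegrableOn (fun μ => S.p y (x - μ) * m μ) W :=
  (hW.integrableOn_p hy x).mul_bdd hm.aestronglyMeasurable (Eventually.of_forall hC)

lemma IsWindow.abs_pot_le (hW : S.IsWindow W) {y : ℝ} (hy : y ∈ S.J)
    (hC : ∀ μ, |m μ| ≤ C) (x : ℝ) : |S.pot W m y x| ≤ C * ∫ μ in W, |S.p y (x - μ)| := by
  unfold pot
  rw [← integral_const_mul]
  refine (abs_integral_le_integral_abs).trans ?_
  refine integral_mono_of_nonneg (Eventually.of_forall fun _ => abs_nonneg _)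
    ((hW.integrableOn_p hy x).abs.const_mul C) (Eventually.of_forall fun μ => ?_)
  simp only [abs_mul]
  rw [mul_comm]
  exact mul_le_mul_of_nonneg_right (hC μ) (abs_nonneg _)

lemma IsWindow.exists_integral_abs_p_le (hW : S.IsWindow W) {y : ℝ} (hy : y ∈ S.J) :
    ∃ C, 0 ≤ C ∧ ∀ x, ∫ μ in W, |S.p y (x - μ)| ≤ C := by
  obtain ⟨D, hD0, hD⟩ := hW.bound
  refine ⟨|S.N y| / (2 * Real.pi) * (1 / min 1 (S.B y)) * D, ?_, fun x => ?_⟩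
  · have := S.B_pos y hy
    positivity
  have hpos : 0 ≤ |S.N y| / (2 * Real.pi) * (1 / min 1 (S.B y)) := by
    have := S.B_pos y hy
    positivity
  calc ∫ μ in W, |S.p y (x - μ)| ≤ ∫ μ in W, |S.N y| / (2 * Real.pi) * (1 / min 1 (S.B y)) * (1 / (S.A (x - μ) + 1)) :=
        integral_mono_of_nonneg (Eventually.of_forall fun _ => abs_nonneg _)
          ((hW.integrableOn x).const_mul _) (Eventually.of_forall fun μ => abs_p_le hy _)
    _ ≤ _ := by
        rw [integral_const_mul]
        exact mul_le_mul_of_nonneg_left (hD x) hpos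

/-- Potentials of bounded densities are Lipschitz at small distances. -/
lemma IsWindow.exists_abs_pot_sub_le (hW : S.IsWindow W) {y : ℝ} (hy : y ∈ S.J)
    : ∃ L, 0 ≤ L ∧ ∀ (m : ℝ → ℝ) (C : ℝ), Measurable m → 0 ≤ C → (∀ μ, |m μ| ≤ C) →
      ∀ x x', |x - x'| ≤ 1 → |S.pot W m y x - S.pot W m y x'| ≤ C * L * |x - x'| := by
  obtain ⟨c, hc0, hc⟩ := S.abs_p_sub_le hy
  obtain ⟨D, hD0, hD⟩ := hW.exists_integral_abs_p_le hy
  refine ⟨c * D, by positivity, fun m C hm hC0 hC x x' hx => ?_⟩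
  unfold pot
  rw [← integral_sub (hW.integrableOn_p_mul hy hm hC x) (hW.integrableOn_p_mul hy hm hC x')]
  calc |∫ μ in W, (S.p y (x - μ) * m μ - S.p y (x' - μ) * m μ)|
      ≤ ∫ μ in W, |S.p y (x - μ) * m μ - S.p y (x' - μ) * m μ| := abs_integral_le_integral_abs
    _ ≤ ∫ μ in W, C * (c * |x - x'|) * |S.p y (x' - μ)| := by
        refine integral_mono_of_nonneg (Eventually.of_forall fun _ => abs_nonneg _)
          ((hW.integrableOn_p hy x').abs.const_mul _) (Eventually.of_forall fun μ => ?_)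
        simp only
        rw [← sub_mul, abs_mul]
        have h1 := hc (x - μ) (x' - μ) (by simpa using hx)
        rw [sub_sub_sub_cancel_right] at h1
        calc _ ≤ (c * |x - x'| * |S.p y (x' - μ)|) * C := by gcongr; exact hC μ
          _ = _ := by ring
    _ ≤ C * (c * |x - x'|) * D := by
        rw [integral_const_mul]
        exact mul_le_mul_of_nonneg_left (hD x') (by positivity)
    _ = _ := by ring

end StripKernel
namespace StripKernel
variable {S : StripKernel} {W : Set ℝ} {m : ℝ → ℝ} {C : ℝ}

lemma eventually_abs_p_sub_le {y₀ : ℝ} (hy₀ : y₀ ∈ S.J) {η : ℝ} (hη : 0 < η) :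
    ∀ᶠ y in 𝓝 y₀, ∀ x, |S.p y x - S.p y₀ x| ≤ η * (1 / (S.A x + 1)) := by
  have hb₀ := S.B_pos y₀ hy₀
  set q : ℝ → ℝ := fun y => (|S.N y - S.N y₀| + |S.N y₀| * |S.B y - S.B y₀| / S.B y₀) /
    (2 * Real.pi) * (1 / min 1 (S.B y))
  have hq : Tendsto q (𝓝 y₀) (𝓝 0) := by
    have hcN : Tendsto S.N (𝓝 y₀) (𝓝 (S.N y₀)) := S.continuous_N.tendsto y₀
    have hcB : Tendsto S.B (𝓝 y₀) (𝓝 (S.B y₀)) := S.continuous_B.tendsto y₀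
    have h1 := (((hcN.sub_const (S.N y₀)).abs.add (((hcB.sub_const (S.B y₀)).abs.const_mul
      |S.N y₀|).div_const (S.B y₀))).div_const (2 * Real.pi)).mul
      ((tendsto_const_nhds (x := (1 : ℝ))).div ((tendsto_const_nhds (x := (1 : ℝ))).min hcB)
        (lt_min one_pos hb₀).ne')
    simpa [q] using h1
  filter_upwards [hq.eventually (gt_mem_nhds hη), S.isOpen_J.mem_nhds hy₀] with y hqy hy x
  have hb := S.B_pos y hy
  have h1 := S.A_add_pos hb x
  have h2 := S.A_add_pos hb₀ x
  have h3 := S.A_add_pos one_pos x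
  have e : S.p y x - S.p y₀ x = ((S.N y - S.N y₀) - S.N y₀ * ((S.B y - S.B y₀) / (S.A x + S.B y₀)))
      / (2 * Real.pi) * (1 / (S.A x + S.B y)) := by
    unfold p
    field_simp
    ring
  have h4 : |(S.N y - S.N y₀) - S.N y₀ * ((S.B y - S.B y₀) / (S.A x + S.B y₀))| ≤
      |S.N y - S.N y₀| + |S.N y₀| * |S.B y - S.B y₀| / S.B y₀ := by
    refine (abs_sub _ _).trans ?_
    rw [abs_mul, abs_div, abs_of_pos h2, mul_div_assoc]
    gcongr
    linarith [S.A_nonneg x]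
  rw [e, abs_mul, abs_div, abs_of_pos (by positivity : 0 < 2 * Real.pi),
    abs_of_pos (by positivity : 0 < 1 / (S.A x + S.B y))]
  calc _ ≤ (|S.N y - S.N y₀| + |S.N y₀| * |S.B y - S.B y₀| / S.B y₀) / (2 * Real.pi) *
        ((1 / min 1 (S.B y)) * (1 / (S.A x + 1))) := by
        gcongr
        exact S.inv_A_add_le hb x
    _ = q y * (1 / (S.A x + 1)) := by simp only [q]; ring
    _ ≤ _ := by gcongr

lemma IsWindow.eventually_abs_pot_sub_le (hW : S.IsWindow W) (hm : Measurable m)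
    (hC : ∀ μ, |m μ| ≤ C) {y₀ : ℝ} (hy₀ : y₀ ∈ S.J) {η : ℝ} (hη : 0 < η) :
    ∀ᶠ y in 𝓝 y₀, ∀ x, |S.pot W m y x - S.pot W m y₀ x| ≤ η := by
  obtain ⟨D, hD0, hD⟩ := hW.bound
  have hC0 : 0 ≤ C := (abs_nonneg _).trans (hC 0)
  have hη' : 0 < η / (C * D + 1) := by positivity
  filter_upwards [eventually_abs_p_sub_le hy₀ hη', S.isOpen_J.mem_nhds hy₀] with y h hy x
  unfold pot
  rw [← integral_sub (hW.integrableOn_p_mul hy hm hC x) (hW.integrableOn_p_mul hy₀ hm hC x)]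
  calc _ ≤ ∫ μ in W, |S.p y (x - μ) * m μ - S.p y₀ (x - μ) * m μ| := abs_integral_le_integral_abs
    _ ≤ ∫ μ in W, (η / (C * D + 1) * C) * (1 / (S.A (x - μ) + 1)) := by
        refine integral_mono_of_nonneg (Eventually.of_forall fun _ => abs_nonneg _)
          ((hW.integrableOn x).const_mul _) (Eventually.of_forall fun μ => ?_)
        simp only
        rw [← sub_mul, abs_mul]
        calc _ ≤ (η / (C * D + 1) * (1 / (S.A (x - μ) + 1))) * C := by
              gcongr
              · exact mul_nonneg hη'.le (one_div_pos.2 (S.A_add_pos one_pos _)).le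
              · exact h _
              · exact hC μ
          _ = _ := by ring
    _ ≤ (η / (C * D + 1) * C) * D := by
        rw [integral_const_mul]
        exact mul_le_mul_of_nonneg_left (hD x) (by positivity)
    _ = η * ((C * D) / (C * D + 1)) := by ring
    _ ≤ η * 1 := by
        gcongr
        rw [div_le_one (by positivity)]
        linarith
    _ = η := mul_one η

lemma continuous_F_sub {z : ℂ} (hz : z.im ∈ S.J) : Continuous fun μ : ℝ => S.F (z - μ) := by
  refine continuous_iff_continuousAt.2 fun μ => ?_
  have h : ContinuousAt S.F (z - μ) := (S.differentiableAt_F _ (by simpa using hz)).continuousAt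
  exact ContinuousAt.comp (f := fun μ : ℝ => z - (μ : ℂ)) h (by fun_prop)

lemma norm_deriv_F_sub_le {z : ℂ} {β x₀ μ : ℝ} (hz : z.im ∈ S.J) (hβ : 0 < β)
    (hB : β ≤ S.B z.im) : ‖deriv S.F (z - μ)‖ ≤
      1 / min 1 β * Real.exp (2 * |x₀ - z.re|) * (1 / (S.A (x₀ - μ) + 1)) := by
  have h1 := S.norm_deriv_F_le (z - μ) (by simpa using hz)
  simp only [Complex.sub_re, Complex.ofReal_re, Complex.sub_im, Complex.ofReal_im, sub_zero] at h1
  have hp := S.A_add_pos hβ (z.re - μ)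
  have h2 : 1 / (S.A (z.re - μ) + S.B z.im) ≤ 1 / (S.A (z.re - μ) + β) := by gcongr
  have h3 := S.inv_A_add_le hβ (z.re - μ)
  have h4 := S.growth (x₀ - μ) (z.re - μ)
  rw [sub_sub_sub_cancel_right] at h4
  have h5 := S.A_add_pos one_pos (z.re - μ)
  have h6 := S.A_add_pos one_pos (x₀ - μ)
  have h7 : 1 / (S.A (z.re - μ) + 1) ≤ Real.exp (2 * |x₀ - z.re|) * (1 / (S.A (x₀ - μ) + 1)) := by
    rw [mul_one_div, div_le_div_iff₀ h5 h6]
    linarith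
  have h0 : 0 < min 1 β := lt_min one_pos hβ
  calc _ ≤ (1 / min 1 β) * (1 / (S.A (z.re - μ) + 1)) := h1.trans (h2.trans h3)
    _ ≤ (1 / min 1 β) * (Real.exp (2 * |x₀ - z.re|) * (1 / (S.A (x₀ - μ) + 1))) := by gcongr
    _ = _ := by ring

lemma integrableOn_F_sub (hW : S.IsWindow W) {z w : ℂ} (hz : z.im ∈ S.J) (hw : w.im ∈ S.J) :
    IntegrableOn (fun μ : ℝ => S.F (z - μ) - Complex.I * (S.F (w - μ)).im) W := by
  have hK : IsCompact (Set.uIcc w.im z.im) := isCompact_uIcc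
  have hsub : Set.uIcc w.im z.im ⊆ S.J := S.ordConnected_J.uIcc_subset hw hz
  obtain ⟨y, hy, hmin⟩ := hK.exists_isMinOn ⟨w.im, Set.left_mem_uIcc⟩ S.continuous_B.continuousOn
  have hβ := S.B_pos y (hsub hy)
  set D := 1 / min 1 (S.B y) * Real.exp (2 * |z.re - w.re|)
  have hbound : ∀ μ : ℝ, ‖S.F (z - μ) - S.F (w - μ)‖ ≤ (D * ‖z - w‖) * (1 / (S.A (z.re - μ) + 1)) := by
    intro μ
    have h := (convex_segment (𝕜 := ℝ) w z).norm_image_sub_le_of_norm_deriv_le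
      (f := fun u : ℂ => S.F (u - μ)) (C := D * (1 / (S.A (z.re - μ) + 1))) (x := w) (y := z) ?_ ?_
      (left_mem_segment ℝ w z) (right_mem_segment ℝ w z)
    · calc _ ≤ _ := h
        _ = _ := by ring
    all_goals
      intro u hu
      have him : u.im ∈ Set.uIcc w.im z.im := by
        obtain ⟨t, ht, rfl⟩ := (segment_eq_image_lineMap ℝ w z).subset hu
        rw [← segment_eq_uIcc, segment_eq_image_lineMap]
        refine ⟨t, ht, ?_⟩
        simp [AffineMap.lineMap_apply]
      have hre : |z.re - u.re| ≤ |z.re - w.re| := by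
        have : u.re ∈ Set.uIcc w.re z.re := by
          obtain ⟨t, ht, rfl⟩ := (segment_eq_image_lineMap ℝ w z).subset hu
          rw [← segment_eq_uIcc, segment_eq_image_lineMap]
          refine ⟨t, ht, ?_⟩
          simp [AffineMap.lineMap_apply]
        exact Set.abs_sub_right_of_mem_uIcc this
      have hd : DifferentiableAt ℂ S.F (u - μ) := S.differentiableAt_F _ (by simpa using hsub him)
    · exact DifferentiableAt.comp u hd (by fun_prop)
    · have hd' : deriv (fun u : ℂ => S.F (u - μ)) u = deriv S.F (u - μ) :=
        deriv_comp_sub_const S.F (μ : ℂ) u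
      rw [hd']
      have hA := S.A_add_pos one_pos (z.re - μ)
      have h0 : 0 < min 1 (S.B y) := lt_min one_pos hβ
      refine (norm_deriv_F_sub_le (x₀ := z.re) (hsub him) hβ (hmin him)).trans ?_
      simp only [D]
      gcongr
  have hre : IntegrableOn (fun μ : ℝ => ((S.F (w - μ)).re : ℂ)) W := by
    have := hW.integrableOn_p hw w.re
    refine (this.congr (Eventually.of_forall fun μ => ?_)).ofReal
    have h := S.re_F (w - μ) (by simpa using hw)
    simp only [Complex.sub_re, Complex.ofReal_re, Complex.sub_im, Complex.ofReal_im, sub_zero] at h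
    exact h.symm
  have hdiff : IntegrableOn (fun μ : ℝ => S.F (z - μ) - S.F (w - μ)) W :=
    Integrable.mono' ((hW.integrableOn z.re).const_mul (D * ‖z - w‖))
      ((continuous_F_sub hz).sub (continuous_F_sub hw)).aestronglyMeasurable
      (Eventually.of_forall hbound)
  refine (hdiff.add hre).congr (Eventually.of_forall fun μ => ?_)
  simp only [Pi.add_apply]
  have := Complex.re_add_im (S.F (w - μ))
  linear_combination this

/-- A potential is the real part of an analytic function. -/
lemma IsWindow.exists_analytic_pot (hW : S.IsWindow W) (hm : Measurable m)
    (hC : ∀ μ, |m μ| ≤ C) {y₀ : ℝ} (hy₀ : y₀ ∈ S.J) :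
    ∃ G : ℂ → ℂ, ∀ z : ℂ, z.im ∈ S.J → DifferentiableAt ℂ G z ∧ (G z).re = S.pot W m z.im z.re := by
  have hC0 : 0 ≤ C := (abs_nonneg _).trans (hC 0)
  set w : ℂ := Complex.I * y₀
  have hw : w.im ∈ S.J := by simpa [w] using hy₀
  have hint : ∀ z : ℂ, z.im ∈ S.J →
      IntegrableOn (fun μ : ℝ => (S.F (z - μ) - Complex.I * (S.F (w - μ)).im) * (m μ : ℂ)) W := by
    intro z hz
    exact (integrableOn_F_sub hW hz hw).mul_bdd (c := C)
      (Complex.measurable_ofReal.comp hm).aestronglyMeasurable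
      (Eventually.of_forall fun μ => by simpa using hC μ)
  refine ⟨fun z => ∫ μ in W, (S.F (z - μ) - Complex.I * (S.F (w - μ)).im) * (m μ : ℂ), fun z hz => ⟨?_, ?_⟩⟩
  · have hb := S.B_pos _ hz
    have hev : ∀ᶠ u : ℂ in 𝓝 z, u.im ∈ S.J ∧ S.B z.im / 2 ≤ S.B u.im ∧ |z.re - u.re| ≤ 1 := by
      refine (Complex.continuous_im.continuousAt.eventually (S.isOpen_J.mem_nhds hz)).and
        (((S.continuous_B.comp Complex.continuous_im).continuousAt.eventually
          (lt_mem_nhds (half_lt_self hb))).mono (fun u hu => hu.le) |>.and ?_)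
      have : Tendsto (fun u : ℂ => |z.re - u.re|) (𝓝 z) (𝓝 0) := by
        have : Continuous (fun u : ℂ => |z.re - u.re|) := by fun_prop
        simpa using this.tendsto z
      exact (this.eventually (gt_mem_nhds one_pos)).mono fun u hu => hu.le
    have h := hasDerivAt_integral_of_dominated_loc_of_deriv_le (𝕜 := ℂ) (μ := volume.restrict W)
      (F := fun (z : ℂ) (μ : ℝ) => (S.F (z - μ) - Complex.I * (S.F (w - μ)).im) * (m μ : ℂ))
      (F' := fun (z : ℂ) (μ : ℝ) => deriv S.F (z - μ) * (m μ : ℂ)) (x₀ := z) (s := {u | u.im ∈ S.J ∧ S.B z.im / 2 ≤ S.B u.im ∧ |z.re - u.re| ≤ 1})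
      (bound := fun μ => (1 / min 1 (S.B z.im / 2) * Real.exp 2 * C) * (1 / (S.A (z.re - μ) + 1)))
      hev (hev.mono fun u hu => (hint u hu.1).aestronglyMeasurable) (hint z hz) ?_ ?_
      ((hW.integrableOn z.re).const_mul _) ?_
    · exact h.2.differentiableAt
    · refine AEStronglyMeasurable.mul ?_ (Complex.measurable_ofReal.comp hm).aestronglyMeasurable
      exact ((measurable_deriv S.F).comp (by fun_prop)).aestronglyMeasurable
    · refine Eventually.of_forall fun μ u hu => ?_
      have h1 := norm_deriv_F_sub_le (x₀ := z.re) (μ := μ) hu.1 (half_pos hb) hu.2.1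
      have hA := S.A_add_pos one_pos (z.re - μ)
      have h0 : 0 < min 1 (S.B z.im / 2) := lt_min one_pos (half_pos hb)
      rw [norm_mul]
      calc _ ≤ (1 / min 1 (S.B z.im / 2) * Real.exp (2 * |z.re - u.re|) * (1 / (S.A (z.re - μ) + 1))) * C := by
            gcongr
            simpa using hC μ
        _ ≤ (1 / min 1 (S.B z.im / 2) * Real.exp 2 * (1 / (S.A (z.re - μ) + 1))) * C := by
            gcongr
            linarith [hu.2.2]
        _ = _ := by ring
    · refine Eventually.of_forall fun μ u hu => ?_
      have hd : DifferentiableAt ℂ S.F (u - μ) := S.differentiableAt_F _ (by simpa using hu.1)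
      exact ((hd.hasDerivAt.comp_sub_const u (μ : ℂ)).sub_const _).mul_const _
  · have h := integral_re (𝕜 := ℂ) (hint z hz)
    simp only [RCLike.re_to_complex] at h
    rw [← h]
    unfold pot
    refine integral_congr_ae (Eventually.of_forall fun μ => ?_)
    have := S.re_F (z - μ) (by simpa using hz)
    simp only [Complex.mul_re, Complex.sub_re, Complex.ofReal_re, Complex.I_re, Complex.I_im,
      Complex.ofReal_im, mul_zero, sub_zero, zero_mul, this]
    simp [p]

end StripKernel

/-- Minimum principle for the real part of an analytic function in a strip. -/
lemma le_re_of_le_re_boundary_strip {G : ℂ → ℂ} {a b M C : ℝ} (hab : a < b)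
    (hd : ∀ z : ℂ, a ≤ z.im → z.im ≤ b → DifferentiableAt ℂ G z)
    (hC : ∀ z : ℂ, a ≤ z.im → z.im ≤ b → -C ≤ (G z).re)
    (ha : ∀ z : ℂ, z.im = a → M ≤ (G z).re) (hb : ∀ z : ℂ, z.im = b → M ≤ (G z).re)
    {z : ℂ} (hza : a ≤ z.im) (hzb : z.im ≤ b) : M ≤ (G z).re := by
  have key : ‖Complex.exp (-G z)‖ ≤ Real.exp (-M) := by
    refine PhragmenLindelof.horizontal_strip (f := fun z => Complex.exp (-G z)) (a := a) (b := b)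
      ?_ ?_ ?_ ?_ hza hzb
    · refine DifferentiableOn.diffContOnCl fun w hw => ?_
      have hcl : closure (Complex.im ⁻¹' Set.Ioo a b) ⊆ Complex.im ⁻¹' Set.Icc a b :=
        closure_minimal (Set.preimage_mono Set.Ioo_subset_Icc_self)
          (isClosed_Icc.preimage Complex.continuous_im)
      have h := hcl hw
      exact ((hd w h.1 h.2).neg.cexp).differentiableWithinAt
    · refine ⟨0, div_pos Real.pi_pos (sub_pos.2 hab), 0, ?_⟩
      refine Asymptotics.IsBigO.of_bound (Real.exp C) ?_
      refine eventually_inf_principal.2 (Eventually.of_forall fun w hw => ?_)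
      have := hC w hw.1.le hw.2.le
      simp only [Complex.norm_exp, zero_mul, Real.exp_zero, norm_one, mul_one, Complex.neg_re]
      exact Real.exp_le_exp.2 (by linarith)
    · intro w hw
      rw [Complex.norm_exp, Complex.neg_re]
      exact Real.exp_le_exp.2 (neg_le_neg (ha w hw))
    · intro w hw
      rw [Complex.norm_exp, Complex.neg_re]
      exact Real.exp_le_exp.2 (neg_le_neg (hb w hw))
  rw [Complex.norm_exp, Complex.neg_re, Real.exp_le_exp] at key
  linarith

/-- Minimum principle for the real part of an analytic function in a half-plane. -/
lemma le_re_of_le_re_boundary_halfPlane {G : ℂ → ℂ} {a M C : ℝ}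
    (hd : ∀ z : ℂ, a ≤ z.im → DifferentiableAt ℂ G z)
    (hC : ∀ z : ℂ, a ≤ z.im → -C ≤ (G z).re)
    (ha : ∀ z : ℂ, z.im = a → M ≤ (G z).re)
    {z : ℂ} (hza : a ≤ z.im) : M ≤ (G z).re := by
  set φ : ℂ → ℂ := fun w => Complex.I * (w + a) with hφ
  have him : ∀ w, (φ w).im = w.re + a := fun w => by simp [hφ]
  have hdφ : ∀ w : ℂ, 0 ≤ w.re → DifferentiableAt ℂ (fun w => Complex.exp (-G (φ w))) w := by
    intro w hw
    have h := hd (φ w) (by rw [him]; linarith)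
    exact (DifferentiableAt.comp w h (by fun_prop)).neg.cexp
  have hbd : ∀ w : ℂ, 0 ≤ w.re → ‖Complex.exp (-G (φ w))‖ ≤ Real.exp C := by
    intro w hw
    have := hC (φ w) (by rw [him]; linarith)
    rw [Complex.norm_exp, Complex.neg_re]
    exact Real.exp_le_exp.2 (by linarith)
  have key : ‖Complex.exp (-G (φ (-Complex.I * z - a)))‖ ≤ Real.exp (-M) := by
    refine PhragmenLindelof.right_half_plane_of_bounded_on_real
      (f := fun w => Complex.exp (-G (φ w))) ?_ ?_ ?_ ?_ ?_
    · refine DifferentiableOn.diffContOnCl fun w hw => ?_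
      have hcl : closure {z : ℂ | 0 < z.re} ⊆ {z : ℂ | 0 ≤ z.re} :=
        closure_minimal (fun z (hz : 0 < z.re) => hz.le) (isClosed_le continuous_const Complex.continuous_re)
      exact (hdφ w (hcl hw)).differentiableWithinAt
    · refine ⟨1, by norm_num, 0, ?_⟩
      refine Asymptotics.IsBigO.of_bound (Real.exp C) ?_
      refine eventually_inf_principal.2 (Eventually.of_forall fun w hw => ?_)
      simpa using hbd w (le_of_lt hw)
    · refine isBoundedUnder_of_eventually_le (a := Real.exp C) ?_
      filter_upwards [eventually_ge_atTop 0] with x hx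
      exact hbd x (by simpa using hx)
    · intro x
      have := ha (φ (x * Complex.I)) (by rw [him]; simp)
      rw [Complex.norm_exp, Complex.neg_re]
      exact Real.exp_le_exp.2 (neg_le_neg this)
    · simpa using hza
  have hz : φ (-Complex.I * z - a) = z := by
    simp only [hφ]
    linear_combination (-z) * Complex.I_mul_I
  rw [hz, Complex.norm_exp, Complex.neg_re, Real.exp_le_exp] at key
  linarith

namespace StripKernel
variable {S : StripKernel} {W : Set ℝ} {m : ℝ → ℝ} {C : ℝ}

lemma exists_abs_p_le_Icc {a b : ℝ} (hab : Set.Icc a b ⊆ S.J) :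
    ∃ D, 0 ≤ D ∧ ∀ y ∈ Set.Icc a b, ∀ x, |S.p y x| ≤ D * (1 / (S.A x + 1)) := by
  have hcont : ContinuousOn (fun y => |S.N y| / (2 * Real.pi) * (1 / min 1 (S.B y))) (Set.Icc a b) := by
    refine ((S.continuous_N.abs.div_const _).continuousOn).mul (ContinuousOn.div continuousOn_const
      (continuous_const.min S.continuous_B).continuousOn fun y hy => ?_)
    exact (lt_min one_pos (S.B_pos y (hab hy))).ne'
  obtain ⟨D, hD⟩ := isCompact_Icc.bddAbove_image hcont
  refine ⟨|D|, abs_nonneg D, fun y hy x => (abs_p_le (hab hy) _).trans ?_⟩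
  refine mul_le_mul_of_nonneg_right ?_ (one_div_pos.2 (S.A_add_pos one_pos _)).le
  exact (hD (Set.mem_image_of_mem _ hy)).trans (le_abs_self D)

lemma IsWindow.exists_abs_pot_le_Icc (hW : S.IsWindow W)
    (hC : ∀ μ, |m μ| ≤ C) {a b : ℝ} (hab : Set.Icc a b ⊆ S.J) :
    ∃ D, 0 ≤ D ∧ ∀ y ∈ Set.Icc a b, ∀ x, |S.pot W m y x| ≤ D := by
  obtain ⟨E, hE0, hE⟩ := hW.bound
  have hC0 : 0 ≤ C := (abs_nonneg _).trans (hC 0)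
  obtain ⟨D, hD0, hD⟩ := exists_abs_p_le_Icc hab
  refine ⟨C * (D * E), by positivity, fun y hy x => ?_⟩
  refine (hW.abs_pot_le (hab hy) hC x).trans (mul_le_mul_of_nonneg_left ?_ hC0)
  calc ∫ μ in W, |S.p y (x - μ)| ≤ ∫ μ in W, D * (1 / (S.A (x - μ) + 1)) :=
        integral_mono_of_nonneg (Eventually.of_forall fun _ => abs_nonneg _)
          ((hW.integrableOn x).const_mul _) (Eventually.of_forall fun μ => hD y hy _)
    _ ≤ D * E := by
        rw [integral_const_mul]
        exact mul_le_mul_of_nonneg_left (hE x) hD0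

/-- The density outside of the window, continued harmonically. -/
def outer (S : StripKernel) (W : Set ℝ) (m : ℝ → ℝ) (ζ y x : ℝ) : ℝ :=
  S.p y x - S.pot W m (y + ζ / 2) x - S.pot W m (y - ζ / 2) x

lemma p_nonneg {y : ℝ} (hy : y ∈ S.J) (hN : 0 ≤ S.N y) (x : ℝ) : 0 ≤ S.p y x := by
  have := S.A_add_pos (S.B_pos y hy) x
  unfold p
  positivity

lemma p_le {y : ℝ} (hy : y ∈ S.J) (x : ℝ) :
    |S.p y x| ≤ |S.N y| / (2 * Real.pi) * (1 / min 1 (S.B y)) := by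
  have := S.B_pos y hy
  refine (abs_p_le hy x).trans (mul_le_of_le_one_right (by positivity) ?_)
  rw [div_le_one (S.A_add_pos one_pos x)]
  linarith [S.A_nonneg x]

lemma IsWindow.continuous_pot (hW : S.IsWindow W) {y : ℝ} (hy : y ∈ S.J) (hm : Measurable m)
    (hC : ∀ μ, |m μ| ≤ C) : Continuous (S.pot W m y) := by
  obtain ⟨L, hL0, hL⟩ := hW.exists_abs_pot_sub_le hy
  have hC0 : 0 ≤ C := (abs_nonneg _).trans (hC 0)
  refine continuous_iff_continuousAt.2 fun x => ?_
  rw [ContinuousAt, tendsto_iff_dist_tendsto_zero]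
  have h0 : Tendsto (fun x' => C * L * |x' - x|) (𝓝 x) (𝓝 0) := by
    have : Continuous fun x' => C * L * |x' - x| := by fun_prop
    simpa using this.tendsto x
  refine squeeze_zero' (Eventually.of_forall fun _ => dist_nonneg) ?_ h0
  filter_upwards [Metric.ball_mem_nhds x one_pos] with x' hx'
  rw [Real.dist_eq]
  exact hL m C hm hC0 hC x' x (le_of_lt (by simpa [Real.dist_eq] using hx'))

/-- A kernel family together with a parameter `ζ` for which the kernels up to `ζ` are nonnegative
and those near `0` blow up. -/
structure IsAdmissible (S : StripKernel) (ζ : ℝ) : Prop where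
  pos : 0 < ζ
  mem_J : ∀ y, 0 < y → y ≤ 3 * ζ / 2 → y ∈ S.J
  N_nonneg : ∀ y, 0 < y → y ≤ ζ → 0 ≤ S.N y
  tendsto_p_zero : Tendsto (fun ε => S.p ε 0) (𝓝[>] 0) atTop

section positivity
variable {ζ : ℝ} {ρ : ℝ → ℝ}

/-- The density, symmetrized in the imaginary direction, is the real part of an analytic function. -/
lemma IsWindow.exists_analytic_density (hW : S.IsWindow W) (hS : S.IsAdmissible ζ)
    (hm : Measurable m) (hC : ∀ μ, |m μ| ≤ C)
    (hρ : ∀ x, ρ x = S.p (ζ / 2) x - S.pot W m ζ x) :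
    ∃ G : ℂ → ℂ, (∀ x : ℝ, G x = 2 * ρ x) ∧ ∀ z : ℂ, |z.im| < ζ / 2 → DifferentiableAt ℂ G z ∧
      (G z).re = S.p (ζ / 2 + z.im) z.re + S.p (ζ / 2 - z.im) z.re
        - S.pot W m (ζ + z.im) z.re - S.pot W m (ζ - z.im) z.re := by
  have hζ := hS.pos
  obtain ⟨Gm, hGm⟩ := hW.exists_analytic_pot hm hC (hS.mem_J ζ hζ (by linarith))
  set Ξ : ℂ → ℂ := fun z => S.F (z + Complex.I * (ζ / 2 : ℝ)) - Gm (z + Complex.I * ζ) with hΞ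
  have h1 : ∀ z : ℂ, |z.im| < ζ / 2 → DifferentiableAt ℂ Ξ z ∧
      (Ξ z).re = S.p (ζ / 2 + z.im) z.re - S.pot W m (ζ + z.im) z.re := by
    intro z hz
    obtain ⟨hz1, hz2⟩ := abs_lt.1 hz
    have i1 : (z + Complex.I * (ζ / 2 : ℝ)).im = ζ / 2 + z.im := by simp [add_comm]
    have i2 : (z + Complex.I * ζ).im = ζ + z.im := by simp [add_comm]
    have r1 : (z + Complex.I * (ζ / 2 : ℝ)).re = z.re := by simp
    have r2 : (z + Complex.I * ζ).re = z.re := by simp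
    have j1 : (z + Complex.I * (ζ / 2 : ℝ)).im ∈ S.J := by
      rw [i1]; exact hS.mem_J _ (by linarith) (by linarith)
    have j2 : (z + Complex.I * ζ).im ∈ S.J := by
      rw [i2]; exact hS.mem_J _ (by linarith) (by linarith)
    refine ⟨?_, ?_⟩
    · exact (DifferentiableAt.comp z (S.differentiableAt_F _ j1) (by fun_prop)).sub
        (DifferentiableAt.comp z (hGm _ j2).1 (by fun_prop))
    · simp only [hΞ, Complex.sub_re]
      rw [S.re_F _ j1, (hGm _ j2).2, i1, i2, r1, r2]
      rfl
  refine ⟨fun z => Ξ z + (starRingEnd ℂ) (Ξ ((starRingEnd ℂ) z)), fun x => ?_, fun z hz => ⟨?_, ?_⟩⟩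
  · have h := (h1 x (by simpa using half_pos hζ)).2
    simp only [Complex.ofReal_im, add_zero, Complex.ofReal_re] at h
    rw [← hρ] at h
    simp only
    rw [Complex.conj_ofReal, Complex.add_conj, h]
    push_cast
    ring
  · have h2 : DifferentiableAt ℂ Ξ ((starRingEnd ℂ) z) := (h1 _ (by simpa using hz)).1
    have h3 := h2.hasDerivAt.conj_conj
    rw [Complex.conj_conj] at h3
    exact (h1 z hz).1.add h3.differentiableAt
  · have h2 := (h1 z hz).2
    have h3 := (h1 ((starRingEnd ℂ) z) (by simpa using hz)).2
    simp only [Complex.conj_im, Complex.conj_re] at h3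
    rw [Complex.add_re, Complex.conj_re, h2, h3]
    ring_nf

lemma IsWindow.half_le_density (hW : S.IsWindow W) (hS : S.IsAdmissible ζ)
    (hm : Measurable m) (hC : ∀ μ, |m μ| ≤ C)
    (hρ : ∀ x, ρ x = S.p (ζ / 2) x - S.pot W m ζ x)
    (hmρ : ∀ μ, m μ ≤ max (ρ μ) 0)
    (hAI : ∀ η > 0, ∀ᶠ ε in 𝓝[>] (0 : ℝ), ∀ x,
      S.pot W (fun μ => max (ρ μ) 0) ε x ≤ max (ρ x) 0 + η)
    (hO : ∀ M ≤ 0, ∀ y₀, ζ / 2 < y₀ → y₀ < ζ → (∀ x, M ≤ S.outer W m ζ y₀ x) →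
      ∀ y, y₀ ≤ y → y < ζ → ∀ x, M ≤ S.outer W m ζ y x)
    {M : ℝ} (hM : M ≤ 0) (hMρ : ∀ x, M ≤ ρ x) (x : ℝ) : M / 2 ≤ ρ x := by
  have hζ := hS.pos
  have hJ := hS.mem_J
  obtain ⟨G, hG1, hG2⟩ := hW.exists_analytic_density hS hm hC hρ
  obtain ⟨D, hD0, hD⟩ := hW.exists_abs_pot_le_Icc hC (a := ζ / 2) (b := 3 * ζ / 2)
    (fun y hy => hJ y (by linarith [hy.1]) hy.2)
  have hζJ : ζ ∈ S.J := hJ ζ hζ (by linarith)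
  have hζJ2 : ζ / 2 ∈ S.J := hJ _ (by linarith) (by linarith)
  have hρc : Continuous ρ := by
    have : ρ = fun x => S.p (ζ / 2) x - S.pot W m ζ x := funext hρ
    rw [this]
    exact (S.continuous_p hζJ2).sub (hW.continuous_pot hζJ hm hC)
  set R := |S.N (ζ / 2)| / (2 * Real.pi) * (1 / min 1 (S.B (ζ / 2))) + D
  have hR : ∀ x, |max (ρ x) 0| ≤ R := by
    intro x
    have h1 := p_le hζJ2 x
    have h2 := hD ζ ⟨by linarith, by linarith⟩ x
    have h3 : |ρ x| ≤ R := by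
      rw [hρ]
      exact (abs_sub _ _).trans (add_le_add h1 h2)
    rw [abs_of_nonneg (le_max_right _ _)]
    exact max_le ((le_abs_self _).trans h3) ((abs_nonneg _).trans h3)
  refine le_of_forall_pos_le_add fun η' hη' => ?_
  obtain ⟨η, hη, rfl⟩ : ∃ η, 0 < η ∧ η' = 5 / 2 * η := ⟨2 / 5 * η', by positivity, by ring⟩
  have t1 : Tendsto (fun ε => ζ / 2 + ε) (𝓝[>] 0) (𝓝 (ζ / 2)) := by
    have : Continuous fun ε : ℝ => ζ / 2 + ε := by fun_prop
    simpa using (this.tendsto 0).mono_left nhdsWithin_le_nhds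
  have t2 : Tendsto (fun ε => ζ / 2 - ε) (𝓝[>] 0) (𝓝 (ζ / 2)) := by
    have : Continuous fun ε : ℝ => ζ / 2 - ε := by fun_prop
    simpa using (this.tendsto 0).mono_left nhdsWithin_le_nhds
  have t3 : Tendsto (fun ε => ζ + ε) (𝓝[>] 0) (𝓝 ζ) := by
    have : Continuous fun ε : ℝ => ζ + ε := by fun_prop
    simpa using (this.tendsto 0).mono_left nhdsWithin_le_nhds
  have hsmall : ∀ᶠ ε in 𝓝[>] (0 : ℝ), ε ∈ Set.Ioo 0 (ζ / 4) := Ioo_mem_nhdsGT (by linarith)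
  obtain ⟨ε, ⟨hε0, hε1⟩, e1, e2, e3, e4, e5⟩ := (hsmall.and
    ((t1.eventually (eventually_abs_p_sub_le hζJ2 hη)).and
    ((t3.eventually (hW.eventually_abs_pot_sub_le hm hC hζJ hη)).and ((hAI η hη).and
    ((t2.eventually (hW.eventually_abs_pot_sub_le hm hC hζJ2 hη)).and
    (t1.eventually (hW.eventually_abs_pot_sub_le hm hC hζJ2 hη))))))).exists
  have hεJ : ε ∈ S.J := hJ ε hε0 (by linarith)
  have houter : ∀ x, M - 3 * η ≤ S.outer W m ζ (ζ / 2 + ε) x := by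
    intro x
    have a1 := e1 x
    have a1' : η * (1 / (S.A x + 1)) ≤ η := by
      refine mul_le_of_le_one_right hη.le ?_
      rw [div_le_one (S.A_add_pos one_pos x)]
      linarith [S.A_nonneg x]
    have a2 := e2 x
    have a3 := e3 x
    have a4 : S.pot W m ε x ≤ S.pot W (fun μ => max (ρ μ) 0) ε x := by
      refine integral_mono (hW.integrableOn_p_mul hεJ hm hC x)
        (hW.integrableOn_p_mul hεJ (hρc.max continuous_const).measurable hR x) fun μ => ?_
      exact mul_le_mul_of_nonneg_left (hmρ μ) (p_nonneg hεJ (hS.N_nonneg ε hε0 (by linarith)) _)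
    have a5 := hρ x
    have a6 : M ≤ ρ x - max (ρ x) 0 := by
      rcases le_total (ρ x) 0 with h | h
      · rw [max_eq_right h]; linarith [hMρ x]
      · rw [max_eq_left h]; linarith
    unfold outer
    rw [show ζ / 2 + ε + ζ / 2 = ζ + ε by ring, show ζ / 2 + ε - ζ / 2 = ε by ring]
    rw [abs_le] at a1 a2
    linarith [a1.1, a2.2]
  have hin := hO (M - 3 * η) (by linarith) (ζ / 2 + ε) (by linarith) (by linarith) houter (ζ - ε)
    (by linarith) (by linarith)
  have hbdy : ∀ x, M - 5 * η ≤ S.p (ζ - ε) x + S.p ε x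
        - S.pot W m (3 * ζ / 2 - ε) x - S.pot W m (ζ / 2 + ε) x := by
    intro x
    have b1 := hin x
    have b2 := p_nonneg hεJ (hS.N_nonneg ε hε0 (by linarith)) x
    have b3 := (abs_le.1 (e4 x)).1
    have b4 := (abs_le.1 (e5 x)).2
    unfold outer at b1
    rw [show ζ - ε + ζ / 2 = 3 * ζ / 2 - ε by ring, show ζ - ε - ζ / 2 = ζ / 2 - ε by ring] at b1
    linarith
  have hfin := le_re_of_le_re_boundary_strip (G := G) (a := -(ζ / 2 - ε)) (b := ζ / 2 - ε)
    (M := M - 5 * η) (C := 2 * D) (by linarith)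
    (fun z h1 h2 => (hG2 z (abs_lt.2 ⟨by linarith, by linarith⟩)).1)
    (fun z h1 h2 => by
      rw [(hG2 z (abs_lt.2 ⟨by linarith, by linarith⟩)).2]
      have c1 := p_nonneg (hJ (ζ / 2 + z.im) (by linarith) (by linarith))
        (hS.N_nonneg _ (by linarith) (by linarith)) z.re
      have c2 := p_nonneg (hJ (ζ / 2 - z.im) (by linarith) (by linarith))
        (hS.N_nonneg _ (by linarith) (by linarith)) z.re
      have c3 := (abs_le.1 (hD (ζ + z.im) ⟨by linarith, by linarith⟩ z.re)).2
      have c4 := (abs_le.1 (hD (ζ - z.im) ⟨by linarith, by linarith⟩ z.re)).2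
      linarith)
    (fun z hz => by
      rw [(hG2 z (abs_lt.2 ⟨by linarith, by linarith⟩)).2, hz]
      have := hbdy z.re
      rw [show ζ / 2 + -(ζ / 2 - ε) = ε by ring, show ζ / 2 - -(ζ / 2 - ε) = ζ - ε by ring,
        show ζ + -(ζ / 2 - ε) = ζ / 2 + ε by ring, show ζ - -(ζ / 2 - ε) = 3 * ζ / 2 - ε by ring]
      linarith)
    (fun z hz => by
      rw [(hG2 z (abs_lt.2 ⟨by linarith, by linarith⟩)).2, hz]
      have := hbdy z.re
      rw [show ζ / 2 + (ζ / 2 - ε) = ζ - ε by ring, show ζ / 2 - (ζ / 2 - ε) = ε by ring,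
        show ζ + (ζ / 2 - ε) = 3 * ζ / 2 - ε by ring, show ζ - (ζ / 2 - ε) = ζ / 2 + ε by ring]
      linarith)
    (z := (x : ℂ)) (by simp; linarith) (by simp; linarith)
  rw [hG1] at hfin
  have : (2 * (ρ x : ℂ)).re = 2 * ρ x := by simp
  rw [this] at hfin
  linarith

lemma IsWindow.density_nonneg (hW : S.IsWindow W) (hS : S.IsAdmissible ζ)
    (hm : Measurable m) (hC : ∀ μ, |m μ| ≤ C)
    (hρ : ∀ x, ρ x = S.p (ζ / 2) x - S.pot W m ζ x)
    (hmρ : ∀ μ, m μ ≤ max (ρ μ) 0)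
    (hAI : ∀ η > 0, ∀ᶠ ε in 𝓝[>] (0 : ℝ), ∀ x,
      S.pot W (fun μ => max (ρ μ) 0) ε x ≤ max (ρ x) 0 + η)
    (hO : ∀ M ≤ 0, ∀ y₀, ζ / 2 < y₀ → y₀ < ζ → (∀ x, M ≤ S.outer W m ζ y₀ x) →
      ∀ y, y₀ ≤ y → y < ζ → ∀ x, M ≤ S.outer W m ζ y x) (x : ℝ) : 0 ≤ ρ x := by
  have hζ := hS.pos
  obtain ⟨D, hD0, hD⟩ := hW.exists_abs_pot_le_Icc hC (a := ζ) (b := ζ)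
    (fun y hy => hS.mem_J y (by linarith [hy.1]) (by linarith [hy.2]))
  have h : ∀ n : ℕ, ∀ x, (-D) * (1 / 2) ^ n ≤ ρ x := by
    intro n
    induction n with
    | zero =>
      intro x
      have h1 := p_nonneg (hS.mem_J (ζ / 2) (by linarith) (by linarith))
        (hS.N_nonneg _ (by linarith) (by linarith)) x
      have h2 := (abs_le.1 (hD ζ ⟨le_rfl, le_rfl⟩ x)).2
      rw [hρ]
      simp
      linarith
    | succ n ih =>
      intro x
      have := hW.half_le_density hS hm hC hρ hmρ hAI hO
        (M := (-D) * (1 / 2) ^ n) (by have : (0 : ℝ) ≤ (1 / 2) ^ n := by positivity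
                                      nlinarith) ih x
      rw [pow_succ]
      linarith
  have ht : Tendsto (fun n : ℕ => (-D) * (1 / 2 : ℝ) ^ n) atTop (𝓝 0) := by
    simpa using (tendsto_pow_atTop_nhds_zero_of_lt_one (r := (1 / 2 : ℝ)) (by norm_num)
      (by norm_num)).const_mul (-D)
  exact le_of_tendsto' ht fun n => h n x

lemma IsWindow.density_ne_zero (hW : S.IsWindow W) (hS : S.IsAdmissible ζ)
    (hm : Measurable m) (hC : ∀ μ, |m μ| ≤ C)
    (hρ : ∀ x, ρ x = S.p (ζ / 2) x - S.pot W m ζ x) {a b : ℝ} (hab : a < b) :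
    ∃ x ∈ Set.Ioo a b, ρ x ≠ 0 := by
  by_contra hcon
  push Not at hcon
  have hζ := hS.pos
  obtain ⟨G, hG1, hG2⟩ := hW.exists_analytic_density hS hm hC hρ
  obtain ⟨D, hD0, hD⟩ := hW.exists_abs_pot_le_Icc hC (a := ζ / 2) (b := 3 * ζ / 2)
    (fun y hy => hS.mem_J y (by linarith [hy.1]) hy.2)
  set U : Set ℂ := Complex.im ⁻¹' Set.Ioo (-(ζ / 2)) (ζ / 2)
  have hU : IsOpen U := isOpen_Ioo.preimage Complex.continuous_im
  have hUc : IsPreconnected U := ((convex_Ioo (-(ζ / 2)) (ζ / 2)).linear_preimage Complex.imLm).isPreconnected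
  have hmem : ∀ z ∈ U, |z.im| < ζ / 2 := fun z hz => abs_lt.2 hz
  have hGa : AnalyticOnNhd ℂ G U := DifferentiableOn.analyticOnNhd
    (fun z hz => (hG2 z (hmem z hz)).1.differentiableWithinAt) hU
  set c := (a + b) / 2
  have hfreq : ∃ᶠ z in 𝓝[≠] (c : ℂ), G z = 0 := by
    have htend : Tendsto (fun x : ℝ => (x : ℂ)) (𝓝[>] c) (𝓝[≠] (c : ℂ)) := by
      refine tendsto_nhdsWithin_iff.2 ⟨(Complex.continuous_ofReal.tendsto c).mono_left
        nhdsWithin_le_nhds, ?_⟩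
      filter_upwards [self_mem_nhdsWithin] with x hx
      simpa using (ne_of_gt hx)
    refine htend.frequently (Eventually.frequently ?_)
    filter_upwards [Ioo_mem_nhdsGT (show c < b by simp only [c]; linarith)] with x hx
    rw [hG1, hcon x ⟨by simp only [c] at hx; linarith [hx.1], hx.2⟩]
    simp
  have hzero := hGa.eqOn_zero_of_preconnected_of_frequently_eq_zero hUc
    (show (c : ℂ) ∈ U by simp [U, hζ]) hfreq
  have hev := (hS.tendsto_p_zero.eventually (eventually_gt_atTop (2 * D))).and
    (Ioo_mem_nhdsGT (show (0 : ℝ) < ζ / 2 by linarith))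
  obtain ⟨ε, hε, hε0, hε1⟩ := hev.exists
  have hzU : (Complex.I * (ζ / 2 - ε : ℝ)) ∈ U := by
    simp only [U, Set.mem_preimage, Complex.mul_im, Complex.I_re, Complex.I_im, Complex.ofReal_re,
      Complex.ofReal_im, Set.mem_Ioo]
    constructor <;> linarith
  have h1 := (hG2 _ (hmem _ hzU)).2
  rw [hzero hzU] at h1
  simp only [Complex.mul_im, Complex.mul_re, Complex.I_re, Complex.I_im, Complex.ofReal_re,
    Complex.ofReal_im, Pi.zero_apply, Complex.zero_re, zero_mul, one_mul, mul_zero, sub_zero,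
    zero_add] at h1
  have c1 := p_nonneg (hS.mem_J (ζ / 2 + (ζ / 2 - ε)) (by linarith) (by linarith))
        (hS.N_nonneg _ (by linarith) (by linarith)) 0
  have c3 := (abs_le.1 (hD (ζ + (ζ / 2 - ε)) ⟨by linarith, by linarith⟩ 0)).2
  have c4 := (abs_le.1 (hD (ζ - (ζ / 2 - ε)) ⟨by linarith, by linarith⟩ 0)).2
  rw [show ζ / 2 - (ζ / 2 - ε) = ε by ring] at h1
  linarith

end positivity
end StripKernel
namespace StripKernel
variable {S : StripKernel} {W U : Set ℝ} {m : ℝ → ℝ} {C ζ : ℝ}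

lemma IsWindow.exists_analytic_outer (hW : S.IsWindow W) (hm : Measurable m)
    (hC : ∀ μ, |m μ| ≤ C) {J' : Set ℝ} {y₀ : ℝ} (hy₀ : y₀ ∈ J')
    (hJ' : ∀ y ∈ J', y ∈ S.J ∧ y + ζ / 2 ∈ S.J ∧ y - ζ / 2 ∈ S.J) :
    ∃ G : ℂ → ℂ, ∀ z : ℂ, z.im ∈ J' →
      DifferentiableAt ℂ G z ∧ (G z).re = S.outer W m ζ z.im z.re := by
  obtain ⟨Gm, hGm⟩ := hW.exists_analytic_pot hm hC (hJ' y₀ hy₀).1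
  refine ⟨fun z => S.F z - Gm (z + Complex.I * (ζ / 2 : ℝ)) - Gm (z - Complex.I * (ζ / 2 : ℝ)),
    fun z hz => ?_⟩
  obtain ⟨j0, j1, j2⟩ := hJ' _ hz
  have i1 : (z + Complex.I * (ζ / 2 : ℝ)).im = z.im + ζ / 2 := by simp
  have i2 : (z - Complex.I * (ζ / 2 : ℝ)).im = z.im - ζ / 2 := by simp
  have r1 : (z + Complex.I * (ζ / 2 : ℝ)).re = z.re := by simp
  have r2 : (z - Complex.I * (ζ / 2 : ℝ)).re = z.re := by simp
  rw [← i1] at j1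
  rw [← i2] at j2
  refine ⟨?_, ?_⟩
  · exact ((S.differentiableAt_F _ j0).sub (DifferentiableAt.comp z (hGm _ j1).1 (by fun_prop))).sub
        (DifferentiableAt.comp z (hGm _ j2).1 (by fun_prop))
  · simp only [Complex.sub_re]
    rw [S.re_F _ j0, (hGm _ j1).2, (hGm _ j2).2, i1, i2, r1, r2]
    rfl

/-- Minimum principle for the outer density, if the kernels are odd about the height `h`. -/
lemma IsWindow.le_outer_of_strip (hW : S.IsWindow W) (hm : Measurable m)
    (hC : ∀ μ, |m μ| ≤ C) {h : ℝ} (hζ : 0 < ζ) (hζh : ζ ≤ h)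
    (hJ : ∀ y, 0 < y → y < 2 * h → y ∈ S.J) (hodd : ∀ s x, S.p (h + s) x = -S.p (h - s) x) :
    ∀ M ≤ 0, ∀ y₀, ζ / 2 < y₀ → y₀ < ζ → (∀ x, M ≤ S.outer W m ζ y₀ x) →
      ∀ y, y₀ ≤ y → y < ζ → ∀ x, M ≤ S.outer W m ζ y x := by
  intro M hM y₀ h1 h2 hb y hy1 hy2 x
  have hJ' : ∀ y ∈ Set.Icc y₀ h, y ∈ S.J ∧ y + ζ / 2 ∈ S.J ∧ y - ζ / 2 ∈ S.J := fun y hy =>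
    ⟨hJ _ (by linarith [hy.1]) (by linarith [hy.2]), hJ _ (by linarith [hy.1]) (by linarith [hy.2]),
      hJ _ (by linarith [hy.1]) (by linarith [hy.2])⟩
  obtain ⟨G, hG⟩ := hW.exists_analytic_outer hm hC (J' := Set.Icc y₀ h) (ζ := ζ) (y₀ := h)
    ⟨by linarith, le_rfl⟩ hJ'
  obtain ⟨D, hD0, hD⟩ := hW.exists_abs_pot_le_Icc hC (a := y₀ - ζ / 2) (b := h + ζ / 2)
    (fun y hy => hJ y (by linarith [hy.1]) (by linarith [hy.2]))
  obtain ⟨E, hE0, hE⟩ := exists_abs_p_le_Icc (S := S) (a := y₀) (b := h)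
    (fun y hy => (hJ' y hy).1)
  have hkey := le_re_of_le_re_boundary_strip (G := G) (a := y₀) (b := h) (M := M)
    (C := E + D + D) (by linarith) (fun z a1 a2 => (hG z ⟨a1, a2⟩).1)
    (fun z a1 a2 => by
      rw [(hG z ⟨a1, a2⟩).2]
      have b1 := (abs_le.1 (hE z.im ⟨a1, a2⟩ z.re)).1
      have b2 : E * (1 / (S.A z.re + 1)) ≤ E := by
        refine mul_le_of_le_one_right hE0 ?_
        rw [div_le_one (S.A_add_pos one_pos _)]
        linarith [S.A_nonneg z.re]
      have b3 := (abs_le.1 (hD (z.im + ζ / 2) ⟨by linarith, by linarith⟩ z.re)).2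
      have b4 := (abs_le.1 (hD (z.im - ζ / 2) ⟨by linarith, by linarith⟩ z.re)).2
      unfold outer
      linarith)
    (fun z hz => by
      rw [(hG z ⟨hz.ge, by linarith⟩).2, hz]
      exact hb _)
    (fun z hz => by
      rw [(hG z ⟨by linarith, hz.le⟩).2, hz]
      have b1 := hodd 0 z.re
      simp only [add_zero, sub_zero] at b1
      have b2 : S.pot W m (h + ζ / 2) z.re = -S.pot W m (h - ζ / 2) z.re := by
        unfold pot
        rw [← integral_neg]
        refine integral_congr_ae (Eventually.of_forall fun μ => ?_)
        simp only
        rw [hodd]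
        ring
      unfold outer
      rw [b2]
      linarith)
    (z := ⟨x, y⟩) hy1 (by simp only; linarith)
  rwa [(hG ⟨x, y⟩ ⟨hy1, by simp only; linarith⟩).2] at hkey

/-- Minimum principle for the outer density, if the kernels are subprobability densities at all
heights. -/
lemma IsWindow.le_outer_of_halfPlane (hW : S.IsWindow W) (hm : Measurable m)
    (hC : ∀ μ, |m μ| ≤ C) (hζ : 0 < ζ)
    (hJ : ∀ y, 0 < y → y ∈ S.J) (hN : ∀ y, 0 < y → 0 ≤ S.N y)
    (hmass : ∀ y, 0 < y → ∀ x, ∫ μ in W, S.p y (x - μ) ≤ 1) :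
    ∀ M ≤ 0, ∀ y₀, ζ / 2 < y₀ → y₀ < ζ → (∀ x, M ≤ S.outer W m ζ y₀ x) →
      ∀ y, y₀ ≤ y → y < ζ → ∀ x, M ≤ S.outer W m ζ y x := by
  intro M hM y₀ h1 h2 hb y hy1 hy2 x
  have hC0 : 0 ≤ C := (abs_nonneg _).trans (hC 0)
  obtain ⟨G, hG⟩ := hW.exists_analytic_outer hm hC (J' := Set.Ici y₀) (ζ := ζ) (y₀ := y₀)
    Set.self_mem_Ici (fun y (hy : y₀ ≤ y) => ⟨hJ _ (by linarith), hJ _ (by linarith), hJ _ (by linarith)⟩)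
  have hpot : ∀ y, 0 < y → ∀ x, S.pot W m y x ≤ C := by
    intro y hy x
    refine (le_abs_self _).trans ((hW.abs_pot_le (hJ y hy) hC x).trans ?_)
    refine mul_le_of_le_one_right hC0 ?_
    simp_rw [abs_of_nonneg (p_nonneg (hJ y hy) (hN y hy) _)]
    exact hmass y hy x
  have hkey := le_re_of_le_re_boundary_halfPlane (G := G) (a := y₀) (M := M)
    (C := 2 * C) (fun z a1 => (hG z a1).1)
    (fun z a1 => by
      rw [(hG z a1).2]
      have b1 := p_nonneg (hJ z.im (by linarith)) (hN z.im (by linarith)) z.re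
      have b3 := hpot (z.im + ζ / 2) (by linarith) z.re
      have b4 := hpot (z.im - ζ / 2) (by linarith) z.re
      unfold outer
      linarith)
    (fun z hz => by
      rw [(hG z hz.ge).2, hz]
      exact hb _)
    (z := ⟨x, y⟩) hy1
  rwa [(hG ⟨x, y⟩ hy1).2] at hkey

/-- The kernels `p ε` form an approximate identity as `ε → 0`. -/
lemma eventually_pot_le {r : ℝ → ℝ} {R : ℝ} (hS : S.IsAdmissible ζ)
    (hU : MeasurableSet U)
    (hconv : ∀ y ∈ S.J, ∀ x, S.pot W r y x = ∫ u in U, S.p y u * r (x - u))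
    (hint : IntegrableOn (fun u => 1 / (S.A u + 1)) U)
    (hmass : ∀ y, 0 < y → y < ζ → ∫ u in U, S.p y u ≤ 1) (hN0 : S.N 0 = 0)
    (hA : ∀ δ > 0, ∃ c > 0, ∀ u ∈ U, δ ≤ |u| → c * (S.A u + 1) ≤ S.A u)
    (hr0 : ∀ x, 0 ≤ r x) (hrR : ∀ x, r x ≤ R) (hr : UniformContinuous r) :
    ∀ η > 0, ∀ᶠ ε in 𝓝[>] (0 : ℝ), ∀ x, S.pot W r ε x ≤ r x + η := by
  intro η hη
  have hR0 : 0 ≤ R := (hr0 0).trans (hrR 0)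
  obtain ⟨δ, hδ, hδr⟩ := Metric.uniformContinuous_iff.1 hr (η / 2) (by positivity)
  obtain ⟨c, hc, hcA⟩ := hA δ hδ
  set E := ∫ u in U, 1 / (S.A u + 1)
  have hE0 : 0 ≤ E := integral_nonneg fun u => (one_div_pos.2 (S.A_add_pos one_pos u)).le
  have ht : Tendsto (fun ε => R * (S.N ε / (2 * Real.pi * c)) * E) (𝓝[>] 0) (𝓝 0) := by
    have h := (((S.continuous_N.div_const (2 * Real.pi * c)).const_mul R).mul_const E).tendsto 0
    rw [hN0] at h
    simpa using h.mono_left nhdsWithin_le_nhds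
  filter_upwards [ht.eventually (gt_mem_nhds (half_pos hη)), Ioo_mem_nhdsGT hS.pos] with ε h1 hε x
  have hζ := hS.pos
  have hJ : ε ∈ S.J := hS.mem_J ε hε.1 (by linarith [hε.2])
  have hN := hS.N_nonneg ε hε.1 hε.2.le
  have hB := S.B_pos ε hJ
  have hpint : IntegrableOn (fun u => S.p ε u) U :=
    Integrable.mono' (hint.const_mul _) (S.continuous_p hJ).aestronglyMeasurable
      (Eventually.of_forall fun u => abs_p_le hJ u)
  rw [hconv ε hJ x]
  calc ∫ u in U, S.p ε u * r (x - u)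
      ≤ ∫ u in U, (S.p ε u * (r x + η / 2) + R * (S.N ε / (2 * Real.pi * c)) * (1 / (S.A u + 1))) := by
        refine setIntegral_mono_on ?_ ?_ hU ?_
        · exact hpint.mul_bdd (c := R) (hr.continuous.comp (continuous_const.sub continuous_id)).aestronglyMeasurable
            (Eventually.of_forall fun u => by
              rw [Real.norm_eq_abs, abs_of_nonneg (hr0 _)]
              exact hrR _)
        · exact (hpint.mul_const _).add (hint.const_mul _)
        · intro u hu
          have hp := p_nonneg hJ hN u
          have hA1 := S.A_add_pos one_pos u
          rcases lt_or_ge |u| δ with hlt | hge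
          · have h2 := hδr (a := x - u) (b := x) (by simpa [Real.dist_eq] using hlt)
            rw [Real.dist_eq] at h2
            have h3 : r (x - u) ≤ r x + η / 2 := by linarith [(abs_lt.1 h2).2]
            have h4 := mul_le_mul_of_nonneg_left h3 hp
            have h5 : 0 ≤ R * (S.N ε / (2 * Real.pi * c)) * (1 / (S.A u + 1)) := by positivity
            linarith
          · have h2 : S.p ε u ≤ S.N ε / (2 * Real.pi * c) * (1 / (S.A u + 1)) := by
              have hcu := hcA u hu hge
              unfold p
              rw [div_mul_div_comm, mul_one]
              refine div_le_div_of_nonneg_left hN (by positivity) ?_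
              rw [mul_assoc (2 * Real.pi)]
              exact mul_le_mul_of_nonneg_left (by linarith) (by positivity)
            have h3 : S.p ε u * r (x - u) ≤ (S.N ε / (2 * Real.pi * c) * (1 / (S.A u + 1))) * R :=
              mul_le_mul h2 (hrR _) (hr0 _) (by positivity)
            have h4 : 0 ≤ S.p ε u * (r x + η / 2) := mul_nonneg hp (by linarith [hr0 x])
            linarith
    _ = (∫ u in U, S.p ε u) * (r x + η / 2) + R * (S.N ε / (2 * Real.pi * c)) * E := by
        rw [integral_add (hpint.mul_const _) (hint.const_mul _), integral_mul_const, integral_const_mul]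
    _ ≤ 1 * (r x + η / 2) + η / 2 := by
        gcongr
        · linarith [hr0 x]
        · exact hmass ε hε.1 hε.2
    _ = r x + η := by ring

lemma uniformContinuous_of_abs_sub_le {f : ℝ → ℝ} {L : ℝ}
    (h : ∀ x y, |x - y| ≤ 1 → |f x - f y| ≤ L * |x - y|) : UniformContinuous f := by
  refine Metric.uniformContinuous_iff.2 fun ε hε => ⟨min 1 (ε / (|L| + 1)), by positivity, ?_⟩
  intro x y hxy
  rw [Real.dist_eq] at *
  have h1 := h x y (hxy.le.trans (min_le_left _ _))
  have h2 := hxy.trans_le (min_le_right _ _)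
  rw [lt_div_iff₀ (by positivity)] at h2
  nlinarith [le_abs_self L, abs_nonneg (x - y)]

lemma IsWindow.exists_abs_density_sub_le (hW : S.IsWindow W) (hm : Measurable m)
    (hC : ∀ μ, |m μ| ≤ C) {y y' : ℝ} (hy : y ∈ S.J) (hy' : y' ∈ S.J) :
    ∃ L, ∀ x x', |x - x'| ≤ 1 → |(S.p y x - S.pot W m y' x) - (S.p y x' - S.pot W m y' x')|
      ≤ L * |x - x'| := by
  obtain ⟨L, hL0, hL⟩ := hW.exists_abs_pot_sub_le hy'
  obtain ⟨c, hc0, hc⟩ := S.abs_p_sub_le hy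
  have hC0 : 0 ≤ C := (abs_nonneg _).trans (hC 0)
  refine ⟨c * (|S.N y| / (2 * Real.pi) * (1 / min 1 (S.B y))) + C * L, fun x x' hx => ?_⟩
  have h1 := hL m C hm hC0 hC x x' hx
  have h2 := (hc x x' hx).trans (mul_le_mul_of_nonneg_left (p_le hy x') (by positivity))
  calc _ = |(S.p y x - S.p y x') - (S.pot W m y' x - S.pot W m y' x')| := by ring_nf
    _ ≤ _ := (abs_sub _ _).trans (add_le_add h2 h1)
    _ = _ := by ring

end StripKernel

section
open scoped BoundedContinuousFunction

/-- Truncation to the interval `[-D/2, D/2]`. -/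
def clamp (D x : ℝ) : ℝ := max (-(D / 2)) (min x (D / 2))

section clamp
variable {D : ℝ}

lemma abs_clamp_le (hD : 0 ≤ D) (x : ℝ) : |clamp D x| ≤ D / 2 :=
  abs_le.2 ⟨le_max_left _ _, max_le (by linarith) (min_le_right _ _)⟩

lemma continuous_clamp : Continuous (clamp D) :=
  continuous_const.max (continuous_id.min continuous_const)

lemma monotone_clamp : Monotone (clamp D) := fun _ _ h =>
  max_le_max le_rfl (min_le_min h le_rfl)

lemma clamp_sub_le {x y : ℝ} (h : x ≤ y) : clamp D y - clamp D x ≤ y - x := by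
  unfold clamp
  rcases le_total x (D / 2) with h1 | h1 <;> rcases le_total y (D / 2) with h2 | h2 <;>
  simp only [h1, h2, min_eq_left, min_eq_right] <;>
  rcases max_cases (-(D / 2)) x with h3 | h3 <;> rcases max_cases (-(D / 2)) y with h4 | h4 <;>
  rcases max_cases (-(D / 2)) (D / 2) with h5 | h5 <;> linarith

lemma clamp_of_mem {x : ℝ} (h1 : -(D / 2) ≤ x) (h2 : x ≤ D / 2) : clamp D x = x := by
  unfold clamp
  rw [min_eq_left h2, max_eq_right h1]

lemma clamp_of_ge (hD : 0 ≤ D) {x : ℝ} (h : D / 2 ≤ x) : clamp D x = D / 2 := by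
  unfold clamp
  rw [min_eq_right h, max_eq_right (by linarith)]

lemma clamp_of_le {x : ℝ} (h : x ≤ -(D / 2)) : clamp D x = -(D / 2) := by
  unfold clamp
  exact max_eq_left ((min_le_left _ _).trans h)

lemma clamp_neg (hD : 0 ≤ D) (x : ℝ) : clamp D (-x) = -clamp D x := by
  rcases le_total x (-(D / 2)) with h | h
  · rw [clamp_of_le h, clamp_of_ge hD (by linarith), neg_neg]
  · rcases le_total x (D / 2) with h2 | h2
    · rw [clamp_of_mem h h2, clamp_of_mem (by linarith) (by linarith)]
    · rw [clamp_of_ge hD h2, clamp_of_le (by linarith)]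

end clamp

/-- `a` lies between `0` and `b`. -/
def Between (a b : ℝ) : Prop := 0 ≤ a * b ∧ |a| ≤ |b|

lemma between_of_monotone {T : ℝ → ℝ} (hT : Monotone T) (h : ∀ x y, x ≤ y → T y - T x ≤ y - x)
    (x y : ℝ) : Between (T x - T y) (x - y) := by
  rcases le_total x y with hxy | hxy
  · have h1 := hT hxy
    refine ⟨mul_nonneg_of_nonpos_of_nonpos (by linarith) (by linarith), ?_⟩
    rw [abs_of_nonpos (by linarith), abs_of_nonpos (by linarith)]
    linarith [h x y hxy]
  · have h1 := hT hxy
    refine ⟨mul_nonneg (by linarith) (by linarith), ?_⟩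
    rw [abs_of_nonneg (by linarith), abs_of_nonneg (by linarith)]
    exact h y x hxy

lemma between_clamp (D x y : ℝ) : Between (clamp D x - clamp D y) (x - y) :=
  between_of_monotone monotone_clamp (fun _ _ h => clamp_sub_le h) x y

lemma Between.neg {a b : ℝ} (h : Between a b) : Between (-a) (-b) := by
  refine ⟨by simpa using h.1, by simpa using h.2⟩

lemma abs_clamp_sub_le (D x y : ℝ) : |clamp D x - clamp D y| ≤ |x - y| := (between_clamp D x y).2

/-- Solution of the truncated equation for a kernel of `L¹`-norm less than one. -/
lemma exists_clamp_solution {W : Set ℝ} {k s : ℝ → ℝ} {κ D : ℝ} (hD : 0 ≤ D)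
    (hs : Continuous s) (hk : ∀ x, IntegrableOn (fun μ => k (x - μ)) W)
    (hκ0 : 0 ≤ κ) (hκ : κ < 1) (hkκ : ∀ x, ∫ μ in W, |k (x - μ)| ≤ κ)
    (hcont : ∀ b : ℝ → ℝ, Measurable b → (∀ μ, |b μ| ≤ D / 2) →
      Continuous fun x => ∫ μ in W, k (x - μ) * b μ) :
    ∃ v : ℝ → ℝ, Continuous v ∧ (∀ x, |v x| ≤ D / 2) ∧
      ∀ x, v x = -∫ μ in W, k (x - μ) * clamp D (s μ + v μ) := by
  have hbdd : ∀ b : ℝ → ℝ, Measurable b → ∀ C, (∀ μ, |b μ| ≤ C) → ∀ x,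
      |∫ μ in W, k (x - μ) * b μ| ≤ κ * C := by
    intro b hb C hC x
    have hC0 : 0 ≤ C := (abs_nonneg _).trans (hC 0)
    calc _ ≤ ∫ μ in W, |k (x - μ) * b μ| := abs_integral_le_integral_abs
      _ ≤ ∫ μ in W, |k (x - μ)| * C := by
          refine integral_mono_of_nonneg (Eventually.of_forall fun _ => abs_nonneg _)
            ((hk x).abs.mul_const C) (Eventually.of_forall fun μ => ?_)
          simp only [abs_mul]
          exact mul_le_mul_of_nonneg_left (hC μ) (abs_nonneg _)
      _ ≤ κ * C := by
          rw [integral_mul_const]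
          exact mul_le_mul_of_nonneg_right (hkκ x) hC0
  have hmeas : ∀ v : ℝ →ᵇ ℝ, Continuous fun μ => clamp D (s μ + v μ) := fun v =>
    continuous_clamp.comp (hs.add v.continuous)
  let Φ : (ℝ →ᵇ ℝ) → (ℝ →ᵇ ℝ) := fun v => BoundedContinuousFunction.ofNormedAddCommGroup
    (fun x => -∫ μ in W, k (x - μ) * clamp D (s μ + v μ))
    (hcont _ (hmeas v).measurable (fun μ => abs_clamp_le hD _)).neg (κ * (D / 2))
    (fun x => by
      rw [Real.norm_eq_abs, abs_neg]
      exact hbdd _ (hmeas v).measurable _ (fun μ => abs_clamp_le hD _) x)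
  have hΦ : ContractingWith κ.toNNReal Φ := by
    refine ⟨by simpa using hκ, LipschitzWith.of_dist_le_mul fun v w => ?_⟩
    rw [Real.coe_toNNReal κ hκ0, BoundedContinuousFunction.dist_le (mul_nonneg hκ0 dist_nonneg)]
    intro x
    have hint : ∀ v : ℝ →ᵇ ℝ, IntegrableOn (fun μ => k (x - μ) * clamp D (s μ + v μ)) W := fun v =>
      (hk x).mul_bdd (hmeas v).aestronglyMeasurable
        (Eventually.of_forall fun μ => abs_clamp_le hD _)
    have e : Φ v x - Φ w x = -∫ μ in W, k (x - μ) * (clamp D (s μ + v μ) - clamp D (s μ + w μ)) := by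
      simp only [Φ, BoundedContinuousFunction.coe_ofNormedAddCommGroup, mul_sub]
      rw [integral_sub (hint v) (hint w)]
      ring
    rw [Real.dist_eq, e, abs_neg]
    refine hbdd _ ((hmeas v).sub (hmeas w)).measurable _ (fun μ => ?_) x
    refine (abs_clamp_sub_le _ _ _).trans ?_
    rw [add_sub_add_left_eq_sub, ← Real.dist_eq]
    exact v.dist_coe_le_dist μ
  set v := hΦ.fixedPoint Φ
  have hv : Φ v = v := hΦ.fixedPoint_isFixedPt
  have hv' : ∀ x, v x = -∫ μ in W, k (x - μ) * clamp D (s μ + v μ) := fun x => by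
    conv_lhs => rw [← hv]
    rfl
  refine ⟨v, v.continuous, fun x => ?_, hv'⟩
  rw [hv' x, abs_neg]
  refine (hbdd _ (hmeas v).measurable _ (fun μ => abs_clamp_le hD _) x).trans ?_
  nlinarith

/-- Uniqueness for a kernel of `L¹`-norm less than one. -/
lemma eq_zero_of_contraction {W : Set ℝ} {k h h₂ : ℝ → ℝ} {κ C : ℝ}
    (hk : ∀ x, IntegrableOn (fun μ => k (x - μ)) W)
    (hκ : κ < 1) (hκ0 : 0 ≤ κ) (hkκ : ∀ x, ∫ μ in W, |k (x - μ)| ≤ κ)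
    (hC : ∀ x, |h x| ≤ C) (hb : ∀ x, |h₂ x| ≤ |h x|)
    (heq : ∀ x, h x = -∫ μ in W, k (x - μ) * h₂ μ) (x : ℝ) : h x = 0 := by
  have hstep : ∀ C, (∀ x, |h x| ≤ C) → ∀ x, |h x| ≤ κ * C := by
    intro C hC x
    rw [heq x, abs_neg]
    calc _ ≤ ∫ μ in W, |k (x - μ) * h₂ μ| := abs_integral_le_integral_abs
      _ ≤ ∫ μ in W, |k (x - μ)| * C := by
          refine integral_mono_of_nonneg (Eventually.of_forall fun _ => abs_nonneg _)
            ((hk x).abs.mul_const C) (Eventually.of_forall fun μ => ?_)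
          simp only [abs_mul]
          exact mul_le_mul_of_nonneg_left ((hb μ).trans (hC μ)) (abs_nonneg _)
      _ ≤ κ * C := by
          rw [integral_mul_const]
          exact mul_le_mul_of_nonneg_right (hkκ x) ((abs_nonneg _).trans (hC x))
  have hn : ∀ n : ℕ, ∀ x, |h x| ≤ κ ^ n * C := by
    intro n
    induction n with
    | zero => simpa using hC
    | succ n ih =>
      intro x
      rw [pow_succ']
      rw [mul_assoc]
      exact hstep _ ih x
  have ht : Tendsto (fun n : ℕ => κ ^ n * C) atTop (𝓝 0) := by
    simpa using (tendsto_pow_atTop_nhds_zero_of_lt_one hκ0 hκ).mul_const C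
  exact abs_nonpos_iff.1 (ge_of_tendsto' ht fun n => hn n x)

/-- Uniqueness for a positive kernel bounded below on a set of finite measure. -/
lemma eq_zero_of_doeblin {W : Set ℝ} {k h h₂ : ℝ → ℝ} {c C : ℝ}
    (hk : ∀ x, IntegrableOn (fun μ => k (x - μ)) W) (hW : MeasurableSet W)
    (hWfin : volume W ≠ ⊤) (hc : 0 < c) (hkc : ∀ x, c ≤ k x)
    (hk1 : ∀ x, ∫ μ in W, k (x - μ) = 1) (hm : Measurable h₂)
    (hC : ∀ x, |h x| ≤ C) (hb : ∀ x ∈ W, Between (h₂ x) (h x))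
    (heq : ∀ x, h x = -∫ μ in W, k (x - μ) * h₂ μ) (x : ℝ) : h x = 0 := by
  have : IsFiniteMeasure (volume.restrict W) := ⟨by
    rw [Measure.restrict_apply_univ]
    exact hWfin.lt_top⟩
  set V := ∫ _ in W, (1 : ℝ)
  set M := ⨆ x, |h x|
  have hbd : BddAbove (Set.range fun x => |h x|) := ⟨C, by rintro _ ⟨x, rfl⟩; exact hC x⟩
  have hM : ∀ x, |h x| ≤ M := fun x => le_ciSup hbd x
  have hM0 : 0 ≤ M := (abs_nonneg _).trans (hM 0)
  have h2M : ∀ᵐ μ ∂volume.restrict W, |h₂ μ| ≤ M := by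
    filter_upwards [ae_restrict_mem hW] with μ hμ using (hb μ hμ).2.trans (hM μ)
  have hint2 : IntegrableOn h₂ W := Integrable.mono' (integrable_const M) hm.aestronglyMeasurable h2M
  have hintk : ∀ x, IntegrableOn (fun μ => k (x - μ) * h₂ μ) W := fun x =>
    (hk x).mul_bdd hm.aestronglyMeasurable h2M
  set α := ∫ μ in W, h₂ μ
  have h1 : ∀ x, |h x| ≤ (1 - c * V) * M + c * |α| := by
    intro x
    have e : h x = -(∫ μ in W, (k (x - μ) - c) * h₂ μ) - c * α := by
      rw [heq x]
      simp only [sub_mul]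
      rw [integral_sub (hintk x) (hint2.const_mul c), integral_const_mul]
      ring
    have e2 : |∫ μ in W, (k (x - μ) - c) * h₂ μ| ≤ (1 - c * V) * M := by
      calc _ ≤ ∫ μ in W, |(k (x - μ) - c) * h₂ μ| := abs_integral_le_integral_abs
        _ ≤ ∫ μ in W, (k (x - μ) - c * 1) * M := by
            refine integral_mono_of_nonneg (Eventually.of_forall fun _ => abs_nonneg _)
              (((hk x).sub (integrable_const (c * 1))).mul_const M) ?_
            filter_upwards [h2M] with μ hμ
            rw [abs_mul, mul_one, abs_of_nonneg (sub_nonneg.2 (hkc _))]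
            exact mul_le_mul_of_nonneg_left hμ (sub_nonneg.2 (hkc _))
        _ = (1 - c * V) * M := by
            rw [integral_mul_const, integral_sub (hk x) (integrable_const _), hk1 x,
              integral_const_mul]
    rw [e]
    refine (abs_sub _ _).trans ?_
    rw [abs_neg, abs_mul, abs_of_pos hc]
    linarith
  have h2 : M ≤ (1 - c * V) * M + c * |α| := ciSup_le h1
  have h3 : V * M ≤ |α| := by nlinarith
  have hVM : ∫ _ in W, M = V * M := by
    rw [← integral_mul_const]; simp
  have hzero : ∀ σ : ℝ, σ ^ 2 = 1 → V * M ≤ σ * α → M = 0 := by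
    intro σ hσ hα
    have hσ1 : |σ| = 1 := by
      rw [← sq_abs] at hσ
      nlinarith [abs_nonneg σ]
    have h4 : ∫ μ in W, (M - σ * h₂ μ) = 0 := by
      refine le_antisymm ?_ ?_
      · rw [integral_sub (integrable_const _) (hint2.const_mul σ), integral_const_mul, hVM]
        linarith
      · refine integral_nonneg_of_ae ?_
        filter_upwards [h2M] with μ hμ
        have : |σ * h₂ μ| ≤ M := by rw [abs_mul, hσ1, one_mul]; exact hμ
        simpa using (le_abs_self _).trans this
    have h5 : (fun μ => M - σ * h₂ μ) =ᵐ[volume.restrict W] 0 := by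
      refine (integral_eq_zero_iff_of_nonneg_ae ?_ ((integrable_const _).sub (hint2.const_mul σ))).1 h4
      filter_upwards [h2M] with μ hμ
      have : |σ * h₂ μ| ≤ M := by rw [abs_mul, hσ1, one_mul]; exact hμ
      simpa using (le_abs_self _).trans this
    have h6 : h₂ =ᵐ[volume.restrict W] fun _ => σ * M := by
      filter_upwards [h5] with μ hμ
      simp only [Pi.zero_apply] at hμ
      linear_combination (-σ) * hμ - (h₂ μ) * hσ
    have h7 : ∀ x, h x = -(σ * M) := by
      intro x
      rw [heq x]
      have : ∫ μ in W, k (x - μ) * h₂ μ = ∫ μ in W, k (x - μ) * (σ * M) := by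
        refine integral_congr_ae ?_
        filter_upwards [h6] with μ hμ
        rw [hμ]
      rw [this, integral_mul_const, hk1 x, one_mul]
    by_contra hne
    have hae : ∀ᵐ μ ∂volume.restrict W, False := by
      filter_upwards [h6, ae_restrict_mem hW] with μ hμ hμW
      have := (hb μ hμW).1
      rw [hμ, h7 μ] at this
      have h8 : 0 < M ^ 2 := by positivity
      nlinarith
    have h9 : volume.restrict W = 0 := by
      rw [← Measure.measure_univ_eq_zero]
      simpa [ae_iff] using hae
    have := hk1 0
    rw [h9] at this
    simp at this
  have hMz : M = 0 := by
    rcases le_total 0 α with h | h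
    · exact hzero 1 (by norm_num) (by rw [abs_of_nonneg h] at h3; linarith)
    · exact hzero (-1) (by norm_num) (by rw [abs_of_nonpos h] at h3; linarith)
  exact abs_nonpos_iff.1 (hMz ▸ hM x)

/-- Stability for a positive kernel of mass at most one on the line. -/
lemma exists_stability {k : ℝ → ℝ} {c δ₀ : ℝ} (hk : Integrable k) (hk0 : ∀ x, 0 ≤ k x)
    (hk1 : ∫ x, k x ≤ 1) (hc : 0 < c) (hδ₀ : 0 < δ₀) (hkc : ∀ x, |x| < δ₀ → c ≤ k x)
    {L η : ℝ} (hL : 0 ≤ L) (hη : 0 < η) :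
    ∃ e > 0, ∀ (h h₂ : ℝ → ℝ) (C : ℝ), Measurable h₂ → (∀ x, |h x| ≤ C) →
      (∀ x y, |x - y| ≤ 1 → |h x - h y| ≤ L * |x - y|) → (∀ x, Between (h₂ x) (h x)) →
      (∀ x, |h x + ∫ μ, k (x - μ) * h₂ μ| ≤ e) → ∀ x, |h x| ≤ η := by
  set δ := min δ₀ (min 1 (η / (2 * (L + 1))))
  have hδ : 0 < δ := by positivity
  have hδ1 : δ ≤ 1 := (min_le_right _ _).trans (min_le_left _ _)
  have hδ2 : L * δ ≤ η / 2 := by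
    have : δ ≤ η / (2 * (L + 1)) := (min_le_right _ _).trans (min_le_right _ _)
    rw [le_div_iff₀ (by positivity)] at this
    nlinarith
  refine ⟨min (η / 4) (δ * c * η / 2), by positivity, ?_⟩
  set e := min (η / 4) (δ * c * η / 2)
  have he1 : e ≤ η / 4 := min_le_left _ _
  have he2 : e ≤ δ * c * η / 2 := min_le_right _ _
  have he0 : 0 < e := by positivity
  intro h h₂ C hm hC hlip hb heq
  have hbd : BddAbove (Set.range fun x => |h x|) := ⟨C, by rintro _ ⟨x, rfl⟩; exact hC x⟩
  set M := ⨆ x, |h x|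
  have hM : ∀ x, |h x| ≤ M := fun x => le_ciSup hbd x
  have hM0 : 0 ≤ M := (abs_nonneg _).trans (hM 0)
  by_contra hcon
  push Not at hcon
  obtain ⟨x₀, hx₀⟩ := hcon
  have hMη : η < M := hx₀.trans_le (hM x₀)
  have key : ∀ g g₂ : ℝ → ℝ, Measurable g₂ → (∀ x, |g x| ≤ M) →
      (∀ x y, |x - y| ≤ 1 → |g x - g y| ≤ L * |x - y|) → (∀ x, Between (g₂ x) (g x)) →
      (∀ x, |g x + ∫ μ, k (x - μ) * g₂ μ| ≤ e) → ∀ x, ¬ M - e < g x := by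
    intro g g₂ hm hgM hlip hb heq x hx
    have hkx : Integrable fun μ => k (x - μ) := hk.comp_sub_left x
    have hg2M : ∀ μ, |g₂ μ| ≤ M := fun μ => (hb μ).2.trans (hgM μ)
    have hint : Integrable fun μ => k (x - μ) * g₂ μ :=
      hkx.mul_bdd hm.aestronglyMeasurable (Eventually.of_forall hg2M)
    have hint2 : Integrable fun μ => k (x - μ) * (M + g₂ μ) := by
      simp only [mul_add]
      exact (hkx.mul_const M).add hint
    have hnn : ∀ μ, 0 ≤ k (x - μ) * (M + g₂ μ) := fun μ =>
      mul_nonneg (hk0 _) (by linarith [(abs_le.1 (hg2M μ)).1])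
    have hup : ∫ μ, k (x - μ) * (M + g₂ μ) ≤ 2 * e := by
      simp only [mul_add]
      rw [integral_add (hkx.mul_const M) hint, integral_mul_const, integral_sub_left_eq_self k volume x]
      have := (abs_le.1 (heq x)).2
      nlinarith
    have hlow : ∫ μ in Set.Ioo (x - δ) (x + δ), c * M ≤ ∫ μ, k (x - μ) * (M + g₂ μ) := by
      refine le_trans ?_ (setIntegral_le_integral (s := Set.Ioo (x - δ) (x + δ)) hint2
        (Eventually.of_forall hnn))
      refine setIntegral_mono_on (integrableOn_const (by simp)) hint2.integrableOn measurableSet_Ioo ?_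
      intro μ hμ
      have hxμ : |x - μ| < δ := abs_lt.2 ⟨by linarith [hμ.2], by linarith [hμ.1]⟩
      have h1 := (abs_le.1 (hlip x μ (hxμ.le.trans hδ1))).2
      have h2 : L * |x - μ| ≤ η / 2 := (mul_le_mul_of_nonneg_left hxμ.le hL).trans hδ2
      have h3 : 0 < g μ := by linarith
      have h4 : 0 ≤ g₂ μ := nonneg_of_mul_nonneg_left (hb μ).1 h3
      have h5 := hkc (x - μ) (hxμ.trans_le (min_le_left _ _))
      exact mul_le_mul h5 (by linarith) hM0 (hk0 _)
    rw [setIntegral_const] at hlow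
    simp only [Measure.real, Real.volume_Ioo, smul_eq_mul] at hlow
    rw [ENNReal.toReal_ofReal (by linarith)] at hlow
    have : δ * c * η < δ * c * M := by gcongr
    nlinarith
  obtain ⟨x, hx⟩ := exists_lt_of_lt_ciSup (show M - e < ⨆ x, |h x| by
    change M - e < M
    linarith)
  rcases abs_cases (h x) with hx2 | hx2
  · exact key h h₂ hm hM hlip hb heq x (by rw [← hx2.1]; exact hx)
  · refine key (fun x => -h x) (fun x => -h₂ x) hm.neg (fun x => by simpa using hM x)
      (fun x y hxy => ?_) (fun x => (hb x).neg) (fun x => ?_) x (by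
        show M - e < -h x
        rw [← hx2.1]; exact hx)
    · rw [neg_sub_neg, abs_sub_comm]
      exact hlip x y hxy
    · simp only [mul_neg]
      rw [integral_neg, ← neg_add, abs_neg]
      exact heq x

end

lemma Between.le_max {a b : ℝ} (h : Between a b) : a ≤ max b 0 := by
  rcases le_total b 0 with hb | hb
  · rcases eq_or_lt_of_le hb with rfl | hb
    · have := h.2
      rw [abs_zero] at this
      rw [abs_nonpos_iff.1 this]; simp
    · exact (nonpos_of_mul_nonneg_left h.1 hb).trans (le_max_right _ _)
  · exact ((le_abs_self a).trans (h.2.trans_eq (abs_of_nonneg hb))).trans (le_max_left _ _)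

lemma Between.min_le {a b : ℝ} (h : Between a b) : min b 0 ≤ a := by
  have := h.neg.le_max
  rcases le_total b 0 with hb | hb
  · rw [min_eq_left hb]; rw [max_eq_left (by linarith)] at this; linarith
  · rw [min_eq_right hb]; rw [max_eq_right (by linarith)] at this; linarith

lemma between_zero (b : ℝ) : Between 0 b := ⟨by simp, by simp⟩

lemma between_self (b : ℝ) : Between b b := ⟨mul_self_nonneg b, le_rfl⟩

/-- Truncation passes to derivatives. -/
lemma between_of_hasDerivAt {f g : ℝ → ℝ} {f' g' x : ℝ} (hf : HasDerivAt f f' x)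
    (hg : HasDerivAt g g' x) (h : ∀ y, Between (g y - g x) (f y - f x)) : Between g' f' := by
  rw [hasDerivAt_iff_tendsto_slope] at hf hg
  have e : ∀ y, Between (slope g x y) (slope f x y) := by
    intro y
    simp only [slope, vsub_eq_sub, smul_eq_mul]
    refine ⟨?_, ?_⟩
    · rw [mul_mul_mul_comm]
      exact mul_nonneg (mul_self_nonneg _) (h y).1
    · rw [abs_mul, abs_mul]
      exact mul_le_mul_of_nonneg_left (h y).2 (abs_nonneg _)
  exact ⟨ge_of_tendsto' (hg.mul hf) fun y => (e y).1,
    le_of_tendsto_of_tendsto' hg.abs hf.abs fun y => (e y).2⟩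

lemma lipschitz_of_local {f : ℝ → ℝ} {L C : ℝ} (hC : ∀ x, |f x| ≤ C)
    (h : ∀ x y, |x - y| ≤ 1 → |f x - f y| ≤ L * |x - y|) :
    ∃ K : NNReal, LipschitzWith K f := by
  refine ⟨Real.toNNReal (max L (2 * C)), LipschitzWith.of_dist_le_mul fun x y => ?_⟩
  have hC0 : 0 ≤ C := (abs_nonneg _).trans (hC 0)
  rw [Real.coe_toNNReal _ (le_max_of_le_right (by positivity)), Real.dist_eq, Real.dist_eq]
  rcases le_total |x - y| 1 with hxy | hxy
  · exact (h x y hxy).trans (mul_le_mul_of_nonneg_right (le_max_left _ _) (abs_nonneg _))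
  · have h1 : |f x - f y| ≤ 2 * C := (abs_sub _ _).trans (by linarith [hC x, hC y])
    calc _ ≤ 2 * C := h1
      _ ≤ max L (2 * C) * 1 := by rw [mul_one]; exact le_max_right _ _
      _ ≤ _ := by
        refine mul_le_mul_of_nonneg_left hxy (le_max_of_le_right (by positivity))

/-- The properties of the kernel `p ζ` and of the source term `s` on the line from which the
solution theory of the boundary problems is derived. -/
structure LineSystem (S : StripKernel) (ζ κ : ℝ) (s : ℝ → ℝ) : Prop where
  window : S.IsWindow Set.univ
  mem : ζ ∈ S.J
  mem_half : ζ / 2 ∈ S.J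
  even_A : ∀ x, S.A (-x) = S.A x
  hasDerivAt_s : ∀ x, HasDerivAt s (S.p (ζ / 2) x) x
  s_neg : ∀ x, s (-x) = -s x
  s_bdd : ∃ C, ∀ x, |s x| ≤ C
  tendsto_s : Tendsto s atTop (𝓝 ((1 + κ) / 4))
  integral_p : ∫ x, S.p ζ x = κ
  neg_one_lt : -1 < κ
  density_pos : ∀ (m ρ : ℝ → ℝ) (C : ℝ), Measurable m → (∀ μ, |m μ| ≤ C) →
    (∀ x, ρ x = S.p (ζ / 2) x - S.pot Set.univ m ζ x) → (∀ μ, Between (m μ) (ρ μ)) →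
    (∀ x, 0 ≤ ρ x) ∧ ∀ a b, a < b → ∃ x ∈ Set.Ioo a b, ρ x ≠ 0
  uniq : ∀ (h h₂ : ℝ → ℝ) (C : ℝ), Measurable h₂ → (∀ x, |h x| ≤ C) →
    (∀ x, Between (h₂ x) (h x)) → (∀ x, h x = -S.pot Set.univ h₂ ζ x) → ∀ x, h x = 0
  exist : ∀ D, 0 ≤ D → D ≤ 1 / 2 → ∃ v : ℝ → ℝ, Measurable v ∧ (∀ x, |v x| ≤ D / 2) ∧
    ∀ x, v x = -S.pot Set.univ (fun μ => clamp D (s μ + v μ)) ζ x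

lemma strictMono_of_deriv_nonneg {f ρ : ℝ → ℝ} (hf : ∀ x, HasDerivAt f (ρ x) x)
    (h0 : ∀ x, 0 ≤ ρ x) (h1 : ∀ a b, a < b → ∃ x ∈ Set.Ioo a b, ρ x ≠ 0) : StrictMono f := by
  have hmono : Monotone f := monotone_of_deriv_nonneg (fun x => (hf x).differentiableAt)
    fun x => by rw [(hf x).deriv]; exact h0 x
  intro a b hab
  refine lt_of_le_of_ne (hmono hab.le) fun heq => ?_
  obtain ⟨x, hx, hne⟩ := h1 a b hab
  refine hne ((hf x).unique ?_)
  refine (hasDerivAt_const x (f a)).congr_of_eventuallyEq ?_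
  filter_upwards [Ioo_mem_nhds hx.1 hx.2] with y hy
  exact le_antisymm (heq ▸ hmono hy.2.le) (hmono hy.1.le)

/-- A bounded measurable density between `ρ` and `0` which is almost everywhere equal to a given
one. -/
lemma exists_between_ae_eq {d ρ : ℝ → ℝ} {L : ℝ} (hd : Measurable d) (hL : ∀ x, |d x| ≤ L)
    (hρ : Measurable ρ) (h : ∀ᵐ x, Between (d x) (ρ x)) :
    ∃ m : ℝ → ℝ, Measurable m ∧ (∀ x, |m x| ≤ L) ∧ (∀ x, Between (m x) (ρ x)) ∧ m =ᵐ[volume] d := by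
  have hA : MeasurableSet {x | Between (d x) (ρ x)} :=
    (measurableSet_le measurable_const (hd.mul hρ)).inter (measurableSet_le hd.abs hρ.abs)
  refine ⟨Set.indicator {x | Between (d x) (ρ x)} d, hd.indicator hA, fun x => ?_, fun x => ?_, ?_⟩
  · by_cases hx : x ∈ {x | Between (d x) (ρ x)}
    · rw [Set.indicator_of_mem hx]; exact hL x
    · rw [Set.indicator_of_notMem hx, abs_zero]; exact (abs_nonneg _).trans (hL x)
  · by_cases hx : x ∈ {x | Between (d x) (ρ x)}
    · rw [Set.indicator_of_mem hx]; exact hx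
    · rw [Set.indicator_of_notMem hx]; exact between_zero _
  · filter_upwards [h] with x hx
    exact Set.indicator_of_mem (show x ∈ {x | Between (d x) (ρ x)} from hx) d

lemma abs_deriv_le_of_lipschitz {g : ℝ → ℝ} {L : NNReal} (hg : LipschitzWith L g) (x : ℝ) :
    |deriv g x| ≤ L := by
  have := norm_deriv_le_of_lipschitz hg (x₀ := x)
  rwa [Real.norm_eq_abs] at this

namespace LineSystem
variable {S : StripKernel} {ζ κ : ℝ} {s : ℝ → ℝ} {D : ℝ}

lemma p_neg (H : LineSystem S ζ κ s) (y x : ℝ) : S.p y (-x) = S.p y x := by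
  unfold StripKernel.p
  rw [H.even_A]

lemma integrable_p (H : LineSystem S ζ κ s) : Integrable (S.p ζ) := by
  have h := H.window.integrableOn_p H.mem 0
  rw [integrableOn_univ] at h
  refine h.congr (Eventually.of_forall fun μ => ?_)
  simp only [zero_sub]
  exact H.p_neg ζ μ

lemma pot_eq (b : ℝ → ℝ) (x : ℝ) :
    S.pot Set.univ b ζ x = ∫ u, S.p ζ u * b (x - u) := by
  unfold StripKernel.pot
  rw [Measure.restrict_univ, ← integral_sub_left_eq_self _ volume x]
  simp

lemma exists_abs_pot_le (H : LineSystem S ζ κ s) {b : ℝ → ℝ} {C : ℝ} (hC : ∀ μ, |b μ| ≤ C) :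
    ∃ E, ∀ x, |S.pot Set.univ b ζ x| ≤ E := by
  obtain ⟨E, hE0, hE⟩ := H.window.exists_integral_abs_p_le H.mem
  exact ⟨C * E, fun x => (H.window.abs_pot_le H.mem hC x).trans
    (mul_le_mul_of_nonneg_left (hE x) ((abs_nonneg _).trans (hC 0)))⟩

lemma exists_lipschitz_pot (H : LineSystem S ζ κ s) {b : ℝ → ℝ} {C : ℝ} (hb : Measurable b)
    (hC : ∀ μ, |b μ| ≤ C) : ∃ L : NNReal, LipschitzWith L (S.pot Set.univ b ζ) := by
  obtain ⟨E, hE⟩ := H.exists_abs_pot_le hC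
  obtain ⟨L, hL0, hL⟩ := H.window.exists_abs_pot_sub_le H.mem
  exact lipschitz_of_local hE fun x y hxy => hL b C hb ((abs_nonneg _).trans (hC 0)) hC x y hxy

lemma exists_lipschitz_s (H : LineSystem S ζ κ s) : ∃ L : NNReal, LipschitzWith L s := by
  set C := |S.N (ζ / 2)| / (2 * Real.pi) * (1 / min 1 (S.B (ζ / 2)))
  refine ⟨C.toNNReal, lipschitzWith_of_nnnorm_deriv_le
    (fun x => (H.hasDerivAt_s x).differentiableAt) fun x => ?_⟩
  rw [(H.hasDerivAt_s x).deriv, ← NNReal.coe_le_coe, coe_nnnorm]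
  exact (StripKernel.p_le H.mem_half x).trans (Real.le_coe_toNNReal _)

section
variable {f g : ℝ → ℝ} {C : ℝ}

lemma exists_lipschitz (H : LineSystem S ζ κ s) (hg : Measurable g) (hC : ∀ x, |g x| ≤ C)
    (hf : ∀ x, f x = s x - S.pot Set.univ g ζ x) :
    (∃ L : NNReal, LipschitzWith L f) ∧ ∃ B, ∀ x, |f x| ≤ B := by
  obtain ⟨L₁, h₁⟩ := H.exists_lipschitz_s
  obtain ⟨L₂, h₂⟩ := H.exists_lipschitz_pot hg hC
  obtain ⟨B₁, hB₁⟩ := H.s_bdd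
  obtain ⟨B₂, hB₂⟩ := H.exists_abs_pot_le hC
  refine ⟨⟨L₁ + L₂, ?_⟩, B₁ + B₂, fun x => ?_⟩
  · rw [show f = fun x => s x - S.pot Set.univ g ζ x from funext hf]
    exact h₁.sub h₂
  · rw [hf]
    exact (abs_sub _ _).trans (add_le_add (hB₁ x) (hB₂ x))

lemma hasDerivAt (H : LineSystem S ζ κ s) {L : NNReal} (hg : LipschitzWith L g)
    (hC : ∀ x, |g x| ≤ C) (hf : ∀ x, f x = s x - S.pot Set.univ g ζ x) (x : ℝ) :
    HasDerivAt f (S.p (ζ / 2) x - S.pot Set.univ (deriv g) ζ x) x := by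
  have hK := H.integrable_p
  rw [show f = fun x => s x - ∫ u, S.p ζ u * g (x - u) from
    funext fun x => by rw [hf, pot_eq]]
  refine (H.hasDerivAt_s x).sub ?_
  rw [pot_eq]
  refine (hasDerivAt_integral_of_dominated_loc_of_lip (μ := volume)
    (F := fun x u => S.p ζ u * g (x - u)) (F' := fun u => S.p ζ u * deriv g (x - u))
    (bound := fun u => |S.p ζ u| * L) (s := Set.univ) univ_mem ?_ ?_ ?_ ?_ (hK.abs.mul_const _) ?_).2
  · refine Eventually.of_forall fun y => hK.aestronglyMeasurable.mul ?_
    exact (hg.continuous.comp (continuous_const.sub continuous_id)).aestronglyMeasurable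
  · exact hK.mul_bdd (c := C) (hg.continuous.comp (continuous_const.sub continuous_id)).aestronglyMeasurable
      (Eventually.of_forall fun u => hC _)
  · exact hK.aestronglyMeasurable.mul
      ((measurable_deriv g).comp (measurable_const.sub measurable_id)).aestronglyMeasurable
  · refine Eventually.of_forall fun u => LipschitzOnWith.of_dist_le_mul fun y _ z _ => ?_
    rw [Real.coe_nnabs, abs_of_nonneg (by positivity), Real.dist_eq, ← mul_sub, abs_mul, mul_assoc]
    have := hg.dist_le_mul (y - u) (z - u)
    rw [Real.dist_eq, dist_sub_right] at this
    exact mul_le_mul_of_nonneg_left this (abs_nonneg _)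
  · have hae : ∀ᵐ u, DifferentiableAt ℝ g (x - u) :=
      (quasiMeasurePreserving_sub_left volume x).ae hg.ae_differentiableAt_real
    filter_upwards [hae] with u hu
    exact (hu.hasDerivAt.comp_sub_const x u).const_mul _

lemma strictMono (H : LineSystem S ζ κ s) {L : NNReal} (hg : LipschitzWith L g)
    (hC : ∀ x, |g x| ≤ C) (hf : ∀ x, f x = s x - S.pot Set.univ g ζ x)
    (hb : ∀ᵐ x, ∀ f', HasDerivAt f f' x → DifferentiableAt ℝ g x → Between (deriv g x) f') :
    StrictMono f := by
  set ρ : ℝ → ℝ := fun x => S.p (ζ / 2) x - S.pot Set.univ (deriv g) ζ x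
  have hρ : ∀ x, HasDerivAt f (ρ x) x := H.hasDerivAt hg hC hf
  have hLd := abs_deriv_le_of_lipschitz hg
  have hρm : Measurable ρ := ((S.continuous_p H.mem_half).sub
    (H.window.continuous_pot H.mem (measurable_deriv g) hLd)).measurable
  obtain ⟨m, hm, hmL, hmb, hmae⟩ := exists_between_ae_eq (measurable_deriv g) hLd hρm (by
    filter_upwards [hb, hg.ae_differentiableAt_real] with x hx hx2 using hx _ (hρ x) hx2)
  obtain ⟨h0, h1⟩ := H.density_pos m ρ L hm hmL (fun x => by
    simp only [ρ, StripKernel.pot]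
    congr 1
    refine integral_congr_ae ?_
    rw [Measure.restrict_univ]
    filter_upwards [hmae] with μ hμ
    rw [hμ]) hmb
  exact strictMono_of_deriv_nonneg hρ h0 h1

end

/-- Solutions of the equation truncated at `±D/2`. -/
structure IsTruncated (S : StripKernel) (ζ : ℝ) (s : ℝ → ℝ) (D : ℝ) (f : ℝ → ℝ) : Prop where
  measurable : Measurable f
  eqn : ∀ x, f x = s x - S.pot Set.univ (fun μ => clamp D (f μ)) ζ x

section
variable {f : ℝ → ℝ}

lemma exists_isTruncated (H : LineSystem S ζ κ s) (hD : 0 ≤ D) (hD1 : D ≤ 1 / 2) :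
    ∃ f, IsTruncated S ζ s D f := by
  obtain ⟨v, hv, -, hveq⟩ := H.exist D hD hD1
  have hsc : Continuous s := continuous_iff_continuousAt.2 fun x => (H.hasDerivAt_s x).continuousAt
  refine ⟨fun x => s x + v x, hsc.measurable.add hv, fun x => ?_⟩
  rw [hveq x]
  ring

lemma IsTruncated.ext (H : LineSystem S ζ κ s) (hD : 0 ≤ D) {f₁ f₂ : ℝ → ℝ}
    (h₁ : IsTruncated S ζ s D f₁) (h₂ : IsTruncated S ζ s D f₂) : f₁ = f₂ := by
  have m₁ : Measurable fun μ => clamp D (f₁ μ) := continuous_clamp.measurable.comp h₁.measurable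
  have m₂ : Measurable fun μ => clamp D (f₂ μ) := continuous_clamp.measurable.comp h₂.measurable
  obtain ⟨-, B₁, hB₁⟩ := H.exists_lipschitz m₁ (fun x => abs_clamp_le hD _) h₁.eqn
  obtain ⟨-, B₂, hB₂⟩ := H.exists_lipschitz m₂ (fun x => abs_clamp_le hD _) h₂.eqn
  have := H.uniq (fun x => f₁ x - f₂ x) (fun x => clamp D (f₁ x) - clamp D (f₂ x)) (B₁ + B₂)
    (m₁.sub m₂) (fun x => (abs_sub _ _).trans (add_le_add (hB₁ x) (hB₂ x)))
    (fun x => between_clamp _ _ _) (fun x => by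
      rw [h₁.eqn x, h₂.eqn x]
      simp only [StripKernel.pot, mul_sub]
      rw [integral_sub (H.window.integrableOn_p_mul H.mem m₁ (fun x => abs_clamp_le hD _) x)
        (H.window.integrableOn_p_mul H.mem m₂ (fun x => abs_clamp_le hD _) x)]
      ring)
  funext x
  linarith [this x]

lemma IsTruncated.measurable_clamp (hf : IsTruncated S ζ s D f) : Measurable fun μ => clamp D (f μ) :=
  continuous_clamp.measurable.comp hf.measurable

lemma IsTruncated.strictMono (H : LineSystem S ζ κ s) (hD : 0 ≤ D) (hf : IsTruncated S ζ s D f) : StrictMono f := by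
  have hm := hf.measurable_clamp
  obtain ⟨⟨L, hL⟩, -⟩ := H.exists_lipschitz hm (fun x => abs_clamp_le hD _) hf.eqn
  have hgL : LipschitzWith L (fun μ => clamp D (f μ)) := by
    refine LipschitzWith.of_dist_le_mul fun x y => ?_
    rw [Real.dist_eq]
    exact (abs_clamp_sub_le _ _ _).trans (hL.dist_le_mul x y)
  refine H.strictMono hgL (fun x => abs_clamp_le hD _) hf.eqn (Eventually.of_forall fun x f' h1 h2 => ?_)
  exact between_of_hasDerivAt h1 h2.hasDerivAt fun y => between_clamp _ _ _

lemma IsTruncated.neg (H : LineSystem S ζ κ s) (hD : 0 ≤ D) (hf : IsTruncated S ζ s D f) (x : ℝ) : f (-x) = -f x := by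
  have hm := hf.measurable_clamp
  have h : IsTruncated S ζ s D fun x => -f (-x) := by
    refine ⟨(hf.measurable.comp measurable_neg).neg, fun x => ?_⟩
    rw [hf.eqn (-x), H.s_neg, StripKernel.pot, StripKernel.pot, Measure.restrict_univ,
      ← integral_neg_eq_self (fun μ => S.p ζ (-x - μ) * clamp D (f μ)), neg_sub, sub_neg_eq_add, add_comm,
      sub_eq_add_neg, ← integral_neg]
    congr 2
    funext μ
    rw [clamp_neg hD, mul_neg, neg_neg, ← neg_add', H.p_neg]
    ring_nf
  have := congrFun (IsTruncated.ext H hD hf h) x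
  linarith

lemma IsTruncated.exists_tendsto (H : LineSystem S ζ κ s) (hD : 0 ≤ D) (hf : IsTruncated S ζ s D f) :
    ∃ L, Tendsto f atTop (𝓝 L) ∧ L + κ * clamp D L = (1 + κ) / 4 := by
  have hm := hf.measurable_clamp
  have hmono := (IsTruncated.strictMono H hD hf).monotone
  obtain ⟨⟨K, hK⟩, B, hB⟩ := H.exists_lipschitz hm (fun x => abs_clamp_le hD _) hf.eqn
  have hL := tendsto_atTop_ciSup hmono ⟨B, by rintro _ ⟨x, rfl⟩; exact (le_abs_self _).trans (hB x)⟩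
  refine ⟨_, hL, ?_⟩
  set L := ⨆ x, f x
  have h1 : Tendsto (fun x => ∫ u, S.p ζ u * clamp D (f (x - u))) atTop
      (𝓝 (∫ u, S.p ζ u * clamp D L)) := by
    refine tendsto_integral_filter_of_dominated_convergence (fun u => |S.p ζ u| * (D / 2)) ?_ ?_
      (H.integrable_p.abs.mul_const _) ?_
    · refine Eventually.of_forall fun x => H.integrable_p.aestronglyMeasurable.mul ?_
      exact (hm.comp (measurable_const.sub measurable_id)).aestronglyMeasurable
    · refine Eventually.of_forall fun x => Eventually.of_forall fun u => ?_
      rw [Real.norm_eq_abs, abs_mul]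
      exact mul_le_mul_of_nonneg_left (abs_clamp_le hD _) (abs_nonneg _)
    · refine Eventually.of_forall fun u => Tendsto.const_mul _ ?_
      have : Tendsto (fun x => f (x - u)) atTop (𝓝 L) :=
        hL.comp (tendsto_atTop_add_const_right atTop (-u) tendsto_id)
      exact (continuous_clamp.tendsto L).comp this
  rw [integral_mul_const, H.integral_p] at h1
  have h2 := H.tendsto_s.sub h1
  have h3 : (fun x => s x - ∫ u, S.p ζ u * clamp D (f (x - u))) = f := by
    funext x
    rw [hf.eqn x, pot_eq]
  rw [h3] at h2
  have := tendsto_nhds_unique hL h2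
  linarith

lemma IsTruncated.tendsto_of_lt (H : LineSystem S ζ κ s) (hD : 0 ≤ D) (hf : IsTruncated S ζ s D f)
    (hD1 : D < 1 / 2) : ∃ L, Tendsto f atTop (𝓝 L) ∧ D / 2 < L := by
  obtain ⟨L, hL, h⟩ := IsTruncated.exists_tendsto H hD hf
  refine ⟨L, hL, ?_⟩
  by_contra hcon
  push Not at hcon
  have hκ := H.neg_one_lt
  have h0 : f 0 = 0 := by
    have := IsTruncated.neg H hD hf 0
    rw [neg_zero] at this
    linarith
  have hL0 : 0 ≤ L := h0 ▸ (IsTruncated.strictMono H hD hf).monotone.ge_of_tendsto hL 0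
  rw [clamp_of_mem (by linarith) hcon] at h
  have : (1 + κ) * (L - 1 / 4) = 0 := by linarith
  rcases mul_eq_zero.1 this with h | h <;> linarith

lemma IsTruncated.tendsto_of_eq (H : LineSystem S ζ κ s) (hD : 0 ≤ D) (hf : IsTruncated S ζ s D f)
    (hD1 : D = 1 / 2) : Tendsto f atTop (𝓝 (D / 2)) := by
  obtain ⟨L, hL, h⟩ := IsTruncated.exists_tendsto H hD hf
  have hκ := H.neg_one_lt
  have h0 : f 0 = 0 := by
    have := IsTruncated.neg H hD hf 0
    rw [neg_zero] at this
    linarith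
  have hL0 : 0 ≤ L := h0 ▸ (IsTruncated.strictMono H hD hf).monotone.ge_of_tendsto hL 0
  subst hD1
  rcases le_total L (1 / 2 / 2) with h2 | h2
  · rw [clamp_of_mem (by linarith) h2] at h
    have : (1 + κ) * (L - 1 / 4) = 0 := by linarith
    rcases mul_eq_zero.1 this with h | h
    · linarith
    · rwa [show (1 / 2 / 2 : ℝ) = L by linarith]
  · rw [clamp_of_ge hD h2] at h
    rwa [show (1 / 2 / 2 : ℝ) = L by linarith]

end
end LineSystem

lemma measurableSet_interval (QL QR : EReal) : MeasurableSet (interval QL QR) :=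
  (measurableSet_le measurable_const measurable_coe_real_ereal).inter
    (measurableSet_le measurable_coe_real_ereal measurable_const)

/-- The function `f` on the interval, extended by the constants `±D/2`. -/
def clip (QL QR : EReal) (D : ℝ) (f : ℝ → ℝ) (x : ℝ) : ℝ :=
  if (x : EReal) < QL then -(D / 2) else if QR < x then D / 2 else f x

section clip
variable {QL QR : EReal} {D : ℝ} {f : ℝ → ℝ}

lemma clip_of_lt {x : ℝ} (h : (x : EReal) < QL) : clip QL QR D f x = -(D / 2) := if_pos h

lemma clip_of_gt (hLR : QL ≤ QR) {x : ℝ} (h : QR < x) : clip QL QR D f x = D / 2 := by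
  unfold clip
  rw [if_neg (not_lt.2 (hLR.trans h.le)), if_pos h]

lemma clip_of_mem {x : ℝ} (h : x ∈ interval QL QR) : clip QL QR D f x = f x := by
  unfold clip
  rw [if_neg (not_lt.2 h.1), if_neg (not_lt.2 h.2)]

lemma measurable_clip (hf : Measurable f) : Measurable (clip QL QR D f) :=
  Measurable.ite (measurableSet_lt measurable_coe_real_ereal measurable_const) measurable_const
    (Measurable.ite (measurableSet_lt measurable_const measurable_coe_real_ereal) measurable_const hf)

lemma abs_clip_le (hD : 0 ≤ D) {B : ℝ} (hB : ∀ x, |f x| ≤ B) (x : ℝ) :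
    |clip QL QR D f x| ≤ B + D / 2 := by
  have := hB x
  have := abs_nonneg (f x)
  unfold clip
  split_ifs
  · rw [abs_neg, abs_of_nonneg (by positivity)]; linarith
  · rw [abs_of_nonneg (by positivity)]; linarith
  · linarith

/-- The nearest point of the interval: an extension with matching boundary values is Lipschitz. -/
lemma lipschitzWith_clip (hLR : QL ≤ QR) (hL : QL ≠ ⊤) (hR : QR ≠ ⊥) {K : NNReal}
    (hf : LipschitzWith K f) (h₁ : HasBoundaryValue f (D / 2) QR)
    (h₂ : HasBoundaryValue f (-(D / 2)) QL) : LipschitzWith K (clip QL QR D f) := by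
  have key : ∀ proj : ℝ → ℝ, LipschitzWith 1 proj → (∀ x, clip QL QR D f x = f (proj x)) →
      LipschitzWith K (clip QL QR D f) := by
    intro proj hp he
    rw [show clip QL QR D f = f ∘ proj from funext he]
    simpa using hf.comp hp
  have hcase : ∀ (proj : ℝ → ℝ), (∀ x : ℝ, (x : EReal) < QL → f (proj x) = -(D / 2)) →
      (∀ x : ℝ, QR < x → f (proj x) = D / 2) → (∀ x ∈ interval QL QR, proj x = x) →
      ∀ x, clip QL QR D f x = f (proj x) := by
    intro proj a1 a2 a3 x
    rcases lt_or_ge (x : EReal) QL with h | h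
    · rw [clip_of_lt h, a1 x h]
    · rcases lt_or_ge QR (x : EReal) with h' | h'
      · rw [clip_of_gt hLR h', a2 x h']
      · rw [clip_of_mem ⟨h, h'⟩, a3 x ⟨h, h'⟩]
  induction QL using EReal.rec with
  | top => exact absurd rfl hL
  | bot =>
    induction QR using EReal.rec with
    | bot => exact absurd rfl hR
    | top =>
      exact key id LipschitzWith.id (hcase id (fun x hx => absurd hx not_lt_bot)
        (fun x hx => absurd hx not_top_lt) fun x _ => rfl)
    | coe b =>
      change f b = D / 2 at h₁
      refine key (fun x => min x b) (LipschitzWith.id.min_const b) (hcase _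
        (fun x hx => absurd hx not_lt_bot) (fun x hx => ?_) fun x hx => ?_)
      · rw [min_eq_right (EReal.coe_lt_coe_iff.1 hx).le, h₁]
      · exact min_eq_left (EReal.coe_le_coe_iff.1 hx.2)
  | coe a =>
    change f a = -(D / 2) at h₂
    induction QR using EReal.rec with
    | bot => exact absurd rfl hR
    | top =>
      refine key (fun x => max x a) (LipschitzWith.id.max_const a) (hcase _
        (fun x hx => ?_) (fun x hx => absurd hx not_top_lt) fun x hx => ?_)
      · rw [max_eq_right (EReal.coe_lt_coe_iff.1 hx).le, h₂]
      · exact max_eq_left (EReal.coe_le_coe_iff.1 hx.1)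
    | coe b =>
      change f b = D / 2 at h₁
      have hab : a ≤ b := EReal.coe_le_coe_iff.1 hLR
      refine key (fun x => max (min x b) a) ((LipschitzWith.id.min_const b).max_const a) (hcase _
        (fun x hx => ?_) (fun x hx => ?_) fun x hx => ?_)
      · have hx := EReal.coe_lt_coe_iff.1 hx
        rw [min_eq_left (by linarith), max_eq_right hx.le, h₂]
      · have hx := EReal.coe_lt_coe_iff.1 hx
        rw [min_eq_right hx.le, max_eq_left hab, h₁]
      · rw [min_eq_left (EReal.coe_le_coe_iff.1 hx.2), max_eq_left (EReal.coe_le_coe_iff.1 hx.1)]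

lemma ae_between_deriv_clip (hLR : QL ≤ QR) : ∀ᵐ x : ℝ, ∀ f', HasDerivAt f f' x →
    Between (deriv (clip QL QR D f) x) f' := by
  have hne : ∀ Q : EReal, ∀ᵐ x : ℝ, (x : EReal) ≠ Q := by
    intro Q
    have : {x : ℝ | (x : EReal) = Q}.Subsingleton := fun x hx y hy =>
      EReal.coe_injective ((show (x : EReal) = Q from hx).trans (show (y : EReal) = Q from hy).symm)
    simpa [ae_iff] using this.measure_zero volume
  have hc := continuous_coe_real_ereal
  filter_upwards [hne QL, hne QR] with x hxL hxR f' hf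
  rcases lt_or_gt_of_ne hxL with h | h
  · have : clip QL QR D f =ᶠ[𝓝 x] fun _ => -(D / 2) := by
      filter_upwards [(isOpen_Iio.preimage hc).mem_nhds h] with y hy using clip_of_lt hy
    rw [this.deriv_eq, deriv_const]
    exact between_zero _
  · rcases lt_or_gt_of_ne hxR with h' | h'
    · have : clip QL QR D f =ᶠ[𝓝 x] f := by
        filter_upwards [(isOpen_Ioi.preimage hc).mem_nhds h, (isOpen_Iio.preimage hc).mem_nhds h']
          with y hy hy'
        exact clip_of_mem ⟨le_of_lt hy, le_of_lt hy'⟩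
      rw [this.deriv_eq, hf.deriv]
      exact between_self _
    · have : clip QL QR D f =ᶠ[𝓝 x] fun _ => D / 2 := by
        filter_upwards [(isOpen_Ioi.preimage hc).mem_nhds h'] with y hy using clip_of_gt hLR hy
      rw [this.deriv_eq, deriv_const]
      exact between_zero _

lemma HasBoundaryValue.le_of_le {c : ℝ} (hf : Monotone f) {Q : EReal} (hQ : Q ≠ ⊥)
    (h : HasBoundaryValue f c Q) {x : ℝ} (hx : (x : EReal) ≤ Q) : f x ≤ c := by
  induction Q using EReal.rec with
  | bot => exact absurd rfl hQ
  | top => exact hf.ge_of_tendsto h x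
  | coe q => exact (hf (EReal.coe_le_coe_iff.1 hx)).trans_eq h

lemma HasBoundaryValue.ge_of_ge {c : ℝ} (hf : Monotone f) {Q : EReal} (hQ : Q ≠ ⊤)
    (h : HasBoundaryValue f c Q) {x : ℝ} (hx : Q ≤ x) : c ≤ f x := by
  induction Q using EReal.rec with
  | top => exact absurd rfl hQ
  | bot => exact hf.le_of_tendsto h x
  | coe q => exact (show f q = c from h).symm.le.trans (hf (EReal.coe_le_coe_iff.1 hx))

lemma HasBoundaryValue.ge_of_lt {c : ℝ} (hf : Monotone f) {Q : EReal} (hQ : Q ≠ ⊥)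
    (h : HasBoundaryValue f c Q) {x : ℝ} (hx : Q < x) : c ≤ f x := by
  induction Q using EReal.rec with
  | bot => exact absurd rfl hQ
  | top => exact absurd hx not_top_lt
  | coe q => exact (show f q = c from h).symm.le.trans (hf (EReal.coe_lt_coe_iff.1 hx).le)

lemma HasBoundaryValue.le_of_gt {c : ℝ} (hf : Monotone f) {Q : EReal} (hQ : Q ≠ ⊤)
    (h : HasBoundaryValue f c Q) {x : ℝ} (hx : (x : EReal) < Q) : f x ≤ c := by
  induction Q using EReal.rec with
  | top => exact absurd rfl hQ
  | bot => exact absurd hx not_lt_bot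
  | coe q => exact (hf (EReal.coe_lt_coe_iff.1 hx).le).trans_eq h

lemma clip_eq_clamp (hLR : QL ≤ QR) (hL : QL ≠ ⊤) (hR : QR ≠ ⊥) (hD : 0 ≤ D)
    (hf : Monotone f) (h₁ : HasBoundaryValue f (D / 2) QR)
    (h₂ : HasBoundaryValue f (-(D / 2)) QL) (x : ℝ) : clip QL QR D f x = clamp D (f x) := by
  rcases lt_or_ge (x : EReal) QL with h | h
  · rw [clip_of_lt h, clamp_of_le (h₂.le_of_gt hf hL h)]
  · rcases lt_or_ge QR (x : EReal) with h' | h'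
    · rw [clip_of_gt hLR h', clamp_of_ge hD (h₁.ge_of_lt hf hR h')]
    · rw [clip_of_mem ⟨h, h'⟩, clamp_of_mem (h₂.ge_of_ge hf hL h) (h₁.le_of_le hf hR h')]

end clip

/-- The functions of the problem at the anisotropy `Δ ≤ 1`, expressed by a system on the line. -/
structure LineModel (Δ : ℝ) (S : StripKernel) (ζ κ : ℝ) (s : ℝ → ℝ) : Prop where
  sys : LineSystem S ζ κ s
  le_one : ¬ 1 < Δ
  kernel : ∀ x, liebKernel Δ x = S.p ζ x
  momentum : ∀ x, bareMomentum Δ x / (2 * Real.pi) = s x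
  phase : ∀ x, HasDerivAt (barePhase Δ) (2 * Real.pi * S.p ζ x) x
  phase_atTop : Tendsto (barePhase Δ) atTop (𝓝 (Real.pi * κ))
  phase_atBot : Tendsto (barePhase Δ) atBot (𝓝 (-(Real.pi * κ)))

namespace LineModel
variable {Δ : ℝ} {S : StripKernel} {ζ κ : ℝ} {s : ℝ → ℝ} {D : ℝ} {QL QR : EReal} {f : ℝ → ℝ}

lemma integral_gt (H : LineModel Δ S ζ κ s) (hR : QR ≠ ⊥) (x : ℝ) :
    ∫ μ in {μ : ℝ | QR < μ}, S.p ζ (x - μ) = (shiftedPhase Δ x QR + Real.pi * κ) / (2 * Real.pi) := by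
  induction QR using EReal.rec with
  | bot => exact absurd rfl hR
  | top =>
    have : {μ : ℝ | (⊤ : EReal) < μ} = ∅ := by ext; simp
    rw [this]
    rw [Measure.restrict_empty, integral_zero_measure]
    change 0 = (limUnder atBot (barePhase Δ) + Real.pi * κ) / (2 * Real.pi)
    rw [H.phase_atBot.limUnder_eq, neg_add_cancel, zero_div]
  | coe q =>
    have : {μ : ℝ | (q : EReal) < μ} = Set.Ioi q := by ext; simp
    rw [this]
    have hd : ∀ μ ∈ Set.Ici q, HasDerivAt (fun μ => -(barePhase Δ (x - μ)) / (2 * Real.pi))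
        (S.p ζ (x - μ)) μ := by
      intro μ _
      have h := ((H.phase (x - μ)).comp_const_sub x μ).neg.div_const (2 * Real.pi)
      refine h.congr_deriv ?_
      field_simp
    have ht : Tendsto (fun μ => -(barePhase Δ (x - μ)) / (2 * Real.pi)) atTop
        (𝓝 (-(-(Real.pi * κ)) / (2 * Real.pi))) :=
      ((H.phase_atBot.comp (tendsto_const_nhds.add_atBot tendsto_neg_atTop_atBot)).neg).div_const _
    rw [integral_Ioi_of_hasDerivAt_of_tendsto' hd
      (H.sys.integrable_p.comp_sub_left x).integrableOn ht]
    change _ = (barePhase Δ (x - q) + Real.pi * κ) / (2 * Real.pi)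
    ring

lemma integral_lt (H : LineModel Δ S ζ κ s) (hL : QL ≠ ⊤) (x : ℝ) :
    ∫ μ in {μ : ℝ | (μ : EReal) < QL}, S.p ζ (x - μ) =
      (Real.pi * κ - shiftedPhase Δ x QL) / (2 * Real.pi) := by
  induction QL using EReal.rec with
  | top => exact absurd rfl hL
  | bot =>
    have : {μ : ℝ | (μ : EReal) < ⊥} = ∅ := by ext; simp
    rw [this]
    rw [Measure.restrict_empty, integral_zero_measure]
    change 0 = (Real.pi * κ - limUnder atTop (barePhase Δ)) / (2 * Real.pi)
    rw [H.phase_atTop.limUnder_eq, sub_self, zero_div]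
  | coe q =>
    have : {μ : ℝ | (μ : EReal) < q} = Set.Iio q := by ext; simp
    rw [this, ← integral_Iic_eq_integral_Iio]
    have hd : ∀ μ ∈ Set.Iic q, HasDerivAt (fun μ => -(barePhase Δ (x - μ)) / (2 * Real.pi))
        (S.p ζ (x - μ)) μ := by
      intro μ _
      have h := ((H.phase (x - μ)).comp_const_sub x μ).neg.div_const (2 * Real.pi)
      refine h.congr_deriv ?_
      field_simp
    have ht : Tendsto (fun μ => -(barePhase Δ (x - μ)) / (2 * Real.pi)) atBot
        (𝓝 (-(Real.pi * κ) / (2 * Real.pi))) :=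
      ((H.phase_atTop.comp (tendsto_const_nhds.add_atTop tendsto_neg_atBot_atTop)).neg).div_const _
    rw [integral_Iic_of_hasDerivAt_of_tendsto' hd
      (H.sys.integrable_p.comp_sub_left x).integrableOn ht]
    change _ = (Real.pi * κ - barePhase Δ (x - q)) / (2 * Real.pi)
    ring

lemma abs_shiftedPhase_le (H : LineModel Δ S ζ κ s) {Q : EReal} (hQ : Q ≠ ⊥) :
    ∃ C, ∀ x, |shiftedPhase Δ x Q| ≤ C := by
  obtain ⟨E, hE0, hE⟩ := H.sys.window.exists_integral_abs_p_le H.sys.mem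
  refine ⟨2 * Real.pi * E + |Real.pi * κ|, fun x => ?_⟩
  have h := H.integral_gt hQ x
  have h1 : |∫ μ in {μ : ℝ | Q < μ}, S.p ζ (x - μ)| ≤ E := by
    refine abs_integral_le_integral_abs.trans (le_trans ?_ (hE x))
    rw [Measure.restrict_univ]
    exact setIntegral_le_integral (H.sys.integrable_p.comp_sub_left x).abs
      (Eventually.of_forall fun _ => abs_nonneg _)
  rw [h] at h1
  have h2 : shiftedPhase Δ x Q = 2 * Real.pi * ((shiftedPhase Δ x Q + Real.pi * κ) / (2 * Real.pi))
      - Real.pi * κ := by field_simp; ring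
  rw [h2]
  refine (abs_sub _ _).trans (add_le_add ?_ le_rfl)
  rw [abs_mul, abs_of_pos (by positivity : 0 < 2 * Real.pi)]
  exact mul_le_mul_of_nonneg_left h1 (by positivity)

lemma abs_shiftedPhase_le' (H : LineModel Δ S ζ κ s) (Q : EReal) :
    ∃ C, ∀ x, |shiftedPhase Δ x Q| ≤ C := by
  by_cases hQ : Q = ⊥
  · subst hQ
    exact ⟨|limUnder atTop (barePhase Δ)|, fun x => le_rfl⟩
  · exact H.abs_shiftedPhase_le hQ

lemma continuous_shiftedPhase (H : LineModel Δ S ζ κ s) (Q : EReal) :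
    Continuous fun x => shiftedPhase Δ x Q := by
  induction Q using EReal.rec with
  | bot => exact continuous_const
  | top => exact continuous_const
  | coe q =>
    have : Continuous (barePhase Δ) := continuous_iff_continuousAt.2 fun x => (H.phase x).continuousAt
    exact this.comp (continuous_id.sub continuous_const)

/-- The integral of the truncated function splits into the integral over the interval and the
phases. -/
lemma pot_clip (H : LineModel Δ S ζ κ s) (hLR : QL ≤ QR) (hL : QL ≠ ⊤) (hR : QR ≠ ⊥) (x : ℝ)
    (hint : IntegrableOn (fun μ => S.p ζ (x - μ) * f μ) (interval QL QR)) :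
    S.pot Set.univ (clip QL QR D f) ζ x = (∫ μ in interval QL QR, S.p ζ (x - μ) * f μ)
      + D / (4 * Real.pi) * (shiftedPhase Δ x QR + shiftedPhase Δ x QL) := by
  have mA : MeasurableSet {μ : ℝ | (μ : EReal) < QL} :=
    measurableSet_lt measurable_coe_real_ereal measurable_const
  have mB : MeasurableSet {μ : ℝ | QR < (μ : EReal)} :=
    measurableSet_lt measurable_const measurable_coe_real_ereal
  have mI := measurableSet_interval QL QR
  have hp := H.sys.integrable_p.comp_sub_left x
  have e : (fun μ => S.p ζ (x - μ) * clip QL QR D f μ) = fun μ =>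
      (interval QL QR).indicator (fun μ => S.p ζ (x - μ) * f μ) μ
      + ({μ : ℝ | QR < (μ : EReal)}.indicator (fun μ => S.p ζ (x - μ) * (D / 2)) μ
      + {μ : ℝ | (μ : EReal) < QL}.indicator (fun μ => S.p ζ (x - μ) * (-(D / 2))) μ) := by
    funext μ
    rcases lt_or_ge (μ : EReal) QL with h | h
    · rw [clip_of_lt h, Set.indicator_of_notMem (fun h' => absurd h'.1 (not_le.2 h)),
        Set.indicator_of_notMem (s := {μ : ℝ | QR < (μ : EReal)})
          (fun h' => absurd (hLR.trans (le_of_lt h')) (not_le.2 h)),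
        Set.indicator_of_mem (show μ ∈ {μ : ℝ | (μ : EReal) < QL} from h)]
      ring
    · rw [Set.indicator_of_notMem (s := {μ : ℝ | (μ : EReal) < QL}) (fun h' => absurd h (not_le.2 h'))]
      rcases lt_or_ge QR (μ : EReal) with h' | h'
      · rw [clip_of_gt hLR h', Set.indicator_of_notMem (fun h'' => absurd h''.2 (not_le.2 h')),
          Set.indicator_of_mem (show μ ∈ {μ : ℝ | QR < (μ : EReal)} from h')]
        ring
      · rw [clip_of_mem ⟨h, h'⟩, Set.indicator_of_mem (show μ ∈ interval QL QR from ⟨h, h'⟩),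
          Set.indicator_of_notMem (s := {μ : ℝ | QR < (μ : EReal)}) (fun h'' => absurd h' (not_le.2 h''))]
        ring
  have iB : Integrable fun μ =>
      {μ : ℝ | QR < (μ : EReal)}.indicator (fun μ => S.p ζ (x - μ) * (D / 2)) μ :=
    (hp.mul_const _).indicator mB
  have iA : Integrable fun μ =>
      {μ : ℝ | (μ : EReal) < QL}.indicator (fun μ => S.p ζ (x - μ) * (-(D / 2))) μ :=
    (hp.mul_const _).indicator mA
  have iAB : Integrable fun μ =>
      {μ : ℝ | QR < (μ : EReal)}.indicator (fun μ => S.p ζ (x - μ) * (D / 2)) μ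
      + {μ : ℝ | (μ : EReal) < QL}.indicator (fun μ => S.p ζ (x - μ) * (-(D / 2))) μ := iB.add iA
  unfold StripKernel.pot
  rw [Measure.restrict_univ, e, integral_add (hint.integrable_indicator mI) iAB,
    integral_add iB iA,
    integral_indicator mI, integral_indicator mA, integral_indicator mB, integral_mul_const,
    integral_mul_const, H.integral_gt hR, H.integral_lt hL]
  field_simp
  ring

/-- Uniform integrability of the kernel against an admissible function. -/
lemma exists_integral_abs_le (H : LineModel Δ S ζ κ s) {I : Set ℝ}
    (hf : MemLp f 2 (volume.restrict I) ∨ MemLp f ⊤ (volume.restrict I)) :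
    ∃ E, ∀ x, IntegrableOn (fun μ => S.p ζ (x - μ) * f μ) I ∧
      ∫ μ in I, |S.p ζ (x - μ) * f μ| ≤ E := by
  have hp := fun x => H.sys.integrable_p.comp_sub_left x
  obtain ⟨E, hE0, hE⟩ := H.sys.window.exists_integral_abs_p_le H.sys.mem
  rw [Measure.restrict_univ] at hE
  have hEI : ∀ x, ∫ μ in I, |S.p ζ (x - μ)| ≤ E := fun x =>
    (setIntegral_le_integral (hp x).abs (Eventually.of_forall fun _ => abs_nonneg _)).trans (hE x)
  have hpm : ∀ x, AEStronglyMeasurable (fun μ => S.p ζ (x - μ)) (volume.restrict I) := fun x =>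
    ((S.continuous_p H.sys.mem).comp (continuous_const.sub continuous_id)).aestronglyMeasurable
  rcases hf with hf | hf
  · have hsq := hf.integrable_sq
    set P := |S.N ζ| / (2 * Real.pi) * (1 / min 1 (S.B ζ))
    have hP : ∀ x, |S.p ζ x| ≤ P := StripKernel.p_le H.sys.mem
    have hbd : ∀ x μ, |S.p ζ (x - μ) * f μ| ≤ P * |S.p ζ (x - μ)| + f μ ^ 2 := by
      intro x μ
      have h1 := mul_le_mul_of_nonneg_right (hP (x - μ)) (abs_nonneg (S.p ζ (x - μ)))
      rw [abs_mul]
      nlinarith [sq_nonneg (|S.p ζ (x - μ)| - |f μ|), sq_abs (f μ), abs_nonneg (S.p ζ (x - μ)),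
        abs_nonneg (f μ)]
    have hib : ∀ x, IntegrableOn (fun μ => P * |S.p ζ (x - μ)| + f μ ^ 2) I := fun x =>
      (((hp x).abs.integrableOn).const_mul P).add hsq
    refine ⟨P * E + ∫ μ in I, f μ ^ 2, fun x => ⟨?_, ?_⟩⟩
    · exact Integrable.mono' (hib x) ((hpm x).mul hf.1) (Eventually.of_forall fun μ => hbd x μ)
    · refine (integral_mono_of_nonneg (Eventually.of_forall fun _ => abs_nonneg _) (hib x)
        (Eventually.of_forall fun μ => hbd x μ)).trans ?_
      rw [integral_add (((hp x).abs.integrableOn).const_mul P) hsq, integral_const_mul]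
      have hP0 : 0 ≤ P := (abs_nonneg _).trans (hP 0)
      exact add_le_add (mul_le_mul_of_nonneg_left (hEI x) hP0) le_rfl
  · obtain ⟨C, hC⟩ : ∃ C : ℝ, ∀ᵐ μ ∂volume.restrict I, |f μ| ≤ C := by
      refine ⟨(eLpNormEssSup f (volume.restrict I)).toReal, ?_⟩
      have hne : eLpNormEssSup f (volume.restrict I) ≠ ⊤ := by
        rw [← eLpNorm_exponent_top]
        exact hf.eLpNorm_ne_top
      filter_upwards [ae_le_eLpNormEssSup (f := f) (μ := volume.restrict I)] with μ hμ
      have := ENNReal.toReal_mono hne hμ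
      simpa using this
    refine ⟨E * |C|, fun x => ⟨(hp x).integrableOn.mul_bdd hf.1 hC, ?_⟩⟩
    refine (integral_mono_of_nonneg (g := fun μ => |S.p ζ (x - μ)| * |C|)
      (Eventually.of_forall fun _ => abs_nonneg _)
      ((hp x).abs.integrableOn.mul_const _) ?_).trans ?_
    · filter_upwards [hC] with μ hμ
      rw [abs_mul]
      exact mul_le_mul_of_nonneg_left (hμ.trans (le_abs_self C)) (abs_nonneg _)
    · rw [integral_mul_const]
      exact mul_le_mul_of_nonneg_right (hEI x) (abs_nonneg C)

lemma eqn_of_solvesLieb (H : LineModel Δ S ζ κ s) (hLR : QL ≤ QR) (hL : QL ≠ ⊤) (hR : QR ≠ ⊥)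
    (hf : SolvesLieb Δ D QL QR f) : Measurable f ∧ (∃ B, ∀ x, |f x| ≤ B) ∧
      ∀ x, f x = s x - S.pot Set.univ (clip QL QR D f) ζ x := by
  obtain ⟨E, hE⟩ := H.exists_integral_abs_le hf.memLp
  have heq : ∀ x, f x = s x - D / (4 * Real.pi) * (shiftedPhase Δ x QR + shiftedPhase Δ x QL)
      - ∫ μ in interval QL QR, S.p ζ (x - μ) * f μ := by
    intro x
    have h := hf.eqn x
    simp only [H.kernel] at h
    rw [H.momentum] at h
    linarith
  have hbd : ∀ x, |∫ μ in interval QL QR, S.p ζ (x - μ) * f μ| ≤ E := fun x =>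
    abs_integral_le_integral_abs.trans (hE x).2
  have hE0 : 0 ≤ E := (abs_nonneg _).trans (hbd 0)
  refine ⟨?_, ?_, ?_⟩
  · obtain ⟨c, hc0, hc⟩ := S.abs_p_sub_le H.sys.mem
    have hcont : Continuous fun x => ∫ μ in interval QL QR, S.p ζ (x - μ) * f μ := by
      refine (StripKernel.uniformContinuous_of_abs_sub_le (L := c * E) fun x x' hx => ?_).continuous
      rw [← integral_sub (hE x).1 (hE x').1]
      calc _ ≤ ∫ μ in interval QL QR, |S.p ζ (x - μ) * f μ - S.p ζ (x' - μ) * f μ| :=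
            abs_integral_le_integral_abs
        _ ≤ ∫ μ in interval QL QR, (c * |x - x'|) * |S.p ζ (x' - μ) * f μ| := by
            refine integral_mono_of_nonneg (Eventually.of_forall fun _ => abs_nonneg _)
              ((hE x').1.abs.const_mul _) (Eventually.of_forall fun μ => ?_)
            simp only
            rw [← sub_mul, abs_mul, abs_mul, ← mul_assoc]
            refine mul_le_mul_of_nonneg_right ?_ (abs_nonneg _)
            have := hc (x - μ) (x' - μ) (by simpa using hx)
            rwa [sub_sub_sub_cancel_right] at this
        _ ≤ c * |x - x'| * E := by
            rw [integral_const_mul]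
            exact mul_le_mul_of_nonneg_left (hE x').2 (by positivity)
        _ = _ := by ring
    have hsc : Continuous s := continuous_iff_continuousAt.2 fun x => (H.sys.hasDerivAt_s x).continuousAt
    rw [show f = _ from funext heq]
    exact ((hsc.sub (continuous_const.mul ((H.continuous_shiftedPhase QR).add
      (H.continuous_shiftedPhase QL)))).sub hcont).measurable
  · obtain ⟨B, hB⟩ := H.sys.s_bdd
    obtain ⟨C₁, h₁⟩ := H.abs_shiftedPhase_le' QR
    obtain ⟨C₂, h₂⟩ := H.abs_shiftedPhase_le' QL
    refine ⟨B + |D / (4 * Real.pi)| * (C₁ + C₂) + E, fun x => ?_⟩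
    rw [heq x]
    refine (abs_sub _ _).trans (add_le_add ((abs_sub _ _).trans (add_le_add (hB x) ?_)) (hbd x))
    rw [abs_mul]
    exact mul_le_mul_of_nonneg_left ((abs_add_le _ _).trans (add_le_add (h₁ x) (h₂ x))) (abs_nonneg _)
  · intro x
    rw [H.pot_clip hLR hL hR x (hE x).1]
    rw [heq x]
    ring

lemma solvesLieb_of_eqn (H : LineModel Δ S ζ κ s) (hLR : QL ≤ QR) (hL : QL ≠ ⊤) (hR : QR ≠ ⊥)
    {B : ℝ} (hm : Measurable f) (hB : ∀ x, |f x| ≤ B)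
    (hf : ∀ x, f x = s x - S.pot Set.univ (clip QL QR D f) ζ x) : SolvesLieb Δ D QL QR f := by
  refine ⟨Or.inr (memLp_top_of_bound hm.aestronglyMeasurable B (Eventually.of_forall hB)), fun x => ?_⟩
  have hint : IntegrableOn (fun μ => S.p ζ (x - μ) * f μ) (interval QL QR) :=
    (H.sys.integrable_p.comp_sub_left x).integrableOn.mul_bdd hm.aestronglyMeasurable
      (Eventually.of_forall hB)
  have h := hf x
  rw [H.pot_clip hLR hL hR x hint] at h
  simp only [H.kernel, H.momentum]
  linarith

lemma isTruncated_of_solvesTwoEndpoint (H : LineModel Δ S ζ κ s) (hD : 0 ≤ D)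
    (hf : SolvesTwoEndpoint Δ D QL QR f) : LineSystem.IsTruncated S ζ s D f := by
  obtain ⟨hm, ⟨B, hB⟩, heq⟩ := H.eqn_of_solvesLieb hf.le hf.left_ne_top hf.right_ne_bot hf.lieb
  have hgC : ∀ x, |clip QL QR D f x| ≤ B + D / 2 := abs_clip_le hD hB
  obtain ⟨⟨L, hL⟩, -⟩ := H.sys.exists_lipschitz (measurable_clip hm) hgC heq
  have hgL := lipschitzWith_clip hf.le hf.left_ne_top hf.right_ne_bot hL hf.boundary_right
    hf.boundary_left
  have hmono := H.sys.strictMono hgL hgC heq (by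
    filter_upwards [ae_between_deriv_clip (D := D) (f := f) hf.le] with x hx f' h1 _ using hx f' h1)
  refine ⟨hm, fun x => ?_⟩
  rw [heq x]
  congr 2
  funext μ
  exact clip_eq_clamp hf.le hf.left_ne_top hf.right_ne_bot hD hmono.monotone hf.boundary_right
    hf.boundary_left μ

lemma solvesTwoEndpoint_of_isTruncated (H : LineModel Δ S ζ κ s) (hD : 0 ≤ D)
    (hf : LineSystem.IsTruncated S ζ s D f) (hLR : QL ≤ QR) (hL : QL ≠ ⊤) (hR : QR ≠ ⊥)
    (h₁ : HasBoundaryValue f (D / 2) QR) (h₂ : HasBoundaryValue f (-(D / 2)) QL) :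
    SolvesTwoEndpoint Δ D QL QR f := by
  have hmono := (LineSystem.IsTruncated.strictMono H.sys hD hf).monotone
  obtain ⟨-, B, hB⟩ := H.sys.exists_lipschitz hf.measurable_clamp (fun x => abs_clamp_le hD _) hf.eqn
  refine ⟨hL, hR, hLR, fun h => absurd h H.le_one, ?_, h₁, h₂⟩
  refine H.solvesLieb_of_eqn hLR hL hR hf.measurable hB fun x => ?_
  rw [hf.eqn x]
  congr 2
  funext μ
  exact (clip_eq_clamp hLR hL hR hD hmono h₁ h₂ μ).symm

end LineModel

lemma hasBoundaryValue_neg {f : ℝ → ℝ} (hf : ∀ x, f (-x) = -f x) (c : ℝ) (Q : EReal) :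
    HasBoundaryValue f (-c) (-Q) ↔ HasBoundaryValue f c Q := by
  have hf' : f = fun x => -f (-x) := funext fun x => by rw [hf, neg_neg]
  induction Q using EReal.rec with
  | bot =>
    change Tendsto f atTop (𝓝 (-c)) ↔ Tendsto f atBot (𝓝 c)
    constructor
    · intro h
      rw [hf']
      simpa using (h.comp tendsto_neg_atBot_atTop).neg
    · intro h
      rw [hf']
      exact (h.comp tendsto_neg_atTop_atBot).neg
  | top =>
    change Tendsto f atBot (𝓝 (-c)) ↔ Tendsto f atTop (𝓝 c)
    constructor
    · intro h
      rw [hf']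
      simpa using (h.comp tendsto_neg_atTop_atBot).neg
    · intro h
      rw [hf']
      exact (h.comp tendsto_neg_atBot_atTop).neg
  | coe q =>
    change f (-q) = -c ↔ f q = c
    rw [hf]
    exact neg_inj

/-- The symmetric problem is the two-endpoint problem on a symmetric interval, provided that its
solutions are odd. -/
lemma SolvesFermiBoundary.solvesTwoEndpoint {Δ D : ℝ} {Q : EReal} {g : ℝ → ℝ}
    (hg : SolvesFermiBoundary Δ D Q g) (hodd : ∀ x, g (-x) = -g x) :
    SolvesTwoEndpoint Δ D (-Q) Q g := by
  have h0 := hg.nonneg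
  refine ⟨?_, ?_, ?_, ?_, hg.lieb, hg.boundary, (hasBoundaryValue_neg hodd _ _).2 hg.boundary⟩
  · intro h
    rw [EReal.neg_eq_top_iff] at h
    rw [h] at h0
    exact absurd h0 (by simp)
  · rintro rfl
    exact absurd h0 (by simp)
  · exact (EReal.neg_le_of_neg_le (by simpa using h0)).trans h0
  · intro h
    have hQ := hg.le_half_period h
    induction Q using EReal.rec with
    | bot => exact absurd h0 (by simp)
    | top => exact absurd hQ (by simp)
    | coe q =>
      have hq : q ≤ Real.pi / 2 := EReal.coe_le_coe_iff.1 hQ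
      rw [← EReal.coe_neg, ← EReal.coe_sub, EReal.coe_le_coe_iff]
      linarith

lemma SolvesTwoEndpoint.solvesFermiBoundary {Δ D : ℝ} {Q : EReal} {g : ℝ → ℝ}
    (hg : SolvesTwoEndpoint Δ D (-Q) Q g) (h0 : 0 ≤ Q)
    (hQ : 1 < Δ → Q ≤ ((Real.pi / 2 : ℝ) : EReal)) : SolvesFermiBoundary Δ D Q g :=
  ⟨h0, hQ, hg.lieb, hg.boundary_right⟩

namespace LineModel
variable {Δ : ℝ} {S : StripKernel} {ζ κ : ℝ} {s : ℝ → ℝ} {D : ℝ} {f : ℝ → ℝ}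

lemma odd_of_solvesFermiBoundary (H : LineModel Δ S ζ κ s) (hD : 0 ≤ D) {Q : EReal}
    (hf : SolvesFermiBoundary Δ D Q f) (x : ℝ) : f (-x) = -f x := by
  have h0 := hf.nonneg
  have hR : Q ≠ ⊥ := by rintro rfl; exact absurd h0 (by simp)
  have hL : -Q ≠ ⊤ := by rwa [ne_eq, EReal.neg_eq_top_iff]
  have hLR : -Q ≤ Q := (EReal.neg_le_of_neg_le (by simpa using h0)).trans h0
  obtain ⟨hm, ⟨B, hB⟩, heq⟩ := H.eqn_of_solvesLieb hLR hL hR hf.lieb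
  set g := clip (-Q) Q D f
  have hgm : Measurable g := measurable_clip hm
  have hgn : Measurable fun μ => g (-μ) := hgm.comp measurable_neg
  have hgC : ∀ x, |g x| ≤ B + D / 2 := abs_clip_le hD hB
  have hflip : ∀ x, S.pot Set.univ g ζ (-x) = S.pot Set.univ (fun μ => g (-μ)) ζ x := by
    intro x
    simp only [StripKernel.pot, Measure.restrict_univ]
    rw [← integral_neg_eq_self (fun μ => S.p ζ (-x - μ) * g μ)]
    congr 1
    funext μ
    rw [show -x - -μ = -(x - μ) by ring, H.sys.p_neg]
  have hb : ∀ μ, Between (g μ + g (-μ)) (f μ + f (-μ)) := by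
    intro μ
    rcases lt_or_ge (μ : EReal) (-Q) with h | h
    · have h' : Q < ((-μ : ℝ) : EReal) := by
        rw [EReal.coe_neg]; exact EReal.lt_neg_comm.1 h
      simp only [g]
      rw [clip_of_lt h, clip_of_gt hLR h', neg_add_cancel]
      exact between_zero _
    · rcases lt_or_ge Q (μ : EReal) with h' | h'
      · have h'' : ((-μ : ℝ) : EReal) < -Q := by
          rw [EReal.coe_neg]; exact EReal.neg_lt_neg_iff.2 h'
        simp only [g]
        rw [clip_of_gt hLR h', clip_of_lt h'', add_neg_cancel]
        exact between_zero _
      · have h'' : -μ ∈ interval (-Q) Q := by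
          refine ⟨?_, ?_⟩
          · rw [EReal.coe_neg]; exact EReal.neg_le_neg_iff.2 h'
          · rw [EReal.coe_neg]; exact EReal.neg_le_of_neg_le h
        simp only [g]
        rw [clip_of_mem ⟨h, h'⟩, clip_of_mem h'']
        exact between_self _
  have := H.sys.uniq (fun x => f x + f (-x)) (fun x => g x + g (-x)) (B + B)
    (hgm.add hgn)
    (fun x => (abs_add_le _ _).trans (add_le_add (hB _) (hB _))) hb (fun x => by
      rw [heq x, heq (-x), H.sys.s_neg, hflip]
      simp only [StripKernel.pot, mul_add]
      rw [integral_add (H.sys.window.integrableOn_p_mul H.sys.mem hgm hgC x)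
        (H.sys.window.integrableOn_p_mul H.sys.mem hgn (fun x => hgC _) x)]
      ring) x
  linarith

/-- The position at which the solution of the truncated equation takes the value `D/2`. -/
lemma exists_boundary (H : LineModel Δ S ζ κ s) (hD : 0 ≤ D) (hD1 : D ≤ 1 / 2)
    (hf : LineSystem.IsTruncated S ζ s D f) :
    ∃ q : EReal, 0 ≤ q ∧ (∀ Q : EReal, Q ≠ ⊥ → (HasBoundaryValue f (D / 2) Q ↔ Q = q)) ∧
      (0 < D → 0 < q) ∧ (D < 1 / 2 → q < ⊤) := by
  have hmono := LineSystem.IsTruncated.strictMono H.sys hD hf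
  have hcont : Continuous f := by
    obtain ⟨⟨L, hL⟩, -⟩ := H.sys.exists_lipschitz hf.measurable_clamp (fun x => abs_clamp_le hD _) hf.eqn
    exact hL.continuous
  have h0 : f 0 = 0 := by
    have := LineSystem.IsTruncated.neg H.sys hD hf 0
    rw [neg_zero] at this
    linarith
  rcases eq_or_lt_of_le hD1 with hD2 | hD2
  · have hlim := LineSystem.IsTruncated.tendsto_of_eq H.sys hD hf hD2
    refine ⟨⊤, le_top, fun Q hQ => ?_, fun _ => EReal.zero_lt_top, fun h => absurd h (by linarith)⟩
    induction Q using EReal.rec with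
    | bot => exact absurd rfl hQ
    | top => exact iff_of_true hlim rfl
    | coe q =>
      refine iff_of_false (fun h => ?_) (EReal.coe_ne_top q)
      change f q = D / 2 at h
      have h1 := hmono (lt_add_one q)
      have h2 := hmono.monotone.ge_of_tendsto hlim (q + 1)
      linarith
  · obtain ⟨L, hL, hDL⟩ := LineSystem.IsTruncated.tendsto_of_lt H.sys hD hf hD2
    obtain ⟨b, hb0, hb⟩ := ((eventually_ge_atTop 0).and (hL.eventually (lt_mem_nhds hDL))).exists
    obtain ⟨q, hq, hfq⟩ := intermediate_value_Icc hb0 hcont.continuousOn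
      (show D / 2 ∈ Set.Icc (f 0) (f b) from ⟨by rw [h0]; linarith, hb.le⟩)
    refine ⟨q, by exact_mod_cast hq.1, fun Q hQ => ?_, fun hD0 => ?_, fun _ => EReal.coe_lt_top q⟩
    · induction Q using EReal.rec with
      | bot => exact absurd rfl hQ
      | top =>
        refine iff_of_false (fun h => ?_) (EReal.coe_ne_top q).symm
        have := tendsto_nhds_unique hL h
        linarith
      | coe r =>
        change f r = D / 2 ↔ _
        rw [← hfq, hmono.injective.eq_iff, EReal.coe_eq_coe_iff]
    · have : 0 < q := by
        refine lt_of_le_of_ne hq.1 fun h => ?_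
        rw [← h, h0] at hfq
        linarith
      exact_mod_cast this

theorem main (H : LineModel Δ S ζ κ s) (hD : D ∈ Set.Icc (0 : ℝ) (1 / 2)) :
    ∃ (q : EReal) (p : ℝ → ℝ),
      (∀ (Q : EReal) (g : ℝ → ℝ), SolvesFermiBoundary Δ D Q g ↔ Q = q ∧ g = p) ∧
      (∀ (QL QR : EReal) (f : ℝ → ℝ), SolvesTwoEndpoint Δ D QL QR f ↔ QL = -q ∧ QR = q ∧ f = p) ∧
      (0 < D → 0 < q) ∧
      (D < 1 / 2 → q < if 1 < Δ then ((Real.pi / 2 : ℝ) : EReal) else ⊤) := by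
  obtain ⟨hD0, hD1⟩ := hD
  obtain ⟨f, hf⟩ := H.sys.exists_isTruncated hD0 hD1
  obtain ⟨q, hq0, hq, hqpos, hqtop⟩ := H.exists_boundary hD0 hD1 hf
  have hodd := LineSystem.IsTruncated.neg H.sys hD0 hf
  have hqb : q ≠ ⊥ := by rintro rfl; exact absurd hq0 (by simp)
  have hsol : SolvesTwoEndpoint Δ D (-q) q f := by
    have h1 : HasBoundaryValue f (D / 2) q := (hq q hqb).2 rfl
    refine H.solvesTwoEndpoint_of_isTruncated hD0 hf
      ((EReal.neg_le_of_neg_le (by simpa using hq0)).trans hq0)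
      (by rwa [ne_eq, EReal.neg_eq_top_iff]) hqb h1 ((hasBoundaryValue_neg hodd _ _).2 h1)
  have huniq : ∀ (QL QR : EReal) (g : ℝ → ℝ), SolvesTwoEndpoint Δ D QL QR g →
      QL = -q ∧ QR = q ∧ g = f := by
    intro QL QR g hg
    have hgf : g = f := LineSystem.IsTruncated.ext H.sys hD0
      (H.isTruncated_of_solvesTwoEndpoint hD0 hg) hf
    subst hgf
    refine ⟨?_, (hq QR hg.right_ne_bot).1 hg.boundary_right, rfl⟩
    have h1 := (hasBoundaryValue_neg hodd (D / 2) (-QL)).1 (by rw [neg_neg]; exact hg.boundary_left)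
    have h2 := (hq (-QL) (by rw [ne_eq, EReal.neg_eq_bot_iff]; exact hg.left_ne_top)).1 h1
    rw [← h2, neg_neg]
  refine ⟨q, f, fun Q g => ⟨fun hg => ?_, ?_⟩, fun QL QR g => ⟨huniq QL QR g, ?_⟩, hqpos, ?_⟩
  · obtain ⟨-, h1, h2⟩ := huniq _ _ _ (hg.solvesTwoEndpoint (H.odd_of_solvesFermiBoundary hD0 hg))
    exact ⟨h1, h2⟩
  · rintro ⟨rfl, rfl⟩
    exact hsol.solvesFermiBoundary hq0 fun h => absurd h H.le_one
  · rintro ⟨rfl, rfl, rfl⟩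
    exact hsol
  · rw [if_neg H.le_one]
    exact hqtop

end LineModel

namespace StripKernel
variable {S : StripKernel} {ζ : ℝ}

lemma isWindow_univ (h : Integrable fun u => 1 / (S.A u + 1)) : S.IsWindow Set.univ := by
  refine ⟨fun x => (h.comp_sub_left x).integrableOn,
    ∫ u, 1 / (S.A u + 1), ?_, fun x => ?_⟩
  · exact integral_nonneg fun u => (one_div_pos.2 (S.A_add_pos one_pos u)).le
  · rw [Measure.restrict_univ, integral_sub_left_eq_self (fun u => 1 / (S.A u + 1)) volume x]

lemma integrable_p (h : Integrable fun u => 1 / (S.A u + 1)) {y : ℝ} (hy : y ∈ S.J) :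
    Integrable (S.p y) := by
  have h1 := ((isWindow_univ h).integrableOn_p hy 0).integrable
  rw [Measure.restrict_univ] at h1
  simpa using h1.comp_sub_left 0

lemma IsWindow.uniformContinuous_pot {W : Set ℝ} (hW : S.IsWindow W) {y : ℝ} (hy : y ∈ S.J)
    {b : ℝ → ℝ} {C : ℝ} (hb : Measurable b) (hC : ∀ μ, |b μ| ≤ C) :
    UniformContinuous (S.pot W b y) := by
  obtain ⟨L, hL0, hL⟩ := hW.exists_abs_pot_sub_le hy
  exact uniformContinuous_of_abs_sub_le fun x x' =>
    hL b C hb ((abs_nonneg _).trans (hC 0)) hC x x'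

/-- The total mass of the kernel is read off from the limits of its primitive. -/
lemma integral_p_of_tendsto (h : Integrable fun u => 1 / (S.A u + 1)) {y c : ℝ} (hy : y ∈ S.J)
    {Θ : ℝ → ℝ} (hΘ : ∀ x, HasDerivAt Θ (2 * Real.pi * S.p y x) x)
    (h1 : Tendsto Θ atTop (𝓝 (Real.pi * c))) (h2 : Tendsto Θ atBot (𝓝 (-(Real.pi * c)))) :
    ∫ x, S.p y x = c := by
  have := integral_of_hasDerivAt_of_tendsto hΘ ((integrable_p h hy).const_mul _) h2 h1
  rw [integral_const_mul] at this
  have hpi := Real.pi_pos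
  have : 2 * Real.pi * ∫ x, S.p y x = 2 * Real.pi * c := by linarith
  exact mul_left_cancel₀ (by positivity) this

lemma exists_mul_le_A {δ a : ℝ} (ha : 0 < a) (h : ∀ u, δ ≤ |u| → a ≤ S.A u) :
    ∃ c > 0, ∀ u, δ ≤ |u| → c * (S.A u + 1) ≤ S.A u := by
  refine ⟨a / (a + 1), by positivity, fun u hu => ?_⟩
  have h1 := h u hu
  rw [div_mul_eq_mul_div, div_le_iff₀ (by positivity)]
  nlinarith

/-- A bound from below by an outer estimate gives the positivity of densities. -/
lemma density_pos_of_outer {W U : Set ℝ} (hW : S.IsWindow W) (hS : S.IsAdmissible ζ)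
    {m ρ : ℝ → ℝ} {C : ℝ} (hm : Measurable m) (hC : ∀ μ, |m μ| ≤ C)
    (hρ : ∀ x, ρ x = S.p (ζ / 2) x - S.pot W m ζ x) (hb : ∀ μ, m μ ≤ max (ρ μ) 0)
    (hU : MeasurableSet U)
    (hconv : ∀ y ∈ S.J, ∀ x, S.pot W (fun μ => max (ρ μ) 0) y x =
      ∫ u in U, S.p y u * max (ρ (x - u)) 0)
    (hint : IntegrableOn (fun u => 1 / (S.A u + 1)) U)
    (hmass : ∀ y, 0 < y → y < ζ → ∫ u in U, S.p y u ≤ 1) (hN0 : S.N 0 = 0)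
    (hA : ∀ δ > 0, ∃ c > 0, ∀ u ∈ U, δ ≤ |u| → c * (S.A u + 1) ≤ S.A u)
    (hO : ∀ M ≤ 0, ∀ y₀, ζ / 2 < y₀ → y₀ < ζ → (∀ x, M ≤ S.outer W m ζ y₀ x) →
      ∀ y, y₀ ≤ y → y < ζ → ∀ x, M ≤ S.outer W m ζ y x) :
    (∀ x, 0 ≤ ρ x) ∧ ∀ a b, a < b → ∃ x ∈ Set.Ioo a b, ρ x ≠ 0 := by
  have hζ := hS.pos
  have hJ : ζ ∈ S.J := hS.mem_J ζ hζ (by linarith)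
  have hJ2 : ζ / 2 ∈ S.J := hS.mem_J _ (by linarith) (by linarith)
  obtain ⟨L, hL⟩ := hW.exists_abs_density_sub_le hm hC hJ2 hJ
  obtain ⟨E, hE0, hE⟩ := hW.exists_integral_abs_p_le hJ
  have hC0 : 0 ≤ C := (abs_nonneg _).trans (hC 0)
  set R := |S.N (ζ / 2)| / (2 * Real.pi) * (1 / min 1 (S.B (ζ / 2))) + C * E
  have hR : ∀ x, |ρ x| ≤ R := by
    intro x
    rw [hρ x]
    refine (abs_sub _ _).trans (add_le_add (p_le hJ2 x) ((hW.abs_pot_le hJ hC x).trans ?_))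
    exact mul_le_mul_of_nonneg_left (hE x) hC0
  have hr : UniformContinuous fun x => max (ρ x) 0 := by
    refine uniformContinuous_of_abs_sub_le (L := L) fun x x' hx => ?_
    refine (abs_max_sub_max_le_abs _ _ _).trans ?_
    rw [hρ x, hρ x']
    exact hL x x' hx
  refine ⟨hW.density_nonneg hS hm hC hρ hb ?_ hO, fun a b hab => hW.density_ne_zero hS hm hC hρ hab⟩
  exact eventually_pot_le hS hU hconv hint hmass hN0 hA (fun x => le_max_right _ _)
    (R := R) (fun x => max_le ((le_abs_self _).trans (hR x)) ((abs_nonneg _).trans (hR x))) hr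

lemma density_pos_of_outer_univ (hi : Integrable fun u => 1 / (S.A u + 1)) (hS : S.IsAdmissible ζ)
    {m ρ : ℝ → ℝ} {C : ℝ} (hm : Measurable m) (hC : ∀ μ, |m μ| ≤ C)
    (hρ : ∀ x, ρ x = S.p (ζ / 2) x - S.pot Set.univ m ζ x) (hb : ∀ μ, Between (m μ) (ρ μ))
    (hmass : ∀ y, 0 < y → y < ζ → ∫ u, S.p y u ≤ 1) (hN0 : S.N 0 = 0)
    (hA : ∀ δ > 0, ∃ a > 0, ∀ u, δ ≤ |u| → a ≤ S.A u)
    (hO : ∀ M ≤ 0, ∀ y₀, ζ / 2 < y₀ → y₀ < ζ → (∀ x, M ≤ S.outer Set.univ m ζ y₀ x) →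
      ∀ y, y₀ ≤ y → y < ζ → ∀ x, M ≤ S.outer Set.univ m ζ y x) :
    (∀ x, 0 ≤ ρ x) ∧ ∀ a b, a < b → ∃ x ∈ Set.Ioo a b, ρ x ≠ 0 := by
  refine density_pos_of_outer (isWindow_univ hi) hS hm hC hρ (fun μ => (hb μ).le_max)
    MeasurableSet.univ (fun y _ x => ?_) hi.integrableOn (by simpa using hmass) hN0 (fun δ hδ => ?_) hO
  · unfold pot
    rw [Measure.restrict_univ,
      ← integral_sub_left_eq_self (fun u => S.p y u * max (ρ (x - u)) 0) volume x]
    simp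
  · obtain ⟨a, ha, h⟩ := hA δ hδ
    obtain ⟨c, hc, h'⟩ := exists_mul_le_A ha h
    exact ⟨c, hc, fun u _ => h' u⟩

/-- Positivity of densities for a nonpositive kernel of mass less than one. -/
lemma density_pos_of_nonpos (hi : Integrable fun u => 1 / (S.A u + 1)) (hJ : ζ ∈ S.J)
    {m ρ : ℝ → ℝ} {C κ : ℝ} (hm : Measurable m) (hC : ∀ μ, |m μ| ≤ C)
    (hρ : ∀ x, ρ x = S.p (ζ / 2) x - S.pot Set.univ m ζ x) (hb : ∀ μ, Between (m μ) (ρ μ))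
    (hp : ∀ x, S.p ζ x ≤ 0) (ha : ∀ x, 0 < S.p (ζ / 2) x) (hκ1 : κ < 1)
    (hκ : ∫ u, |S.p ζ u| ≤ κ) :
    (∀ x, 0 ≤ ρ x) ∧ ∀ a b, a < b → ∃ x ∈ Set.Ioo a b, ρ x ≠ 0 := by
  have hW := isWindow_univ hi
  have hκ0 : 0 ≤ κ := (integral_nonneg fun _ => abs_nonneg _).trans hκ
  have hC0 : 0 ≤ C := (abs_nonneg _).trans (hC 0)
  have hmass : ∀ x, ∫ μ in Set.univ, |S.p ζ (x - μ)| ≤ κ := by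
    intro x
    rwa [Measure.restrict_univ, integral_sub_left_eq_self (fun u => |S.p ζ u|) volume x]
  have hstep : ∀ M, 0 ≤ M → (∀ x, -M ≤ m x) → ∀ x, S.p (ζ / 2) x - κ * M ≤ ρ x := by
    intro M hM hmM x
    rw [hρ x]
    have : S.pot Set.univ m ζ x ≤ ∫ μ in Set.univ, |S.p ζ (x - μ)| * M := by
      refine integral_mono (hW.integrableOn_p_mul hJ hm hC x)
        ((hW.integrableOn_p hJ x).abs.mul_const M) fun μ => ?_
      simp only
      rw [abs_of_nonpos (hp _)]
      nlinarith [hp (x - μ), hmM μ]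
    rw [integral_mul_const] at this
    nlinarith [mul_le_mul_of_nonneg_right (hmass x) hM]
  have hn : ∀ n : ℕ, ∀ x, -(κ ^ n * C) ≤ m x := by
    intro n
    induction n with
    | zero => intro x; simpa using (abs_le.1 (hC x)).1
    | succ n ih =>
      intro x
      have h1 := hstep _ (by positivity) ih x
      have h2 := (hb x).min_le
      refine le_trans (le_min ?_ ?_) h2
      · rw [pow_succ]; nlinarith [(ha x).le]
      · exact neg_nonpos.2 (by positivity)
  have hm0 : ∀ x, 0 ≤ m x := by
    intro x
    have ht : Tendsto (fun n : ℕ => -(κ ^ n * C)) atTop (𝓝 (-(0 * C))) :=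
      ((tendsto_pow_atTop_nhds_zero_of_lt_one hκ0 hκ1).mul_const C).neg
    have := le_of_tendsto' ht fun n => hn n x
    simpa using this
  have hpos : ∀ x, 0 < ρ x := by
    intro x
    have := hstep 0 le_rfl (by simpa using hm0) x
    linarith [ha x]
  exact ⟨fun x => (hpos x).le, fun a b hab =>
    ⟨(a + b) / 2, ⟨by linarith, by linarith⟩, (hpos _).ne'⟩⟩

end StripKernel

/-! ### The kernels in the massless regime -/

lemma re_I_mul_log (t : ℝ) :
    (Complex.I * Complex.log ((1 - t * Complex.I) / (1 + t * Complex.I))).re = 2 * Real.arctan t := by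
  have h := Complex.ofReal_arctan (-t)
  unfold Complex.arctan at h
  push_cast at h
  rw [neg_mul, sub_neg_eq_add, ← sub_eq_add_neg] at h
  have h2 : Complex.I * Complex.log ((1 - t * Complex.I) / (1 + t * Complex.I)) =
      ((2 * Real.arctan t : ℝ) : ℂ) := by
    rw [show ((2 * Real.arctan t : ℝ) : ℂ) = -2 * ((Real.arctan (-t) : ℝ) : ℂ) by
      rw [Real.arctan_neg]; push_cast; ring, Complex.ofReal_arctan, Complex.ofReal_neg, h]
    ring
  rw [h2, Complex.ofReal_re]

lemma sinh_add_mul_I (x y : ℝ) : Complex.sinh (x + y * Complex.I) =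
    Real.sinh x * Real.cos y + Real.cosh x * Real.sin y * Complex.I := by
  rw [Complex.sinh_add, Complex.sinh_mul_I, Complex.cosh_mul_I]
  push_cast
  ring

lemma cosh_add_mul_I (x y : ℝ) : Complex.cosh (x + y * Complex.I) =
    Real.cosh x * Real.cos y + Real.sinh x * Real.sin y * Complex.I := by
  rw [Complex.cosh_add, Complex.sinh_mul_I, Complex.cosh_mul_I]
  push_cast
  ring

lemma normSq_sinh (z : ℂ) : Complex.normSq (Complex.sinh z) = Real.sinh z.re ^ 2 + Real.sin z.im ^ 2 := by
  conv_lhs => rw [← Complex.re_add_im z, sinh_add_mul_I]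
  rw [← Complex.ofReal_mul, ← Complex.ofReal_mul, Complex.normSq_add_mul_I, mul_pow, mul_pow,
    Real.cosh_sq]
  nlinarith [Real.sin_sq_add_cos_sq z.im]

lemma re_coth {z : ℂ} : (Complex.I / Real.pi * (Complex.cosh z / Complex.sinh z)).re =
    Real.sin (2 * z.im) / (2 * Real.pi * (Real.sinh z.re ^ 2 + Real.sin z.im ^ 2)) := by
  have h1 : Complex.I / Real.pi * (Complex.cosh z / Complex.sinh z) =
      ((1 / Real.pi : ℝ) : ℂ) * (Complex.I * (Complex.cosh z / Complex.sinh z)) := by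
    push_cast; ring
  rw [h1, Complex.re_ofReal_mul, Complex.I_mul_re, Complex.div_im, normSq_sinh]
  have hs : Complex.sinh z = ((Real.sinh z.re * Real.cos z.im : ℝ) : ℂ) +
      ((Real.cosh z.re * Real.sin z.im : ℝ) : ℂ) * Complex.I := by
    conv_lhs => rw [← Complex.re_add_im z, sinh_add_mul_I]
    push_cast; ring
  have hc : Complex.cosh z = ((Real.cosh z.re * Real.cos z.im : ℝ) : ℂ) +
      ((Real.sinh z.re * Real.sin z.im : ℝ) : ℂ) * Complex.I := by
    conv_lhs => rw [← Complex.re_add_im z, cosh_add_mul_I]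
    push_cast; ring
  have key : ∀ a b : ℝ, ((a : ℂ) + b * Complex.I).re = a ∧ ((a : ℂ) + b * Complex.I).im = b := by
    simp
  have r1 : (Complex.sinh z).re = Real.sinh z.re * Real.cos z.im := by rw [hs]; exact (key _ _).1
  have r2 : (Complex.sinh z).im = Real.cosh z.re * Real.sin z.im := by rw [hs]; exact (key _ _).2
  have r3 : (Complex.cosh z).re = Real.cosh z.re * Real.cos z.im := by rw [hc]; exact (key _ _).1
  have r4 : (Complex.cosh z).im = Real.sinh z.re * Real.sin z.im := by rw [hc]; exact (key _ _).2
  rw [r1, r2, r3, r4, Real.sin_two_mul]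
  have hpi := Real.pi_pos
  have hch := Real.cosh_sq z.re
  rcases eq_or_ne (Real.sinh z.re ^ 2 + Real.sin z.im ^ 2) 0 with h0 | h0
  · simp [h0]
  · field_simp
    rw [hch]
    ring

lemma hasDerivAt_coth {z : ℂ} (hz : Complex.sinh z ≠ 0) :
    HasDerivAt (fun z => Complex.I / Real.pi * (Complex.cosh z / Complex.sinh z))
      (-(Complex.I / Real.pi) / Complex.sinh z ^ 2) z := by
  refine (((Complex.hasDerivAt_cosh z).div (Complex.hasDerivAt_sinh z) hz).const_mul _).congr_deriv ?_
  have h := Complex.cosh_sq z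
  field_simp
  rw [h]
  ring

lemma norm_I_div_pi_le (w : ℂ) : ‖-(Complex.I / Real.pi) / w ^ 2‖ ≤ 1 / Complex.normSq w := by
  rw [norm_div, norm_neg, norm_div, Complex.norm_I, norm_pow, Complex.normSq_eq_norm_sq,
    Complex.norm_real, Real.norm_eq_abs, abs_of_pos Real.pi_pos]
  refine div_le_div_of_nonneg_right ?_ (by positivity)
  rw [div_le_one Real.pi_pos]
  linarith [Real.pi_gt_three]

def hypKernel : StripKernel where
  A x := Real.sinh x ^ 2
  A' x := 2 * Real.sinh x * Real.cosh x
  B y := Real.sin y ^ 2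
  N y := Real.sin (2 * y)
  F z := Complex.I / Real.pi * (Complex.cosh z / Complex.sinh z)
  J := Set.Ioo 0 Real.pi
  hasDerivAt_A x := by simpa using (Real.hasDerivAt_sinh x).fun_pow 2
  A_nonneg x := sq_nonneg _
  abs_A'_le x := by
    have h := Real.cosh_sq x
    rw [← h, abs_le]
    constructor <;> nlinarith [sq_nonneg (Real.sinh x + Real.cosh x), sq_nonneg (Real.sinh x - Real.cosh x)]
  continuous_B := by fun_prop
  continuous_N := by fun_prop
  isOpen_J := isOpen_Ioo
  ordConnected_J := Set.ordConnected_Ioo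
  B_pos y hy := pow_pos (Real.sin_pos_of_mem_Ioo hy) 2
  differentiableAt_F z hz := by
    have h : Complex.sinh z ≠ 0 := by
      rw [← Complex.normSq_pos, normSq_sinh]
      have := pow_pos (Real.sin_pos_of_mem_Ioo hz) 2
      positivity
    exact (hasDerivAt_coth h).differentiableAt
  norm_deriv_F_le z hz := by
    have h : Complex.sinh z ≠ 0 := by
      rw [← Complex.normSq_pos, normSq_sinh]
      have := pow_pos (Real.sin_pos_of_mem_Ioo hz) 2
      positivity
    rw [(hasDerivAt_coth h).deriv, ← normSq_sinh]
    exact norm_I_div_pi_le _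
  re_F z _ := re_coth

def ratKernel : StripKernel where
  A x := x ^ 2
  A' x := 2 * x
  B y := y ^ 2
  N y := 2 * y
  F z := Complex.I / Real.pi * z⁻¹
  J := Set.Ioi 0
  hasDerivAt_A x := by simpa using hasDerivAt_pow 2 x
  A_nonneg x := sq_nonneg _
  abs_A'_le x := by rw [abs_le]; constructor <;> nlinarith [sq_nonneg (x + 1), sq_nonneg (x - 1)]
  continuous_B := by fun_prop
  continuous_N := by fun_prop
  isOpen_J := isOpen_Ioi
  ordConnected_J := Set.ordConnected_Ioi
  B_pos y hy := pow_pos hy 2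
  differentiableAt_F z hz := by
    have h : z ≠ 0 := by rintro rfl; exact lt_irrefl (0 : ℝ) hz
    exact ((hasDerivAt_inv h).const_mul _).differentiableAt
  norm_deriv_F_le z hz := by
    have h : z ≠ 0 := by rintro rfl; exact lt_irrefl (0 : ℝ) hz
    rw [((hasDerivAt_inv h).const_mul _).deriv]
    have e : Complex.I / Real.pi * -(z ^ 2)⁻¹ = -(Complex.I / Real.pi) / z ^ 2 := by ring
    have e2 : z.re ^ 2 + z.im ^ 2 = Complex.normSq z := by rw [Complex.normSq_apply]; ring
    rw [e, e2]
    exact norm_I_div_pi_le _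
  re_F z hz := by
    have h1 : Complex.I / Real.pi * z⁻¹ = ((1 / Real.pi : ℝ) : ℂ) * (Complex.I * z⁻¹) := by
      push_cast; ring
    have e2 : Complex.normSq z = z.re ^ 2 + z.im ^ 2 := by rw [Complex.normSq_apply]; ring
    rw [h1, Complex.re_ofReal_mul, Complex.I_mul_re, Complex.inv_im, e2]
    have hpi := Real.pi_pos
    have : 0 < z.re ^ 2 + z.im ^ 2 := by have := pow_pos (show 0 < z.im from hz) 2; positivity
    field_simp

section phases

lemma phaseHyp_eq {η : ℝ} (hη : η ∈ Set.Ioo 0 Real.pi) (x : ℝ) :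
    phaseHyp η x = 2 * Real.arctan (Real.tanh x * (Real.cos η / Real.sin η)) := by
  have hs : Real.sin η ≠ 0 := (Real.sin_pos_of_mem_Ioo hη).ne'
  have hc : Real.cosh x ≠ 0 := (Real.cosh_pos x).ne'
  rw [← re_I_mul_log]
  unfold phaseHyp
  set t := Real.tanh x * (Real.cos η / Real.sin η)
  have ht : Real.cosh x * Real.sin η * t = Real.sinh x * Real.cos η := by
    simp only [t]
    rw [Real.tanh_eq_sinh_div_cosh]
    field_simp
  have ht' : (Real.sinh x : ℂ) * Real.cos η = Real.cosh x * Real.sin η * t := by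
    exact_mod_cast ht.symm
  have hI := Complex.I_mul_I
  have e1 : Complex.sinh (Complex.I * η + x) =
      (Complex.I * (Real.cosh x * Real.sin η)) * (1 - t * Complex.I) := by
    rw [add_comm, mul_comm, sinh_add_mul_I, ht']
    linear_combination (Real.cosh x * Real.sin η * t : ℂ) * hI
  have e2 : Complex.sinh (Complex.I * η - x) =
      (Complex.I * (Real.cosh x * Real.sin η)) * (1 + t * Complex.I) := by
    have := sinh_add_mul_I (-x) η
    rw [show Complex.I * η - x = ((-x : ℝ) : ℂ) + η * Complex.I by push_cast; ring, this,
      Real.sinh_neg, Real.cosh_neg, Complex.ofReal_neg, neg_mul, ht']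
    linear_combination (-(Real.cosh x * Real.sin η * t : ℂ)) * hI
  have hne : Complex.I * (Real.cosh x * Real.sin η) ≠ 0 := by
    refine mul_ne_zero Complex.I_ne_zero ?_
    exact_mod_cast mul_ne_zero hc hs
  rw [e1, e2, mul_div_mul_left _ _ hne]

lemma phaseRat_eq {η : ℝ} (hη : 0 < η) (x : ℝ) : phaseRat η x = 2 * Real.arctan (x / η) := by
  rw [← re_I_mul_log]
  unfold phaseRat
  have hne : Complex.I * (η : ℂ) ≠ 0 :=
    mul_ne_zero Complex.I_ne_zero (Complex.ofReal_ne_zero.2 hη.ne')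
  have hη' : (η : ℂ) ≠ 0 := Complex.ofReal_ne_zero.2 hη.ne'
  have hI := Complex.I_mul_I
  have e1 : Complex.I * η + x = (Complex.I * η) * (1 - ((x / η : ℝ) : ℂ) * Complex.I) := by
    push_cast
    field_simp
    linear_combination (x : ℂ) * hI
  have e2 : Complex.I * η - x = (Complex.I * η) * (1 + ((x / η : ℝ) : ℂ) * Complex.I) := by
    push_cast
    field_simp
    linear_combination (-(x : ℂ)) * hI
  rw [e1, e2, mul_div_mul_left _ _ hne]

lemma phaseHyp_neg {η : ℝ} (hη : η ∈ Set.Ioo 0 Real.pi) (x : ℝ) :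
    phaseHyp η (-x) = -phaseHyp η x := by
  rw [phaseHyp_eq hη, phaseHyp_eq hη, Real.tanh_neg, neg_mul, Real.arctan_neg, mul_neg]

lemma phaseRat_neg {η : ℝ} (hη : 0 < η) (x : ℝ) : phaseRat η (-x) = -phaseRat η x := by
  rw [phaseRat_eq hη, phaseRat_eq hη, neg_div, Real.arctan_neg, mul_neg]

lemma abs_two_arctan_le (t : ℝ) : |2 * Real.arctan t| ≤ Real.pi := by
  rw [abs_le]
  constructor <;> linarith [Real.neg_pi_div_two_lt_arctan t, Real.arctan_lt_pi_div_two t]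

lemma hasDerivAt_phaseHyp {η : ℝ} (hη : η ∈ Set.Ioo 0 Real.pi) (x : ℝ) :
    HasDerivAt (phaseHyp η) (2 * Real.pi * hypKernel.p η x) x := by
  rw [show phaseHyp η = _ from funext (phaseHyp_eq hη)]
  have hs := Real.sin_pos_of_mem_Ioo hη
  have hc := Real.cosh_pos x
  have ht : HasDerivAt Real.tanh (1 / Real.cosh x ^ 2) x := by
    rw [show Real.tanh = fun x => Real.sinh x / Real.cosh x from
      funext Real.tanh_eq_sinh_div_cosh]
    refine ((Real.hasDerivAt_sinh x).fun_div (Real.hasDerivAt_cosh x) hc.ne').congr_deriv ?_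
    have := Real.cosh_sq x
    field_simp
    linarith
  refine (((ht.mul_const (Real.cos η / Real.sin η)).arctan).const_mul 2).congr_deriv ?_
  change _ = 2 * Real.pi * (Real.sin (2 * η) / (2 * Real.pi * (Real.sinh x ^ 2 + Real.sin η ^ 2)))
  have h1 : Real.sinh x ^ 2 + Real.sin η ^ 2 =
      Real.cosh x ^ 2 * Real.sin η ^ 2 + Real.sinh x ^ 2 * Real.cos η ^ 2 := by
    rw [Real.cosh_sq x]
    nlinarith [Real.sin_sq_add_cos_sq η]
  have h2 : 0 < Real.cosh x ^ 2 * Real.sin η ^ 2 + Real.sinh x ^ 2 * Real.cos η ^ 2 := by positivity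
  have hpi := Real.pi_pos
  rw [Real.tanh_eq_sinh_div_cosh, Real.sin_two_mul, h1]
  field_simp

lemma hasDerivAt_phaseRat {η : ℝ} (hη : 0 < η) (x : ℝ) :
    HasDerivAt (phaseRat η) (2 * Real.pi * ratKernel.p η x) x := by
  rw [show phaseRat η = _ from funext (phaseRat_eq hη)]
  refine ((((hasDerivAt_id x).div_const η).arctan).const_mul 2).congr_deriv ?_
  change _ = 2 * Real.pi * (2 * η / (2 * Real.pi * (x ^ 2 + η ^ 2)))
  have hpi := Real.pi_pos
  simp only [id]
  field_simp
  ring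

lemma tendsto_tanh_atTop : Tendsto Real.tanh atTop (𝓝 1) := by
  have h : Tendsto (fun x : ℝ => 1 - 2 / (Real.exp (2 * x) + 1)) atTop (𝓝 (1 - 0)) := by
    refine tendsto_const_nhds.sub (tendsto_const_nhds.div_atTop ?_)
    exact (Real.tendsto_exp_atTop.comp (tendsto_id.const_mul_atTop two_pos)).atTop_add
      tendsto_const_nhds
  rw [sub_zero] at h
  refine h.congr fun x => ?_
  rw [Real.tanh_eq_sinh_div_cosh, Real.sinh_eq, Real.cosh_eq, Real.exp_neg, two_mul, Real.exp_add]
  have := Real.exp_pos x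
  field_simp
  ring

lemma tendsto_phaseHyp {η : ℝ} (hη : η ∈ Set.Ioo 0 Real.pi) :
    Tendsto (phaseHyp η) atTop (𝓝 (Real.pi * (1 - 2 * η / Real.pi))) := by
  rw [show phaseHyp η = _ from funext (phaseHyp_eq hη)]
  have h := ((Real.continuous_arctan.tendsto _).comp
    (tendsto_tanh_atTop.mul_const (Real.cos η / Real.sin η))).const_mul 2
  have e : 2 * Real.arctan (1 * (Real.cos η / Real.sin η)) = Real.pi * (1 - 2 * η / Real.pi) := by
    rw [one_mul, ← Real.sin_pi_div_two_sub, ← Real.cos_pi_div_two_sub η, ← Real.tan_eq_sin_div_cos,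
      Real.arctan_tan (by linarith [hη.2]) (by linarith [hη.1])]
    have := Real.pi_pos
    field_simp
  rw [e] at h
  exact h

lemma tendsto_phaseRat {η : ℝ} (hη : 0 < η) :
    Tendsto (phaseRat η) atTop (𝓝 (Real.pi * 1)) := by
  rw [show phaseRat η = _ from funext (phaseRat_eq hη)]
  have h := ((tendsto_nhds_of_tendsto_nhdsWithin Real.tendsto_arctan_atTop).comp
    (tendsto_id.atTop_div_const hη)).const_mul 2
  rw [show 2 * (Real.pi / 2) = Real.pi * 1 by ring] at h
  exact h

lemma tendsto_atBot_of_odd {f : ℝ → ℝ} {c : ℝ} (hf : ∀ x, f (-x) = -f x)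
    (h : Tendsto f atTop (𝓝 c)) : Tendsto f atBot (𝓝 (-c)) := by
  have h1 := (h.comp tendsto_neg_atBot_atTop).neg
  refine h1.congr fun x => ?_
  simp only [Function.comp]
  rw [hf, neg_neg]

end phases

lemma hypKernel_integrable : Integrable fun u => 1 / (hypKernel.A u + 1) := by
  refine integrable_inv_one_add_sq.mono' ?_ (Eventually.of_forall fun u => ?_)
  · exact (continuous_const.div (hypKernel.continuous_A.add continuous_const)
      fun u => (hypKernel.A_add_pos one_pos u).ne').aestronglyMeasurable
  · rw [Real.norm_eq_abs, abs_of_pos (one_div_pos.2 (hypKernel.A_add_pos one_pos u)), ← one_div]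
    refine one_div_le_one_div_of_le (by positivity) ?_
    change 1 + u ^ 2 ≤ Real.sinh u ^ 2 + 1
    have h1 : |u| ≤ |Real.sinh u| := by
      rw [Real.abs_sinh]
      exact Real.self_le_sinh_iff.2 (abs_nonneg u)
    have := sq_le_sq.2 h1
    linarith

lemma ratKernel_integrable : Integrable fun u => 1 / (ratKernel.A u + 1) := by
  simpa [ratKernel, add_comm] using integrable_inv_one_add_sq

lemma integral_hypKernel {y : ℝ} (hy : y ∈ Set.Ioo 0 Real.pi) :
    ∫ x, hypKernel.p y x = 1 - 2 * y / Real.pi :=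
  StripKernel.integral_p_of_tendsto hypKernel_integrable hy (hasDerivAt_phaseHyp hy)
    (tendsto_phaseHyp hy) (tendsto_atBot_of_odd (phaseHyp_neg hy) (tendsto_phaseHyp hy))

lemma integral_ratKernel {y : ℝ} (hy : 0 < y) : ∫ x, ratKernel.p y x = 1 :=
  StripKernel.integral_p_of_tendsto ratKernel_integrable hy (hasDerivAt_phaseRat hy)
    (tendsto_phaseRat hy) (tendsto_atBot_of_odd (phaseRat_neg hy) (tendsto_phaseRat hy))

lemma hypKernel_p_nonneg {y : ℝ} (hy : y ∈ Set.Ioc 0 (Real.pi / 2)) (x : ℝ) :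
    0 ≤ hypKernel.p y x :=
  StripKernel.p_nonneg (S := hypKernel) (y := y) ⟨hy.1, by linarith [hy.2, Real.pi_pos]⟩
    (Real.sin_nonneg_of_nonneg_of_le_pi (by linarith [hy.1]) (by linarith [hy.2])) x

lemma hypKernel_p_nonpos {y : ℝ} (hy : y ∈ Set.Ico (Real.pi / 2) Real.pi) (x : ℝ) :
    hypKernel.p y x ≤ 0 := by
  have h1 : hypKernel.N y ≤ 0 := by
    change Real.sin (2 * y) ≤ 0
    rw [← Real.sin_sub_two_pi]
    exact Real.sin_nonpos_of_nonpos_of_neg_pi_le (by linarith [hy.2]) (by linarith [hy.1])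
  have := hypKernel.A_add_pos (hypKernel.B_pos y ⟨by linarith [hy.1, Real.pi_pos], hy.2⟩) x
  exact div_nonpos_of_nonpos_of_nonneg h1 (by positivity)

lemma integral_abs_hypKernel {y : ℝ} (hy : y ∈ Set.Ioo 0 Real.pi) :
    ∫ x, |hypKernel.p y x| = |1 - 2 * y / Real.pi| := by
  rcases le_total y (Real.pi / 2) with h | h
  · have h0 := hypKernel_p_nonneg ⟨hy.1, h⟩
    rw [← integral_hypKernel hy, abs_of_nonneg (integral_nonneg h0)]
    exact integral_congr_ae (Eventually.of_forall fun x => abs_of_nonneg (h0 x))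
  · have h0 := hypKernel_p_nonpos ⟨h, hy.2⟩
    rw [← integral_hypKernel hy, abs_of_nonpos (integral_nonpos h0), ← integral_neg]
    exact integral_congr_ae (Eventually.of_forall fun x => abs_of_nonpos (h0 x))

lemma tendsto_sin_two_mul_div_sin_sq :
    Tendsto (fun ε : ℝ => Real.sin (2 * ε) / (2 * Real.pi * Real.sin ε ^ 2)) (𝓝[>] 0) atTop := by
  have h1 : Tendsto (fun ε : ℝ => Real.tan ε) (𝓝[>] 0) (𝓝[>] 0) := by
    rw [tendsto_nhdsWithin_iff]
    refine ⟨?_, ?_⟩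
    · have := (Real.continuousAt_tan (x := 0)).2 (by simp)
      have h := this.tendsto
      rw [Real.tan_zero] at h
      exact h.mono_left nhdsWithin_le_nhds
    · filter_upwards [Ioo_mem_nhdsGT (show (0 : ℝ) < Real.pi / 2 by positivity)] with ε hε
      exact Real.tan_pos_of_pos_of_lt_pi_div_two hε.1 hε.2
  have h2 := (tendsto_inv_nhdsGT_zero.comp h1).const_mul_atTop (inv_pos.2 Real.pi_pos)
  refine h2.congr' ?_
  filter_upwards [Ioo_mem_nhdsGT (show (0 : ℝ) < Real.pi / 2 by positivity)] with ε hε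
  have hs : 0 < Real.sin ε := Real.sin_pos_of_pos_of_lt_pi hε.1 (by linarith [hε.2, Real.pi_pos])
  have hc : 0 < Real.cos ε := Real.cos_pos_of_mem_Ioo ⟨by linarith [hε.1, Real.pi_pos], hε.2⟩
  have hpi := Real.pi_pos
  simp only [Function.comp]
  rw [Real.tan_eq_sin_div_cos, Real.sin_two_mul]
  field_simp

lemma hypKernel_isAdmissible {ζ : ℝ} (h0 : 0 < ζ) (h1 : ζ ≤ Real.pi / 2) :
    hypKernel.IsAdmissible ζ where
  pos := h0
  mem_J y hy hy2 := ⟨hy, by linarith [Real.pi_pos]⟩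
  N_nonneg y hy hy2 := Real.sin_nonneg_of_nonneg_of_le_pi (by linarith) (by linarith)
  tendsto_p_zero := by
    refine tendsto_sin_two_mul_div_sin_sq.congr fun ε => ?_
    simp [StripKernel.p, hypKernel]

lemma ratKernel_isAdmissible {ζ : ℝ} (h0 : 0 < ζ) : ratKernel.IsAdmissible ζ where
  pos := h0
  mem_J y hy _ := hy
  N_nonneg y hy _ := by change 0 ≤ 2 * y; positivity
  tendsto_p_zero := by
    refine (tendsto_inv_nhdsGT_zero.const_mul_atTop (inv_pos.2 Real.pi_pos)).congr' ?_
    filter_upwards [self_mem_nhdsWithin] with ε hε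
    have hε : ε ≠ 0 := ne_of_gt hε
    have hpi := Real.pi_pos
    simp only [StripKernel.p, ratKernel]
    field_simp
    ring

lemma hypKernel_density_pos {ζ : ℝ} (hζ : ζ ∈ Set.Ioo 0 Real.pi) (m ρ : ℝ → ℝ) (C : ℝ)
    (hm : Measurable m) (hC : ∀ μ, |m μ| ≤ C)
    (hρ : ∀ x, ρ x = hypKernel.p (ζ / 2) x - hypKernel.pot Set.univ m ζ x)
    (hb : ∀ μ, Between (m μ) (ρ μ)) :
    (∀ x, 0 ≤ ρ x) ∧ ∀ a b, a < b → ∃ x ∈ Set.Ioo a b, ρ x ≠ 0 := by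
  have hpi := Real.pi_pos
  rcases le_total ζ (Real.pi / 2) with h | h
  · refine StripKernel.density_pos_of_outer_univ hypKernel_integrable
      (hypKernel_isAdmissible hζ.1 h) hm hC hρ hb (fun y hy hyζ => ?_) ?_ (fun δ hδ => ?_) ?_
    · rw [integral_hypKernel ⟨hy, by linarith [hζ.2]⟩]
      have : 0 ≤ 2 * y / Real.pi := by positivity
      linarith
    · change Real.sin (2 * 0) = 0
      simp
    · refine ⟨Real.sinh δ ^ 2, pow_pos (Real.sinh_pos_iff.2 hδ) 2, fun u hu => ?_⟩
      change _ ≤ Real.sinh u ^ 2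
      rw [sq_le_sq, Real.abs_sinh, Real.abs_sinh, Real.sinh_le_sinh, abs_of_pos hδ]
      exact hu
    · refine (StripKernel.isWindow_univ hypKernel_integrable).le_outer_of_strip hm hC
        (h := Real.pi / 2) hζ.1 h (fun y h0 h1 => ⟨h0, by linarith⟩) fun s x => ?_
      simp only [StripKernel.p, hypKernel]
      rw [Real.sin_pi_div_two_sub, add_comm, Real.sin_add_pi_div_two,
        show 2 * (s + Real.pi / 2) = 2 * s + Real.pi by ring,
        show 2 * (Real.pi / 2 - s) = Real.pi - 2 * s by ring, Real.sin_add_pi, Real.sin_pi_sub,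
        neg_div]
  · refine StripKernel.density_pos_of_nonpos hypKernel_integrable hζ hm hC hρ hb
      (hypKernel_p_nonpos ⟨h, hζ.2⟩) (fun x => ?_) (κ := |1 - 2 * ζ / Real.pi|) ?_
      (integral_abs_hypKernel hζ).le
    · have h1 : 0 < Real.sin (ζ / 2) := Real.sin_pos_of_pos_of_lt_pi (by linarith [hζ.1]) (by linarith [hζ.2])
      have h2 : 0 < Real.sin (2 * (ζ / 2)) := Real.sin_pos_of_pos_of_lt_pi (by linarith [hζ.1]) (by linarith [hζ.2])
      simp only [StripKernel.p, hypKernel]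
      positivity
    · have h1 : 0 < 2 * ζ / Real.pi := by have := hζ.1; positivity
      have h2 : 2 * ζ / Real.pi < 2 := by rw [div_lt_iff₀ hpi]; linarith [hζ.2]
      rw [abs_lt]
      constructor <;> linarith

lemma ratKernel_density_pos {ζ : ℝ} (hζ : 0 < ζ) (m ρ : ℝ → ℝ) (C : ℝ)
    (hm : Measurable m) (hC : ∀ μ, |m μ| ≤ C)
    (hρ : ∀ x, ρ x = ratKernel.p (ζ / 2) x - ratKernel.pot Set.univ m ζ x)
    (hb : ∀ μ, Between (m μ) (ρ μ)) :
    (∀ x, 0 ≤ ρ x) ∧ ∀ a b, a < b → ∃ x ∈ Set.Ioo a b, ρ x ≠ 0 := by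
  refine StripKernel.density_pos_of_outer_univ ratKernel_integrable
    (ratKernel_isAdmissible hζ) hm hC hρ hb (fun y hy _ => (integral_ratKernel hy).le)
    (mul_zero 2) (fun δ hδ => ⟨δ ^ 2, by positivity, fun u hu => ?_⟩) ?_
  · change _ ≤ u ^ 2
    rw [sq_le_sq, abs_of_pos hδ]
    exact hu
  · refine (StripKernel.isWindow_univ ratKernel_integrable).le_outer_of_halfPlane hm hC hζ
      (fun y hy => hy) (fun y hy => ?_) fun y hy x => ?_
    · change 0 ≤ 2 * y
      positivity
    · rw [Measure.restrict_univ, integral_sub_left_eq_self (fun u => ratKernel.p y u) volume x,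
        integral_ratKernel hy]

lemma zeta_mem_Ioo {Δ : ℝ} (h0 : -1 < Δ) (h1 : Δ < 1) : zeta Δ ∈ Set.Ioo 0 Real.pi := by
  unfold zeta
  rw [if_pos h1]
  exact ⟨Real.arccos_pos.2 h1, lt_of_le_of_ne (Real.arccos_le_pi Δ)
    fun h => absurd (Real.arccos_eq_pi.1 h) (not_le.2 h0)⟩

lemma hypKernel_even (x : ℝ) : hypKernel.A (-x) = hypKernel.A x := by
  simp [hypKernel]

lemma hyp_lineSystem {ζ : ℝ} (hζ : ζ ∈ Set.Ioo 0 Real.pi) :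
    LineSystem hypKernel ζ (1 - 2 * ζ / Real.pi) (fun x => phaseHyp (ζ / 2) x / (2 * Real.pi)) := by
  have hpi := Real.pi_pos
  have hζ2 : ζ / 2 ∈ Set.Ioo 0 Real.pi := ⟨by linarith [hζ.1], by linarith [hζ.1, hζ.2]⟩
  have hW := StripKernel.isWindow_univ hypKernel_integrable
  have hlt2 : 2 * ζ / Real.pi < 2 := by rw [div_lt_iff₀ hpi]; linarith [hζ.2]
  have hlt : |1 - 2 * ζ / Real.pi| < 1 := by
    have h1 : 0 < 2 * ζ / Real.pi := by have := hζ.1; positivity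
    rw [abs_lt]
    constructor <;> linarith
  have hmass : ∀ x, ∫ μ in Set.univ, |hypKernel.p ζ (x - μ)| ≤ |1 - 2 * ζ / Real.pi| := by
    intro x
    rw [Measure.restrict_univ, integral_sub_left_eq_self (fun u => |hypKernel.p ζ u|) volume x,
      integral_abs_hypKernel hζ]
  have hd : ∀ x, HasDerivAt (fun x => phaseHyp (ζ / 2) x / (2 * Real.pi)) (hypKernel.p (ζ / 2) x) x := by
    intro x
    refine ((hasDerivAt_phaseHyp hζ2 x).div_const (2 * Real.pi)).congr_deriv ?_
    field_simp
  refine ⟨hW, hζ, hζ2, hypKernel_even, hd, fun x => ?_, ⟨Real.pi / (2 * Real.pi), fun x => ?_⟩, ?_,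
    integral_hypKernel hζ, by linarith, hypKernel_density_pos hζ, ?_, ?_⟩
  · rw [phaseHyp_neg hζ2, neg_div]
  · rw [abs_div, abs_of_pos (by positivity : 0 < 2 * Real.pi), phaseHyp_eq hζ2]
    exact div_le_div_of_nonneg_right (abs_two_arctan_le _) (by positivity)
  · have h := (tendsto_phaseHyp hζ2).div_const (2 * Real.pi)
    convert h using 2
    field_simp
    ring
  · intro h h₂ C _ hC hb heq
    exact eq_zero_of_contraction (hW.integrableOn_p hζ) hlt (abs_nonneg _) hmass hC
      (fun x => (hb x).2) heq
  · intro D hD _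
    obtain ⟨v, hv, hvD, heq⟩ := exists_clamp_solution (W := Set.univ) (k := hypKernel.p ζ)
      (s := fun x => phaseHyp (ζ / 2) x / (2 * Real.pi)) (κ := |1 - 2 * ζ / Real.pi|) hD
      (continuous_iff_continuousAt.2 fun x => (hd x).continuousAt) (hW.integrableOn_p hζ)
      (abs_nonneg _) hlt hmass
      (fun b hb hbD => (hW.uniformContinuous_pot hζ hb hbD).continuous)
    exact ⟨v, hv.measurable, hvD, heq⟩

/-- Existence of truncated solutions for a kernel of mass one, by approximation with kernels of
mass less than one. -/
lemma exists_clamp_solution_of_stable {S : StripKernel} {ζ D : ℝ} {s : ℝ → ℝ}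
    (hi : Integrable fun u => 1 / (S.A u + 1)) (hJ : ζ ∈ S.J) (hp : ∀ x, 0 ≤ S.p ζ x)
    (hp1 : ∫ x, S.p ζ x = 1) {c δ₀ : ℝ} (hc : 0 < c) (hδ₀ : 0 < δ₀)
    (hpc : ∀ x, |x| < δ₀ → c ≤ S.p ζ x) (hs : Continuous s) (hD : 0 ≤ D) :
    ∃ v : ℝ → ℝ, Measurable v ∧ (∀ x, |v x| ≤ D / 2) ∧
      ∀ x, v x = -S.pot Set.univ (fun μ => clamp D (s μ + v μ)) ζ x := by
  have hW := StripKernel.isWindow_univ hi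
  obtain ⟨L, hL0, hL⟩ := hW.exists_abs_pot_sub_le hJ
  have hmass : ∀ x, ∫ μ, |S.p ζ (x - μ)| = 1 := by
    intro x
    rw [integral_sub_left_eq_self (fun u => |S.p ζ u|) volume x, ← hp1]
    exact integral_congr_ae (Eventually.of_forall fun x => abs_of_nonneg (hp x))
  set t : ℕ → ℝ := fun n => 1 - 1 / ((n : ℝ) + 1)
  have ht0 : ∀ n, 0 ≤ t n := by
    intro n
    have : 1 / ((n : ℝ) + 1) ≤ 1 := by rw [div_le_one (by positivity)]; linarith [n.cast_nonneg (α := ℝ)]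
    simp only [t]
    linarith
  have ht1 : ∀ n, t n < 1 := by
    intro n
    have : 0 < 1 / ((n : ℝ) + 1) := by positivity
    simp only [t]
    linarith
  have htl : Tendsto t atTop (𝓝 1) := by
    simpa [t] using tendsto_const_nhds.sub (tendsto_one_div_add_atTop_nhds_zero_nat (𝕜 := ℝ))
  have hex : ∀ n, ∃ v : ℝ → ℝ, Continuous v ∧ (∀ x, |v x| ≤ D / 2) ∧
      ∀ x, v x = -(t n * S.pot Set.univ (fun μ => clamp D (s μ + v μ)) ζ x) := by
    intro n
    have hpull : ∀ (b : ℝ → ℝ) x, ∫ μ in Set.univ, t n * S.p ζ (x - μ) * b μ =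
        t n * S.pot Set.univ b ζ x := by
      intro b x
      unfold StripKernel.pot
      rw [← integral_const_mul]
      simp only [mul_assoc]
    obtain ⟨v, hv, hvD, heq⟩ := exists_clamp_solution (W := Set.univ) (k := fun x => t n * S.p ζ x)
      (s := s) (κ := t n) hD hs (fun x => (hW.integrableOn_p hJ x).const_mul _) (ht0 n) (ht1 n)
      (fun x => by
        simp only [abs_mul]
        rw [integral_const_mul, Measure.restrict_univ, hmass, abs_of_nonneg (ht0 n), mul_one])
      (fun b hb hbD => by
        simp only [hpull]
        exact continuous_const.mul (hW.uniformContinuous_pot hJ hb hbD).continuous)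
    exact ⟨v, hv, hvD, fun x => by rw [heq x, hpull]⟩
  choose v hvc hvD hveq using hex
  set g : ℕ → ℝ → ℝ := fun n μ => clamp D (s μ + v n μ)
  have hgm : ∀ n, Measurable (g n) := fun n => (continuous_clamp.comp (hs.add (hvc n))).measurable
  have hgD : ∀ n x, |g n x| ≤ D / 2 := fun n x => abs_clamp_le hD _
  have hgpot : ∀ n x, |S.pot Set.univ (g n) ζ x| ≤ D / 2 := by
    intro n x
    refine (hW.abs_pot_le hJ (hgD n) x).trans ?_
    rw [Measure.restrict_univ, hmass, mul_one]
  have hvL : ∀ n x y, |x - y| ≤ 1 → |v n x - v n y| ≤ D / 2 * L * |x - y| := by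
    intro n x y hxy
    rw [hveq n x, hveq n y, neg_sub_neg, ← mul_sub, abs_mul, abs_of_nonneg (ht0 n), abs_sub_comm]
    have := hL (g n) (D / 2) (hgm n) (by positivity) (hgD n) x y hxy
    refine (mul_le_of_le_one_left (abs_nonneg _) (ht1 n).le).trans this
  have hcauchy : ∀ x, CauchySeq fun n => v n x := by
    intro x
    refine Metric.cauchySeq_iff'.2 fun ε hε => ?_
    obtain ⟨e, he, hst⟩ := exists_stability (StripKernel.integrable_p hi hJ) hp hp1.le hc hδ₀ hpc
      (L := D * L) (η := ε / 2) (by positivity) (by positivity)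
    have hev : ∀ᶠ n in atTop, (1 - t n) * D ≤ e := by
      have h1 : Tendsto (fun n => (1 - t n) * D) atTop (𝓝 ((1 - 1) * D)) :=
        (tendsto_const_nhds.sub htl).mul_const D
      rw [sub_self, zero_mul] at h1
      exact (h1.eventually (gt_mem_nhds he)).mono fun n hn => hn.le
    obtain ⟨N, hN⟩ := eventually_atTop.1 hev
    refine ⟨N, fun n hn => ?_⟩
    rw [Real.dist_eq]
    refine lt_of_le_of_lt (hst (fun x => v n x - v N x) (fun x => g n x - g N x) (D / 2 + D / 2)
      ((hgm n).sub (hgm N)) (fun x => (abs_sub _ _).trans (add_le_add (hvD n x) (hvD N x)))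
      (fun x y hxy => ?_) (fun x => ?_) (fun x => ?_) x) (by linarith)
    · have h1 := hvL n x y hxy
      have h2 := hvL N x y hxy
      calc _ = |(v n x - v n y) - (v N x - v N y)| := by ring_nf
        _ ≤ _ := (abs_sub _ _).trans (add_le_add h1 h2)
        _ = _ := by ring
    · have := between_clamp D (s x + v n x) (s x + v N x)
      rwa [add_sub_add_left_eq_sub] at this
    · have hsub : ∫ μ, S.p ζ (x - μ) * (g n μ - g N μ) =
          S.pot Set.univ (g n) ζ x - S.pot Set.univ (g N) ζ x := by
        have i1 := hW.integrableOn_p_mul hJ (hgm n) (hgD n) x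
        have i2 := hW.integrableOn_p_mul hJ (hgm N) (hgD N) x
        unfold StripKernel.pot
        rw [← integral_sub i1 i2, Measure.restrict_univ]
        simp only [mul_sub]
      have e1 := hveq n x
      have e2 := hveq N x
      rw [hsub, e1, e2]
      have h1 := hgpot n x
      have h2 := hgpot N x
      have h3 := hN n hn
      have h4 := hN N le_rfl
      have h5 := ht1 n
      have h6 := ht1 N
      change |-(t n * S.pot Set.univ (g n) ζ x) - -(t N * S.pot Set.univ (g N) ζ x) + _| ≤ e
      calc _ = |(1 - t n) * S.pot Set.univ (g n) ζ x - (1 - t N) * S.pot Set.univ (g N) ζ x| := by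
            ring_nf
        _ ≤ (1 - t n) * (D / 2) + (1 - t N) * (D / 2) := by
            refine (abs_sub _ _).trans (add_le_add ?_ ?_)
            · rw [abs_mul, abs_of_pos (by linarith)]
              exact mul_le_mul_of_nonneg_left h1 (by linarith)
            · rw [abs_mul, abs_of_pos (by linarith)]
              exact mul_le_mul_of_nonneg_left h2 (by linarith)
        _ ≤ e := by linarith
  choose w hw using fun x => cauchySeq_tendsto_of_complete (hcauchy x)
  have hwm : Measurable w :=
    measurable_of_tendsto_metrizable (fun n => (hvc n).measurable) (tendsto_pi_nhds.2 hw)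
  refine ⟨w, hwm, fun x => le_of_tendsto (hw x).abs (Eventually.of_forall fun n => hvD n x),
    fun x => ?_⟩
  have hlim : Tendsto (fun n => S.pot Set.univ (g n) ζ x) atTop
      (𝓝 (S.pot Set.univ (fun μ => clamp D (s μ + w μ)) ζ x)) := by
    refine tendsto_integral_of_dominated_convergence (fun μ => |S.p ζ (x - μ)| * (D / 2))
      (fun n => (hW.integrableOn_p_mul hJ (hgm n) (hgD n) x).aestronglyMeasurable)
      ((hW.integrableOn_p hJ x).abs.mul_const _) (fun n => Eventually.of_forall fun μ => ?_)
      (Eventually.of_forall fun μ => ?_)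
    · rw [Real.norm_eq_abs, abs_mul]
      exact mul_le_mul_of_nonneg_left (hgD n μ) (abs_nonneg _)
    · exact ((continuous_clamp.tendsto _).comp ((hw μ).const_add (s μ))).const_mul _
  have h1 := (htl.mul hlim).neg
  rw [one_mul] at h1
  refine tendsto_nhds_unique ((hw x).congr fun n => hveq n x) h1

lemma rat_lineSystem : LineSystem ratKernel 1 1 (fun x => phaseRat (1 / 2) x / (2 * Real.pi)) := by
  have hpi := Real.pi_pos
  have hW := StripKernel.isWindow_univ ratKernel_integrable
  have hJ : (1 : ℝ) ∈ ratKernel.J := show (0 : ℝ) < 1 from one_pos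
  have hp : ∀ x, ratKernel.p 1 x = 1 / (Real.pi * (1 + x ^ 2)) := by
    intro x
    simp only [StripKernel.p, ratKernel]
    field_simp
    ring
  have hp0 : ∀ x, 0 ≤ ratKernel.p 1 x := fun x => by rw [hp]; positivity
  have hpc : ∀ x, |x| < 1 → 1 / (2 * Real.pi) ≤ ratKernel.p 1 x := by
    intro x hx
    rw [hp]
    refine one_div_le_one_div_of_le (by positivity) ?_
    have : x ^ 2 ≤ 1 := by rw [sq_le_one_iff_abs_le_one]; exact hx.le
    nlinarith
  have hd : ∀ x, HasDerivAt (fun x => phaseRat (1 / 2) x / (2 * Real.pi)) (ratKernel.p (1 / 2) x) x := by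
    intro x
    refine ((hasDerivAt_phaseRat one_half_pos x).div_const (2 * Real.pi)).congr_deriv ?_
    field_simp
  have hJ2 : (1 / 2 : ℝ) ∈ ratKernel.J := show (0 : ℝ) < 1 / 2 from one_half_pos
  refine ⟨hW, hJ, hJ2, fun x => by simp [ratKernel], hd, fun x => ?_,
    ⟨Real.pi / (2 * Real.pi), fun x => ?_⟩, ?_, integral_ratKernel one_pos, by norm_num,
    ratKernel_density_pos one_pos, ?_, ?_⟩
  · rw [phaseRat_neg one_half_pos, neg_div]
  · rw [abs_div, abs_of_pos (by positivity : 0 < 2 * Real.pi), phaseRat_eq one_half_pos]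
    exact div_le_div_of_nonneg_right (abs_two_arctan_le _) (by positivity)
  · have h := (tendsto_phaseRat one_half_pos).div_const (2 * Real.pi)
    convert h using 2
    field_simp
    norm_num
  · intro h h₂ C hm hC hb heq x
    have hC2 : ∀ x, |h₂ x| ≤ C := fun x => (hb x).2.trans (hC x)
    have hC0 : 0 ≤ C := (abs_nonneg _).trans (hC 0)
    obtain ⟨L, hL0, hL⟩ := hW.exists_abs_pot_sub_le hJ
    have hle : ∀ η > 0, |h x| ≤ η := by
      intro η hη
      obtain ⟨e, he, hst⟩ := exists_stability (StripKernel.integrable_p ratKernel_integrable hJ) hp0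
        (integral_ratKernel one_pos).le (by positivity) one_pos hpc (L := C * L) (η := η)
        (by positivity) hη
      refine hst h h₂ C hm hC (fun x y hxy => ?_) hb (fun x => ?_) x
      · rw [heq x, heq y, neg_sub_neg, abs_sub_comm]
        exact hL h₂ C hm hC0 hC2 x y hxy
      · rw [heq x, StripKernel.pot, Measure.restrict_univ, neg_add_cancel, abs_zero]
        exact he.le
    exact abs_nonpos_iff.1 (le_of_forall_pos_le_add fun η hη => by simpa using hle η hη)
  · intro D hD _
    exact exists_clamp_solution_of_stable ratKernel_integrable hJ hp0 (integral_ratKernel one_pos)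
      (by positivity) one_pos hpc (continuous_iff_continuousAt.2 fun x => (hd x).continuousAt) hD

lemma hyp_lineModel {Δ : ℝ} (h0 : -1 < Δ) (h1 : Δ < 1) :
    LineModel Δ hypKernel (zeta Δ) (1 - 2 * zeta Δ / Real.pi)
      (fun x => phaseHyp (zeta Δ / 2) x / (2 * Real.pi)) := by
  have hζ := zeta_mem_Ioo h0 h1
  have e : barePhase Δ = phaseHyp (zeta Δ) := funext fun x => if_pos h1
  refine ⟨hyp_lineSystem hζ, not_lt.2 h1.le, fun x => ?_, fun x => ?_, ?_, ?_, ?_⟩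
  · unfold liebKernel
    rw [if_pos h1, mul_comm Complex.I, sinh_add_mul_I]
    have e2 : Complex.sinh (x - zeta Δ * Complex.I) =
        Real.sinh x * Real.cos (zeta Δ) - Real.cosh x * Real.sin (zeta Δ) * Complex.I := by
      have := sinh_add_mul_I x (-zeta Δ)
      rw [Real.cos_neg, Real.sin_neg] at this
      push_cast at this ⊢
      rw [sub_eq_add_neg, ← neg_mul, this]
      ring
    have e3 : (2 * (Real.pi : ℂ) * (Real.sinh x * Real.cos (zeta Δ) + Real.cosh x * Real.sin (zeta Δ) * Complex.I))
        * (Real.sinh x * Real.cos (zeta Δ) - Real.cosh x * Real.sin (zeta Δ) * Complex.I) =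
        ((2 * Real.pi * (Real.sinh x ^ 2 + Real.sin (zeta Δ) ^ 2) : ℝ) : ℂ) := by
      have h2 : Real.sinh x ^ 2 + Real.sin (zeta Δ) ^ 2 =
          Real.sinh x ^ 2 * Real.cos (zeta Δ) ^ 2 + Real.cosh x ^ 2 * Real.sin (zeta Δ) ^ 2 := by
        rw [Real.cosh_sq]
        nlinarith [Real.sin_sq_add_cos_sq (zeta Δ)]
      rw [h2, Complex.ofReal_mul, Complex.ofReal_add, Complex.ofReal_mul, Complex.ofReal_mul,
        Complex.ofReal_mul, Complex.ofReal_pow, Complex.ofReal_pow, Complex.ofReal_pow,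
        Complex.ofReal_pow, Complex.ofReal_ofNat]
      linear_combination (-2 * (Real.pi : ℂ) * (Real.cosh x) ^ 2 * (Real.sin (zeta Δ)) ^ 2) * Complex.I_mul_I
    rw [e2, e3, show (2 : ℂ) * (zeta Δ : ℂ) = ((2 * zeta Δ : ℝ) : ℂ) by push_cast; ring,
      ← Complex.ofReal_sin, ← Complex.ofReal_div, Complex.ofReal_re]
    rfl
  · unfold bareMomentum
    rw [if_pos h1]
  · rw [e]; exact hasDerivAt_phaseHyp hζ
  · rw [e]; exact tendsto_phaseHyp hζ
  · rw [e]; exact tendsto_atBot_of_odd (phaseHyp_neg hζ) (tendsto_phaseHyp hζ)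

lemma rat_lineModel :
    LineModel 1 ratKernel 1 1 (fun x => phaseRat (1 / 2) x / (2 * Real.pi)) := by
  have e : barePhase 1 = phaseRat 1 := funext fun x => by simp [barePhase]
  refine ⟨rat_lineSystem, lt_irrefl 1, fun x => ?_, fun x => ?_, ?_, ?_, ?_⟩
  · have hpi := Real.pi_pos
    simp only [liebKernel, lt_irrefl, if_false, if_true, StripKernel.p, ratKernel]
    field_simp
    ring
  · simp [bareMomentum]
  · rw [e]; exact hasDerivAt_phaseRat one_pos
  · rw [e]; exact tendsto_phaseRat one_pos
  · rw [e]; exact tendsto_atBot_of_odd (phaseRat_neg one_pos) (tendsto_phaseRat one_pos)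

/-! ### The kernels in the massive regime -/

lemma sin_add_mul_I' (x y : ℝ) : Complex.sin (x + y * Complex.I) =
    ((Real.sin x * Real.cosh y : ℝ) : ℂ) + ((Real.cos x * Real.sinh y : ℝ) : ℂ) * Complex.I := by
  rw [Complex.sin_add_mul_I]
  push_cast
  rfl

lemma cos_add_mul_I' (x y : ℝ) : Complex.cos (x + y * Complex.I) =
    ((Real.cos x * Real.cosh y : ℝ) : ℂ) + ((-(Real.sin x * Real.sinh y) : ℝ) : ℂ) * Complex.I := by
  rw [Complex.cos_add_mul_I]
  push_cast
  ring

lemma normSq_sin (z : ℂ) : Complex.normSq (Complex.sin z) = Real.sin z.re ^ 2 + Real.sinh z.im ^ 2 := by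
  conv_lhs => rw [← Complex.re_add_im z, sin_add_mul_I']
  rw [Complex.normSq_add_mul_I, mul_pow, mul_pow, Real.cosh_sq]
  nlinarith [Real.sin_sq_add_cos_sq z.re]

lemma re_cot {z : ℂ} : (Complex.I / Real.pi * (Complex.cos z / Complex.sin z)).re =
    Real.sinh (2 * z.im) / (2 * Real.pi * (Real.sin z.re ^ 2 + Real.sinh z.im ^ 2)) := by
  have h1 : Complex.I / Real.pi * (Complex.cos z / Complex.sin z) =
      ((1 / Real.pi : ℝ) : ℂ) * (Complex.I * (Complex.cos z / Complex.sin z)) := by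
    push_cast; ring
  rw [h1, Complex.re_ofReal_mul, Complex.I_mul_re, Complex.div_im, normSq_sin]
  have key : ∀ a b : ℝ, ((a : ℂ) + b * Complex.I).re = a ∧ ((a : ℂ) + b * Complex.I).im = b := by
    simp
  have hs := sin_add_mul_I' z.re z.im
  have hc := cos_add_mul_I' z.re z.im
  rw [Complex.re_add_im] at hs hc
  have r1 : (Complex.sin z).re = Real.sin z.re * Real.cosh z.im := by rw [hs]; exact (key _ _).1
  have r2 : (Complex.sin z).im = Real.cos z.re * Real.sinh z.im := by rw [hs]; exact (key _ _).2
  have r3 : (Complex.cos z).re = Real.cos z.re * Real.cosh z.im := by rw [hc]; exact (key _ _).1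
  have r4 : (Complex.cos z).im = -(Real.sin z.re * Real.sinh z.im) := by rw [hc]; exact (key _ _).2
  rw [r1, r2, r3, r4, Real.sinh_two_mul]
  have hpi := Real.pi_pos
  have hch := Real.sin_sq_add_cos_sq z.re
  rcases eq_or_ne (Real.sin z.re ^ 2 + Real.sinh z.im ^ 2) 0 with h0 | h0
  · simp [h0]
  · field_simp
    linear_combination (Real.sinh z.im) * hch

lemma hasDerivAt_cot {z : ℂ} (hz : Complex.sin z ≠ 0) :
    HasDerivAt (fun z => Complex.I / Real.pi * (Complex.cos z / Complex.sin z))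
      (-(Complex.I / Real.pi) / Complex.sin z ^ 2) z := by
  refine (((Complex.hasDerivAt_cos z).div (Complex.hasDerivAt_sin z) hz).const_mul _).congr_deriv ?_
  have h := Complex.sin_sq_add_cos_sq z
  have hpi : (Real.pi : ℂ) ≠ 0 := Complex.ofReal_ne_zero.2 Real.pi_ne_zero
  field_simp
  linear_combination (-1 : ℂ) * h

lemma sin_ne_zero_of_im_pos {z : ℂ} (hz : 0 < z.im) : Complex.sin z ≠ 0 := by
  rw [← Complex.normSq_pos, normSq_sin]
  have := pow_pos (Real.sinh_pos_iff.2 hz) 2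
  positivity

def trigKernel : StripKernel where
  A x := Real.sin x ^ 2
  A' x := 2 * Real.sin x * Real.cos x
  B y := Real.sinh y ^ 2
  N y := Real.sinh (2 * y)
  F z := Complex.I / Real.pi * (Complex.cos z / Complex.sin z)
  J := Set.Ioi 0
  hasDerivAt_A x := by simpa using (Real.hasDerivAt_sin x).fun_pow 2
  A_nonneg x := sq_nonneg _
  abs_A'_le x := by
    have h := Real.sin_sq_add_cos_sq x
    rw [abs_le]
    constructor <;> nlinarith [sq_nonneg (Real.sin x + Real.cos x), sq_nonneg (Real.sin x - Real.cos x)]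
  continuous_B := by fun_prop
  continuous_N := by fun_prop
  isOpen_J := isOpen_Ioi
  ordConnected_J := Set.ordConnected_Ioi
  B_pos y hy := pow_pos (Real.sinh_pos_iff.2 hy) 2
  differentiableAt_F z hz := (hasDerivAt_cot (sin_ne_zero_of_im_pos hz)).differentiableAt
  norm_deriv_F_le z hz := by
    rw [(hasDerivAt_cot (sin_ne_zero_of_im_pos hz)).deriv, ← normSq_sin]
    exact norm_I_div_pi_le _
  re_F z _ := re_cot

namespace trigKernel

lemma p_eq (y x : ℝ) : trigKernel.p y x =
    Real.sinh (2 * y) / (2 * Real.pi * (Real.sin x ^ 2 + Real.sinh y ^ 2)) := rfl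

lemma p_neg (y x : ℝ) : trigKernel.p y (-x) = trigKernel.p y x := by
  rw [p_eq, p_eq, Real.sin_neg, neg_sq]

lemma p_add_pi (y x : ℝ) : trigKernel.p y (x + Real.pi) = trigKernel.p y x := by
  rw [p_eq, p_eq, Real.sin_add_pi, neg_sq]

lemma p_pos {y : ℝ} (hy : 0 < y) (x : ℝ) : 0 < trigKernel.p y x := by
  have h1 := Real.sinh_pos_iff.2 hy
  have h2 := Real.sinh_pos_iff.2 (show 0 < 2 * y by positivity)
  have hpi := Real.pi_pos
  rw [p_eq]
  positivity

lemma exists_le_p {y : ℝ} (hy : 0 < y) : ∃ c > 0, ∀ x, c ≤ trigKernel.p y x := by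
  have h1 := Real.sinh_pos_iff.2 hy
  have h2 := Real.sinh_pos_iff.2 (show 0 < 2 * y by positivity)
  have hpi := Real.pi_pos
  refine ⟨Real.sinh (2 * y) / (2 * Real.pi * (1 + Real.sinh y ^ 2)), by positivity, fun x => ?_⟩
  rw [p_eq]
  refine div_le_div_of_nonneg_left h2.le (by positivity) ?_
  gcongr
  exact Real.sin_sq_le_one x

lemma continuous_p {y : ℝ} (hy : 0 < y) : Continuous (trigKernel.p y) :=
  StripKernel.continuous_p _ (show y ∈ trigKernel.J from hy)

lemma isWindow_Icc (a b : ℝ) : trigKernel.IsWindow (Set.Icc a b) := by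
  have hc : Continuous fun u => 1 / (trigKernel.A u + 1) :=
    continuous_const.div (trigKernel.continuous_A.add continuous_const)
      fun u => (trigKernel.A_add_pos one_pos u).ne'
  have hi : ∀ x, IntegrableOn (fun μ => 1 / (trigKernel.A (x - μ) + 1)) (Set.Icc a b) := fun x =>
    (hc.comp (continuous_const.sub continuous_id)).continuousOn.integrableOn_Icc
  refine ⟨hi, ∫ _ in Set.Icc a b, (1 : ℝ), by positivity, fun x => ?_⟩
  refine integral_mono (hi x) (integrable_const 1) fun μ => ?_
  have := trigKernel.A_nonneg (x - μ)
  simp only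
  rw [div_le_one (by positivity)]
  linarith

lemma isAdmissible {ζ : ℝ} (h0 : 0 < ζ) : trigKernel.IsAdmissible ζ where
  pos := h0
  mem_J y hy _ := hy
  N_nonneg y hy _ := Real.sinh_nonneg_iff.2 (by positivity)
  tendsto_p_zero := by
    have h1 : Tendsto Real.sinh (𝓝[>] 0) (𝓝[>] 0) := by
      rw [tendsto_nhdsWithin_iff]
      refine ⟨?_, eventually_mem_nhdsWithin.mono fun ε hε => Real.sinh_pos_iff.2 hε⟩
      have := Real.continuous_sinh.tendsto 0
      rw [Real.sinh_zero] at this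
      exact this.mono_left nhdsWithin_le_nhds
    refine tendsto_atTop_mono' _ ?_ ((tendsto_inv_nhdsGT_zero.comp h1).const_mul_atTop
      (inv_pos.2 Real.pi_pos))
    filter_upwards [self_mem_nhdsWithin] with ε hε
    have h2 := Real.sinh_pos_iff.2 (show 0 < ε from hε)
    have hpi := Real.pi_pos
    have h3 := Real.one_le_cosh ε
    rw [p_eq, Real.sin_zero, Real.sinh_two_mul]
    simp only [Function.comp]
    rw [← mul_inv, inv_eq_one_div, div_le_div_iff₀ (by positivity) (by positivity)]
    nlinarith [mul_pos hpi (pow_pos h2 2)]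

lemma integral_p_period {y : ℝ} (hy : 0 < y) :
    ∫ x in (-(Real.pi / 2))..(Real.pi / 2), trigKernel.p y x = 1 := by
  have hpi := Real.pi_pos
  have hsh := Real.sinh_pos_iff.2 hy
  have hch := Real.cosh_pos y
  set c := Real.cosh y / Real.sinh y
  have hc : 0 < c := by positivity
  have hd : ∀ x ∈ Set.Ioo (-(Real.pi / 2)) (Real.pi / 2),
      HasDerivAt (fun x => Real.arctan (Real.tan x * c) / Real.pi) (trigKernel.p y x) x := by
    intro x hx
    have hcos : 0 < Real.cos x := Real.cos_pos_of_mem_Ioo hx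
    refine ((((Real.hasDerivAt_tan hcos.ne').mul_const c).arctan).div_const Real.pi).congr_deriv ?_
    have e : Real.sin x ^ 2 + Real.sinh y ^ 2 =
        Real.cos x ^ 2 * Real.sinh y ^ 2 + Real.sin x ^ 2 * Real.cosh y ^ 2 := by
      rw [Real.cosh_sq]
      linear_combination (-(Real.sinh y ^ 2)) * Real.sin_sq_add_cos_sq x
    have : 0 < Real.cos x ^ 2 * Real.sinh y ^ 2 + Real.sin x ^ 2 * Real.cosh y ^ 2 := by positivity
    rw [p_eq, Real.tan_eq_sin_div_cos, Real.sinh_two_mul, e]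
    simp only [c]
    field_simp
  have h1 : Tendsto (fun x => Real.arctan (Real.tan x * c) / Real.pi) (𝓝[<] (Real.pi / 2))
      (𝓝 (Real.pi / 2 / Real.pi)) :=
    ((tendsto_nhds_of_tendsto_nhdsWithin Real.tendsto_arctan_atTop).comp
      (Real.tendsto_tan_pi_div_two.atTop_mul_const hc)).div_const _
  have h2 : Tendsto (fun x => Real.arctan (Real.tan x * c) / Real.pi) (𝓝[>] (-(Real.pi / 2)))
      (𝓝 (-(Real.pi / 2) / Real.pi)) :=
    ((tendsto_nhds_of_tendsto_nhdsWithin Real.tendsto_arctan_atBot).comp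
      (Real.tendsto_tan_neg_pi_div_two.atBot_mul_const hc)).div_const _
  rw [intervalIntegral.integral_eq_sub_of_hasDerivAt_of_tendsto (by linarith) hd
    ((continuous_p hy).intervalIntegrable _ _) h2 h1]
  field_simp
  ring

/-- Integrals over a window of one period, as interval integrals. -/
lemma integral_Icc_period (a : ℝ) (f : ℝ → ℝ) :
    ∫ μ in Set.Icc a (a + Real.pi), f μ = ∫ μ in a..(a + Real.pi), f μ := by
  rw [integral_Icc_eq_integral_Ioc, intervalIntegral.integral_of_le (by linarith [Real.pi_pos])]

lemma integral_window {f : ℝ → ℝ} (hf : Function.Periodic f Real.pi) (a x : ℝ) :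
    ∫ μ in Set.Icc a (a + Real.pi), f (x - μ) = ∫ u in (-(Real.pi / 2))..(Real.pi / 2), f u := by
  rw [integral_Icc_period, intervalIntegral.integral_comp_sub_left]
  have := hf.intervalIntegral_add_eq (x - (a + Real.pi)) (-(Real.pi / 2))
  rw [show x - (a + Real.pi) + Real.pi = x - a by ring,
    show -(Real.pi / 2) + Real.pi = Real.pi / 2 by ring] at this
  exact this

lemma integral_p_window {y : ℝ} (hy : 0 < y) (a x : ℝ) :
    ∫ μ in Set.Icc a (a + Real.pi), trigKernel.p y (x - μ) = 1 := by
  rw [integral_window (p_add_pi y), integral_p_period hy]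

/-- The primitive of the kernel. -/
def prim (y x : ℝ) : ℝ := ∫ μ in (0 : ℝ)..x, trigKernel.p y μ

lemma hasDerivAt_prim {y : ℝ} (hy : 0 < y) (x : ℝ) :
    HasDerivAt (prim y) (trigKernel.p y x) x :=
  intervalIntegral.integral_hasDerivAt_right ((continuous_p hy).intervalIntegrable _ _)
    ((continuous_p hy).stronglyMeasurableAtFilter _ _) (continuous_p hy).continuousAt

lemma prim_neg (y x : ℝ) : prim y (-x) = -prim y x := by
  unfold prim
  rw [← intervalIntegral.integral_symm, ← neg_zero, ← intervalIntegral.integral_comp_neg]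
  simp only [p_neg, neg_zero]

lemma integral_p_eq {y : ℝ} (hy : 0 < y) (a b : ℝ) :
    ∫ μ in a..b, trigKernel.p y μ = prim y b - prim y a :=
  intervalIntegral.integral_eq_sub_of_hasDerivAt (fun x _ => hasDerivAt_prim hy x)
    ((continuous_p hy).intervalIntegrable _ _)

lemma prim_add_pi {y : ℝ} (hy : 0 < y) (x : ℝ) : prim y (x + Real.pi) = prim y x + 1 := by
  have h : Function.Periodic (trigKernel.p y) Real.pi := p_add_pi y
  have := h.intervalIntegral_add_eq x (-(Real.pi / 2))
  rw [show -(Real.pi / 2) + Real.pi = Real.pi / 2 by ring, integral_p_period hy,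
    integral_p_eq hy] at this
  linarith

lemma continuous_prim {y : ℝ} (hy : 0 < y) : Continuous (prim y) :=
  continuous_iff_continuousAt.2 fun x => (hasDerivAt_prim hy x).continuousAt

lemma exists_lipschitz_prim {y : ℝ} (hy : 0 < y) : ∃ L : NNReal, LipschitzWith L (prim y) := by
  set C := |trigKernel.N y| / (2 * Real.pi) * (1 / min 1 (trigKernel.B y))
  refine ⟨C.toNNReal, lipschitzWith_of_nnnorm_deriv_le
    (fun x => (hasDerivAt_prim hy x).differentiableAt) fun x => ?_⟩
  rw [(hasDerivAt_prim hy x).deriv, ← NNReal.coe_le_coe, coe_nnnorm]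
  exact (StripKernel.p_le (show y ∈ trigKernel.J from hy) x).trans (Real.le_coe_toNNReal _)

lemma integral_p_sub {y : ℝ} (hy : 0 < y) (x a b : ℝ) :
    ∫ μ in a..b, trigKernel.p y (x - μ) = prim y (x - a) - prim y (x - b) := by
  rw [intervalIntegral.integral_comp_sub_left, integral_p_eq hy]

end trigKernel

lemma zeta_pos {Δ : ℝ} (h : 1 < Δ) : 0 < zeta Δ := by
  unfold zeta
  rw [if_neg (not_lt.2 h.le)]
  exact Real.arcosh_pos h

/-- The quotients in the definitions of the phase and of the kernel. -/
lemma sin_mul_sin (x y : ℝ) : Complex.sin (x + Complex.I * y) * Complex.sin (x - Complex.I * y) =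
    ((Real.sin x ^ 2 + Real.sinh y ^ 2 : ℝ) : ℂ) := by
  have h := sin_add_mul_I' x (-y)
  rw [Real.cosh_neg, Real.sinh_neg] at h
  rw [mul_comm Complex.I, sin_add_mul_I',
    show (x : ℂ) - y * Complex.I = x + ((-y : ℝ) : ℂ) * Complex.I by push_cast; ring, h]
  have e : Real.sin x ^ 2 + Real.sinh y ^ 2 =
      (Real.sin x * Real.cosh y) ^ 2 + (Real.cos x * Real.sinh y) ^ 2 := by
    rw [mul_pow, mul_pow, Real.cosh_sq]
    linear_combination (-(Real.sinh y ^ 2)) * Real.sin_sq_add_cos_sq x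
  rw [e, mul_neg, Complex.ofReal_neg, Complex.ofReal_add, Complex.ofReal_pow, Complex.ofReal_pow]
  linear_combination (-((Real.cos x * Real.sinh y : ℝ) : ℂ) ^ 2) * Complex.I_mul_I

lemma phaseTrig_eq (η x : ℝ) : phaseTrig η x = 2 * Real.pi * trigKernel.prim η x := by
  unfold phaseTrig trigKernel.prim
  rw [← intervalIntegral.integral_const_mul]
  congr 1
  funext μ
  rw [sin_mul_sin, show (2 : ℂ) * (η : ℂ) = ((2 * η : ℝ) : ℂ) by push_cast; ring,
    ← Complex.ofReal_sinh, ← Complex.ofReal_div, Complex.ofReal_re, trigKernel.p_eq]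
  have := Real.pi_pos
  field_simp

lemma liebKernel_of_one_lt {Δ : ℝ} (h : 1 < Δ) (x : ℝ) :
    liebKernel Δ x = trigKernel.p (zeta Δ) x := by
  unfold liebKernel
  rw [if_neg (not_lt.2 h.le), if_neg h.ne', mul_assoc, sin_mul_sin,
    show (2 : ℂ) * (zeta Δ : ℂ) = ((2 * zeta Δ : ℝ) : ℂ) by push_cast; ring,
    show (2 : ℂ) * (Real.pi : ℂ) = ((2 * Real.pi : ℝ) : ℂ) by push_cast; ring,
    ← Complex.ofReal_sinh, ← Complex.ofReal_mul, ← Complex.ofReal_div, Complex.ofReal_re,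
    trigKernel.p_eq]

lemma barePhase_of_one_lt {Δ : ℝ} (h : 1 < Δ) (x : ℝ) :
    barePhase Δ x = 2 * Real.pi * trigKernel.prim (zeta Δ) x := by
  unfold barePhase
  rw [if_neg (not_lt.2 h.le), if_neg h.ne', phaseTrig_eq]

lemma bareMomentum_of_one_lt {Δ : ℝ} (h : 1 < Δ) (x : ℝ) :
    bareMomentum Δ x / (2 * Real.pi) = trigKernel.prim (zeta Δ / 2) x := by
  unfold bareMomentum
  rw [if_neg (not_lt.2 h.le), if_neg h.ne', phaseTrig_eq]
  have := Real.pi_pos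
  field_simp

/-! ### The periodic extension of the truncation -/

/-- The intervals of radius `D/2` around the multiples of `c`. -/
def stairSet (c D : ℝ) : Set ℝ := {t | ∃ n : ℤ, |t - c * n| ≤ D / 2}

/-- The function that increases with slope one on `stairSet c D` and is constant elsewhere. -/
def stair (c D y : ℝ) : ℝ := ∫ t in (0 : ℝ)..y, (stairSet c D).indicator 1 t

section stair
variable {c D : ℝ}

lemma measurableSet_stairSet : MeasurableSet (stairSet c D) := by
  have : stairSet c D = ⋃ n : ℤ, {t | |t - c * n| ≤ D / 2} := by ext; simp [stairSet]
  rw [this]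
  exact MeasurableSet.iUnion fun n => measurableSet_le (by fun_prop) measurable_const

lemma stairSet_indicator_mem (t : ℝ) : (stairSet c D).indicator (1 : ℝ → ℝ) t ∈ Set.Icc (0 : ℝ) 1 := by
  by_cases h : t ∈ stairSet c D
  · simp [Set.indicator_of_mem h]
  · simp [Set.indicator_of_notMem h]

lemma stairSet_intervalIntegrable (a b : ℝ) :
    IntervalIntegrable ((stairSet c D).indicator (1 : ℝ → ℝ)) volume a b := by
  refine (intervalIntegrable_const (c := (1 : ℝ))).mono_fun
    (measurable_one.indicator measurableSet_stairSet).aestronglyMeasurable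
    (Eventually.of_forall fun t => ?_)
  have := stairSet_indicator_mem (c := c) (D := D) t
  change |(stairSet c D).indicator (1 : ℝ → ℝ) t| ≤ |1|
  rw [abs_of_nonneg this.1, abs_one]
  exact this.2

lemma stair_sub (x y : ℝ) :
    stair c D y - stair c D x = ∫ t in x..y, (stairSet c D).indicator 1 t := by
  unfold stair
  have := intervalIntegral.integral_add_adjacent_intervals (a := 0) (b := x) (c := y)
    (stairSet_intervalIntegrable (c := c) (D := D) 0 x) (stairSet_intervalIntegrable x y)
  linarith

lemma monotone_stair : Monotone (stair c D) := by
  intro x y hxy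
  have : 0 ≤ ∫ t in x..y, (stairSet c D).indicator (1 : ℝ → ℝ) t :=
    intervalIntegral.integral_nonneg hxy fun t _ => (stairSet_indicator_mem t).1
  rw [← stair_sub] at this
  linarith

lemma stair_sub_le {x y : ℝ} (hxy : x ≤ y) : stair c D y - stair c D x ≤ y - x := by
  rw [stair_sub]
  have := intervalIntegral.integral_mono_on hxy (stairSet_intervalIntegrable (c := c) (D := D) x y)
    (intervalIntegrable_const (c := (1 : ℝ))) fun t _ => (stairSet_indicator_mem t).2
  simpa using this

lemma between_stair (x y : ℝ) : Between (stair c D x - stair c D y) (x - y) :=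
  between_of_monotone monotone_stair (fun _ _ h => stair_sub_le h) x y

lemma continuous_stair : Continuous (stair c D) := by
  have : LipschitzWith 1 (stair c D) := LipschitzWith.of_dist_le_mul fun x y => by
    rw [Real.dist_eq, Real.dist_eq, NNReal.coe_one, one_mul]
    exact (between_stair x y).2
  exact this.continuous

lemma stair_neg (y : ℝ) : stair c D (-y) = -stair c D y := by
  unfold stair
  rw [← intervalIntegral.integral_symm, ← neg_zero, ← intervalIntegral.integral_comp_neg, neg_zero]
  congr 1
  funext t
  have hneg : ∀ t, t ∈ stairSet c D → -t ∈ stairSet c D := by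
    rintro t ⟨n, hn⟩
    refine ⟨-n, ?_⟩
    rw [← abs_neg] at hn
    convert hn using 2
    push_cast
    ring
  by_cases h : t ∈ stairSet c D
  · rw [Set.indicator_of_mem h, Set.indicator_of_mem (hneg t h)]
    rfl
  · rw [Set.indicator_of_notMem h, Set.indicator_of_notMem fun h' => h (by simpa using hneg _ h')]

lemma stair_of_le_half {y : ℝ} (h0 : 0 ≤ y) (hy : y ≤ D / 2) : stair c D y = y := by
  unfold stair
  have : ∫ t in (0 : ℝ)..y, (stairSet c D).indicator (1 : ℝ → ℝ) t = ∫ _ in (0 : ℝ)..y, (1 : ℝ) := by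
    refine intervalIntegral.integral_congr fun t ht => ?_
    rw [Set.uIcc_of_le h0] at ht
    have hmem : t ∈ stairSet c D :=
      ⟨0, by rw [Int.cast_zero, mul_zero, sub_zero, abs_of_nonneg ht.1]; exact ht.2.trans hy⟩
    rw [Set.indicator_of_mem hmem]
    rfl
  rw [this]
  simp

lemma stair_of_half_le (hD : 0 ≤ D) {y : ℝ} (hy : D / 2 ≤ y) (hyc : y ≤ c / 2) :
    stair c D y = D / 2 := by
  have h1 := stair_of_le_half (c := c) (by positivity : 0 ≤ D / 2) le_rfl
  have h2 := stair_sub (c := c) (D := D) (D / 2) y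
  rw [intervalIntegral.integral_of_le hy, setIntegral_eq_zero_of_forall_eq_zero] at h2
  · linarith
  · intro t ht
    refine Set.indicator_of_notMem ?_ _
    rintro ⟨n, hn⟩
    have hc : 0 < c := by linarith [ht.1, ht.2]
    have h3 := abs_le.1 hn
    rcases le_or_gt n 0 with h | h
    · have : c * (n : ℝ) ≤ 0 := mul_nonpos_of_nonneg_of_nonpos hc.le (by exact_mod_cast h)
      linarith [ht.1, h3.2]
    · have : c * 1 ≤ c * (n : ℝ) := mul_le_mul_of_nonneg_left (by exact_mod_cast h) hc.le
      linarith [ht.1, ht.2, h3.1]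

lemma stair_eq_clamp_of_abs_le (hD : 0 ≤ D) {y : ℝ} (hy : |y| ≤ c / 2) :
    stair c D y = clamp D y := by
  have key : ∀ y, 0 ≤ y → y ≤ c / 2 → stair c D y = clamp D y := by
    intro y h0 hy
    rcases le_total y (D / 2) with h | h
    · rw [stair_of_le_half h0 h, clamp_of_mem (by linarith) h]
    · rw [stair_of_half_le hD h hy, clamp_of_ge hD h]
  rcases le_total 0 y with h | h
  · exact key y h ((le_abs_self y).trans hy)
  · have := key (-y) (by linarith) ((neg_le_abs y).trans hy)
    rw [stair_neg, clamp_neg hD] at this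
    linarith

lemma stair_add (hD : 0 ≤ D) (hc : D ≤ c) (y : ℝ) : stair c D (y + c) = stair c D y + D := by
  have hper : Function.Periodic ((stairSet c D).indicator (1 : ℝ → ℝ)) c := by
    intro t
    have h1 : t + c ∈ stairSet c D ↔ t ∈ stairSet c D := by
      constructor
      · rintro ⟨n, hn⟩
        refine ⟨n - 1, ?_⟩
        push_cast
        convert hn using 2
        ring
      · rintro ⟨n, hn⟩
        refine ⟨n + 1, ?_⟩
        push_cast
        convert hn using 2
        ring
    by_cases h : t ∈ stairSet c D
    · rw [Set.indicator_of_mem h, Set.indicator_of_mem (h1.2 h)]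
      rfl
    · rw [Set.indicator_of_notMem h, Set.indicator_of_notMem fun h' => h (h1.1 h')]
  have h2 := hper.intervalIntegral_add_eq y (-(c / 2))
  rw [show -(c / 2) + c = c / 2 by ring, ← stair_sub, ← stair_sub, stair_neg,
    stair_of_half_le hD (by linarith) le_rfl] at h2
  linarith

lemma stair_eq_clamp (hD : 0 ≤ D) (hc : D ≤ c) {y : ℝ} (h₁ : -(c / 2) ≤ y)
    (h₂ : y ≤ c - D / 2) : stair c D y = clamp D y := by
  rcases le_total y (c / 2) with h | h
  · exact stair_eq_clamp_of_abs_le hD (abs_le.2 ⟨h₁, h⟩)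
  · rw [clamp_of_ge hD (by linarith)]
    refine le_antisymm ?_ ?_
    · have h3 := stair_add hD hc (-(D / 2))
      rw [stair_neg, stair_of_le_half (by positivity) le_rfl] at h3
      calc _ ≤ stair c D (-(D / 2) + c) := monotone_stair (by linarith)
        _ = _ := by rw [h3]; ring
    · calc D / 2 = stair c D (c / 2) := (stair_of_half_le hD (by linarith) le_rfl).symm
        _ ≤ _ := monotone_stair h

end stair

namespace trigKernel
variable {ζ D A : ℝ} {f g : ℝ → ℝ} {C : ℝ}

/-- The source term of the equation on the window `[A, A + π]`. -/
def source (ζ D A x : ℝ) : ℝ := prim (ζ / 2) x - D * prim ζ (x - A) + D / 2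

lemma pot_add_pi (W : Set ℝ) (g : ℝ → ℝ) (x : ℝ) :
    trigKernel.pot W g ζ (x + Real.pi) = trigKernel.pot W g ζ x := by
  unfold StripKernel.pot
  congr 1
  funext μ
  rw [show x + Real.pi - μ = (x - μ) + Real.pi by ring, p_add_pi]

lemma add_pi_of_eqn (hζ : 0 < ζ) {W : Set ℝ}
    (hf : ∀ x, f x = source ζ D A x - trigKernel.pot W g ζ x) (x : ℝ) :
    f (x + Real.pi) = f x + (1 - D) := by
  rw [hf, hf, pot_add_pi]
  unfold source
  rw [show x + Real.pi - A = (x - A) + Real.pi by ring, prim_add_pi hζ, prim_add_pi (half_pos hζ)]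
  ring

lemma abs_pot_window_le (hζ : 0 < ζ) (hC : ∀ μ, |g μ| ≤ C) (x : ℝ) :
    |trigKernel.pot (Set.Icc A (A + Real.pi)) g ζ x| ≤ C := by
  refine ((isWindow_Icc _ _).abs_pot_le (show ζ ∈ trigKernel.J from hζ) hC x).trans ?_
  simp_rw [abs_of_pos (p_pos hζ _)]
  rw [integral_p_window hζ, mul_one]

lemma exists_lipschitz_source (hζ : 0 < ζ) (D A : ℝ) :
    ∃ L : NNReal, LipschitzWith L (source ζ D A) := by
  obtain ⟨L₁, h₁⟩ := exists_lipschitz_prim (half_pos hζ)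
  obtain ⟨L₂, h₂⟩ := exists_lipschitz_prim hζ
  have h3 : LipschitzWith (‖D‖₊ * L₂) fun x => D * prim ζ (x - A) := by
    refine LipschitzWith.of_dist_le_mul fun x y => ?_
    have := h₂.dist_le_mul (x - A) (y - A)
    rw [dist_sub_right] at this
    rw [Real.dist_eq, ← mul_sub, abs_mul, NNReal.coe_mul, coe_nnnorm, Real.norm_eq_abs, mul_assoc]
    exact mul_le_mul_of_nonneg_left this (abs_nonneg _)
  have h4 := (h₁.sub h3).add (LipschitzWith.const (α := ℝ) (D / 2))
  exact ⟨_, h4⟩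

lemma exists_lipschitz (hζ : 0 < ζ) (hg : Measurable g) (hC : ∀ x, |g x| ≤ C)
    (hf : ∀ x, f x = source ζ D A x - trigKernel.pot (Set.Icc A (A + Real.pi)) g ζ x) :
    ∃ L : NNReal, LipschitzWith L f := by
  obtain ⟨L₁, h₁⟩ := exists_lipschitz_source hζ D A
  obtain ⟨L, hL0, hL⟩ := (isWindow_Icc A (A + Real.pi)).exists_abs_pot_sub_le
    (show ζ ∈ trigKernel.J from hζ)
  obtain ⟨L₂, h₂⟩ := lipschitz_of_local (abs_pot_window_le (A := A) hζ hC)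
    fun x y hxy => hL g C hg ((abs_nonneg _).trans (hC 0)) hC x y hxy
  refine ⟨L₁ + L₂, ?_⟩
  rw [show f = _ from funext hf]
  exact h₁.sub h₂

/-- Integration by parts on the window. -/
lemma pot_window_eq (hζ : 0 < ζ) {L : NNReal} (hg : LipschitzWith L g)
    (h₁ : g A = -(D / 2)) (h₂ : g (A + Real.pi) = D / 2) (x : ℝ) :
    trigKernel.pot (Set.Icc A (A + Real.pi)) g ζ x =
      (∫ μ in Set.Icc A (A + Real.pi), prim ζ (x - μ) * deriv g μ) - D * prim ζ (x - A) + D / 2 := by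
  obtain ⟨K, hK⟩ := exists_lipschitz_prim hζ
  have hu : LipschitzWith K fun μ => prim ζ (x - μ) := LipschitzWith.of_dist_le_mul fun μ ν => by
    have := hK.dist_le_mul (x - μ) (x - ν)
    rwa [dist_sub_left] at this
  have hd : ∀ μ, deriv (fun μ => prim ζ (x - μ)) μ = -trigKernel.p ζ (x - μ) := fun μ =>
    ((hasDerivAt_prim hζ (x - μ)).comp_const_sub x μ).deriv
  have h := AbsolutelyContinuousOnInterval.integral_mul_deriv_eq_deriv_mul
    (hu.lipschitzOnWith (s := Set.uIcc A (A + Real.pi))).absolutelyContinuousOnInterval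
    (hg.lipschitzOnWith (s := Set.uIcc A (A + Real.pi))).absolutelyContinuousOnInterval
  simp only [hd] at h
  rw [h₁, h₂] at h
  have h3 : prim ζ (x - A) = prim ζ (x - (A + Real.pi)) + 1 := by
    rw [← prim_add_pi hζ]
    congr 1
    ring
  unfold StripKernel.pot
  rw [integral_Icc_period, integral_Icc_period, h]
  simp only [neg_mul]
  rw [intervalIntegral.integral_neg, h3]
  ring

lemma hasDerivAt (hζ : 0 < ζ) {L : NNReal} (hg : LipschitzWith L g)
    (h₁ : g A = -(D / 2)) (h₂ : g (A + Real.pi) = D / 2)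
    (hf : ∀ x, f x = source ζ D A x - trigKernel.pot (Set.Icc A (A + Real.pi)) g ζ x) (x : ℝ) :
    HasDerivAt f (trigKernel.p (ζ / 2) x
      - trigKernel.pot (Set.Icc A (A + Real.pi)) (deriv g) ζ x) x := by
  have e : f = fun x => prim (ζ / 2) x
      - ∫ μ in Set.Icc A (A + Real.pi), prim ζ (x - μ) * deriv g μ := by
    funext x
    rw [hf, pot_window_eq hζ hg h₁ h₂]
    unfold source
    ring
  rw [e]
  refine (hasDerivAt_prim (half_pos hζ) x).sub ?_
  have hLd := abs_deriv_le_of_lipschitz hg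
  have hm := (measurable_deriv g).aestronglyMeasurable (μ := volume.restrict (Set.Icc A (A + Real.pi)))
  have hc : ∀ y, Continuous fun μ => prim ζ (y - μ) := fun y =>
    (continuous_prim hζ).comp (continuous_const.sub continuous_id)
  have hp : ∀ y, Continuous fun μ => trigKernel.p ζ (y - μ) := fun y =>
    (continuous_p hζ).comp (continuous_const.sub continuous_id)
  refine (hasDerivAt_integral_of_dominated_loc_of_deriv_le
    (μ := volume.restrict (Set.Icc A (A + Real.pi)))
    (F := fun y μ => prim ζ (y - μ) * deriv g μ)
    (F' := fun y μ => trigKernel.p ζ (y - μ) * deriv g μ)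
    (bound := fun _ => |trigKernel.N ζ| / (2 * Real.pi) * (1 / min 1 (trigKernel.B ζ)) * L)
    (s := Set.univ) univ_mem
    (Eventually.of_forall fun y => (hc y).aestronglyMeasurable.mul hm) ?_
    ((hp x).aestronglyMeasurable.mul hm) ?_ (integrable_const _) ?_).2
  · exact ((hc x).continuousOn.integrableOn_Icc).mul_bdd hm (Eventually.of_forall hLd)
  · refine Eventually.of_forall fun μ y _ => ?_
    rw [Real.norm_eq_abs, abs_mul]
    exact mul_le_mul (StripKernel.p_le (show ζ ∈ trigKernel.J from hζ) _) (hLd μ) (abs_nonneg _)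
      ((abs_nonneg _).trans (StripKernel.p_le (show ζ ∈ trigKernel.J from hζ) 0))
  · exact Eventually.of_forall fun μ y _ => ((hasDerivAt_prim hζ (y - μ)).comp_sub_const y μ).mul_const _

lemma density_pos (hζ : 0 < ζ) {m ρ : ℝ → ℝ} (hm : Measurable m) (hC : ∀ μ, |m μ| ≤ C)
    (hρ : ∀ x, ρ x = trigKernel.p (ζ / 2) x - trigKernel.pot (Set.Icc A (A + Real.pi)) m ζ x)
    (hb : ∀ μ, Between (m μ) (ρ μ)) :
    (∀ x, 0 ≤ ρ x) ∧ ∀ a b, a < b → ∃ x ∈ Set.Ioo a b, ρ x ≠ 0 := by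
  have hpi := Real.pi_pos
  have hper : ∀ x, ρ (x + Real.pi) = ρ x := fun x => by rw [hρ, hρ, pot_add_pi, p_add_pi]
  refine StripKernel.density_pos_of_outer (isWindow_Icc _ _) (isAdmissible hζ) hm hC hρ
    (fun μ => (hb μ).le_max) (U := Set.Icc (-(Real.pi / 2)) (-(Real.pi / 2) + Real.pi))
    measurableSet_Icc (fun y _ x => ?_) ?_ (fun y hy _ => ?_) ?_ (fun δ hδ => ?_) ?_
  · have hF : Function.Periodic (fun u => trigKernel.p y u * max (ρ (x - u)) 0) Real.pi := by
      intro u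
      simp only
      rw [p_add_pi, ← hper (x - (u + Real.pi)), show x - (u + Real.pi) + Real.pi = x - u by ring]
    have := integral_window hF A x
    rw [integral_Icc_period, show -(Real.pi / 2) + Real.pi = Real.pi / 2 by ring, ← this]
    unfold StripKernel.pot
    simp only [sub_sub_cancel]
  · exact (continuous_const.div (trigKernel.continuous_A.add continuous_const)
      fun u => (trigKernel.A_add_pos one_pos u).ne').continuousOn.integrableOn_Icc
  · rw [integral_Icc_period, show -(Real.pi / 2) + Real.pi = Real.pi / 2 by ring,
      integral_p_period hy]
  · change Real.sinh (2 * 0) = 0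
    simp
  · set a := (2 / Real.pi * δ) ^ 2
    have ha : 0 < a := by positivity
    refine ⟨a / (a + 1), by positivity, fun u hu hδu => ?_⟩
    have h1 : a ≤ trigKernel.A u := by
      change (2 / Real.pi * δ) ^ 2 ≤ Real.sin u ^ 2
      have hu2 : |u| ≤ Real.pi / 2 := abs_le.2 ⟨hu.1, by linarith [hu.2]⟩
      have h2 := Real.mul_le_sin (abs_nonneg u) hu2
      have h3 : Real.sin |u| ^ 2 = Real.sin u ^ 2 := by
        rcases abs_choice u with h | h <;> rw [h]
        rw [Real.sin_neg, neg_sq]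
      rw [← h3]
      refine pow_le_pow_left₀ (by positivity) (le_trans ?_ h2) 2
      exact mul_le_mul_of_nonneg_left hδu (by positivity)
    rw [div_mul_eq_mul_div, div_le_iff₀ (by positivity)]
    nlinarith
  · refine (isWindow_Icc _ _).le_outer_of_halfPlane hm hC hζ (fun y hy => hy)
      (fun y hy => Real.sinh_nonneg_iff.2 (by positivity))
      fun y hy x => (integral_p_window hy A x).le

lemma strictMono (hζ : 0 < ζ) {L : NNReal} (hg : LipschitzWith L g)
    (h₁ : g A = -(D / 2)) (h₂ : g (A + Real.pi) = D / 2)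
    (hf : ∀ x, f x = source ζ D A x - trigKernel.pot (Set.Icc A (A + Real.pi)) g ζ x)
    (hb : ∀ᵐ x, ∀ f', HasDerivAt f f' x → DifferentiableAt ℝ g x → Between (deriv g x) f') :
    StrictMono f := by
  have hJ : ζ ∈ trigKernel.J := hζ
  set ρ : ℝ → ℝ := fun x => trigKernel.p (ζ / 2) x
    - trigKernel.pot (Set.Icc A (A + Real.pi)) (deriv g) ζ x
  have hρ : ∀ x, HasDerivAt f (ρ x) x := hasDerivAt hζ hg h₁ h₂ hf
  have hLd := abs_deriv_le_of_lipschitz hg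
  have hρm : Measurable ρ := ((continuous_p (half_pos hζ)).sub
    ((isWindow_Icc _ _).continuous_pot hJ (measurable_deriv g) hLd)).measurable
  obtain ⟨m, hm, hmL, hmb, hmae⟩ := exists_between_ae_eq (measurable_deriv g) hLd hρm (by
    filter_upwards [hb, hg.ae_differentiableAt_real] with x hx hx2 using hx _ (hρ x) hx2)
  obtain ⟨h0, h1⟩ := density_pos hζ hm hmL (A := A) (ρ := ρ) (fun x => by
    simp only [ρ, StripKernel.pot]
    congr 1
    refine integral_congr_ae (ae_restrict_of_ae ?_)
    filter_upwards [hmae] with μ hμ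
    rw [hμ]) hmb
  exact strictMono_of_deriv_nonneg hρ h0 h1

/-- The equation does not depend on the window. -/
lemma source_sub_pot_eq (hζ : 0 < ζ) (hg : Continuous g) (hgp : ∀ x, g (x + Real.pi) = g x + D)
    (A B x : ℝ) : source ζ D A x - trigKernel.pot (Set.Icc A (A + Real.pi)) g ζ x =
      source ζ D B x - trigKernel.pot (Set.Icc B (B + Real.pi)) g ζ x := by
  have hc : Continuous fun μ => trigKernel.p ζ (x - μ) * g μ :=
    ((continuous_p hζ).comp (continuous_const.sub continuous_id)).mul hg
  have hp : Continuous fun μ => trigKernel.p ζ (x - μ) :=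
    (continuous_p hζ).comp (continuous_const.sub continuous_id)
  have i := fun a b => hc.intervalIntegrable (μ := volume) a b
  have h1 := intervalIntegral.integral_interval_sub_interval_comm (i A (A + Real.pi))
    (i B (B + Real.pi)) (i A B)
  have h2 := intervalIntegral.integral_comp_add_right (a := A) (b := B)
    (fun μ => trigKernel.p ζ (x - μ) * g μ) Real.pi
  have h3 : (fun μ => trigKernel.p ζ (x - (μ + Real.pi)) * g (μ + Real.pi)) =
      fun μ => trigKernel.p ζ (x - μ) * g μ + D * trigKernel.p ζ (x - μ) := by
    funext μ
    rw [hgp, ← p_add_pi ζ (x - (μ + Real.pi)), show x - (μ + Real.pi) + Real.pi = x - μ by ring]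
    ring
  rw [h3, intervalIntegral.integral_add (i A B) ((hp.intervalIntegrable _ _).const_mul D),
    intervalIntegral.integral_const_mul, integral_p_sub hζ] at h2
  unfold StripKernel.pot source
  rw [integral_Icc_period, integral_Icc_period]
  linarith

end trigKernel

lemma interval_coe (a b : ℝ) : interval (a : EReal) (b : EReal) = Set.Icc a b := by
  ext x
  simp [interval]

lemma abs_clip_le_of_mem {D a b B : ℝ} {f : ℝ → ℝ} (hD : 0 ≤ D) (hB : 0 ≤ B)
    (hf : ∀ x ∈ Set.Icc a b, |f x| ≤ B) (x : ℝ) :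
    |clip (a : EReal) (b : EReal) D f x| ≤ B + D / 2 := by
  unfold clip
  split_ifs with h1 h2
  · rw [abs_neg, abs_of_nonneg (by positivity)]; linarith
  · rw [abs_of_nonneg (by positivity)]; linarith
  · have := hf x ⟨by simpa using h1, by simpa using h2⟩
    linarith

namespace trigKernel
variable {Δ ζ D A a b : ℝ} {f g : ℝ → ℝ}

lemma integral_p_mul_clip (hζ : 0 < ζ) (hab : a ≤ b) (hA : A ≤ a) (hb : b ≤ A + Real.pi)
    (hf : IntegrableOn f (Set.Icc a b)) (x : ℝ) :
    trigKernel.pot (Set.Icc A (A + Real.pi)) (clip (a : EReal) (b : EReal) D f) ζ x =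
      (∫ μ in Set.Icc a b, trigKernel.p ζ (x - μ) * f μ)
      + D / 2 * (prim ζ (x - b) + prim ζ (x - a)) - D * prim ζ (x - A) + D / 2 := by
  have hpc : Continuous fun μ => trigKernel.p ζ (x - μ) :=
    (continuous_p hζ).comp (continuous_const.sub continuous_id)
  have hpm : AEStronglyMeasurable (fun μ => trigKernel.p ζ (x - μ)) (volume.restrict (Set.Icc a b)) :=
    hpc.aestronglyMeasurable
  have hLR : (a : EReal) ≤ b := EReal.coe_le_coe_iff.2 hab
  have hint : IntegrableOn (fun μ => trigKernel.p ζ (x - μ) * f μ) (Set.Icc a b) :=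
    hf.bdd_mul hpm (Eventually.of_forall fun μ => StripKernel.p_le (show ζ ∈ trigKernel.J from hζ) _)
  have c1 : Set.EqOn (fun μ => trigKernel.p ζ (x - μ) * clip (a : EReal) (b : EReal) D f μ)
      (fun μ => trigKernel.p ζ (x - μ) * (-(D / 2))) (Set.Ico A a) := fun μ hμ => by
    simp only
    rw [clip_of_lt (EReal.coe_lt_coe_iff.2 hμ.2)]
  have c2 : Set.EqOn (fun μ => trigKernel.p ζ (x - μ) * clip (a : EReal) (b : EReal) D f μ)
      (fun μ => trigKernel.p ζ (x - μ) * f μ) (Set.Icc a b) := fun μ hμ => by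
    simp only
    rw [clip_of_mem (by rw [interval_coe]; exact hμ)]
  have c3 : Set.EqOn (fun μ => trigKernel.p ζ (x - μ) * clip (a : EReal) (b : EReal) D f μ)
      (fun μ => trigKernel.p ζ (x - μ) * (D / 2)) (Set.Ioc b (A + Real.pi)) := fun μ hμ => by
    simp only
    rw [clip_of_gt hLR (EReal.coe_lt_coe_iff.2 hμ.1)]
  have i1 : IntegrableOn (fun μ => trigKernel.p ζ (x - μ) * clip (a : EReal) (b : EReal) D f μ)
      (Set.Ico A a) := by
    rw [integrableOn_congr_fun c1 measurableSet_Ico]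
    exact ((hpc.mul continuous_const).continuousOn.integrableOn_Icc).mono_set Set.Ico_subset_Icc_self
  have i2 : IntegrableOn (fun μ => trigKernel.p ζ (x - μ) * clip (a : EReal) (b : EReal) D f μ)
      (Set.Icc a b) := by
    rwa [integrableOn_congr_fun c2 measurableSet_Icc]
  have i3 : IntegrableOn (fun μ => trigKernel.p ζ (x - μ) * clip (a : EReal) (b : EReal) D f μ)
      (Set.Ioc b (A + Real.pi)) := by
    rw [integrableOn_congr_fun c3 measurableSet_Ioc]
    exact ((hpc.mul continuous_const).continuousOn.integrableOn_Icc).mono_set Set.Ioc_subset_Icc_self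
  have hW : Set.Icc A (A + Real.pi) = (Set.Ico A a ∪ Set.Icc a b) ∪ Set.Ioc b (A + Real.pi) := by
    rw [Set.Ico_union_Icc_eq_Icc hA hab, Set.Icc_union_Ioc_eq_Icc (hA.trans hab) hb]
  have hd1 : Disjoint (Set.Ico A a) (Set.Icc a b) :=
    Set.disjoint_left.2 fun μ h h' => absurd h.2 (not_lt.2 h'.1)
  have hd2 : Disjoint (Set.Ico A a ∪ Set.Icc a b) (Set.Ioc b (A + Real.pi)) :=
    Set.disjoint_left.2 fun μ h h' => absurd h'.1 (not_lt.2
      (h.elim (fun h => h.2.le.trans hab) fun h => h.2))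
  have h3 : prim ζ (x - A) = prim ζ (x - (A + Real.pi)) + 1 := by
    rw [← prim_add_pi hζ]
    congr 1
    ring
  unfold StripKernel.pot
  rw [hW, setIntegral_union hd2 measurableSet_Ioc (i1.union i2) i3,
    setIntegral_union hd1 measurableSet_Icc i1 i2, setIntegral_congr_fun measurableSet_Ico c1,
    setIntegral_congr_fun measurableSet_Icc c2, setIntegral_congr_fun measurableSet_Ioc c3,
    integral_mul_const, integral_mul_const, integral_Ico_eq_integral_Ioc,
    ← intervalIntegral.integral_of_le hA, ← intervalIntegral.integral_of_le hb,
    integral_p_sub hζ, integral_p_sub hζ, h3]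
  ring

lemma solvesLieb_eqn_iff (h : 1 < Δ) (x : ℝ) :
    f x + ∫ μ in interval (a : EReal) (b : EReal), liebKernel Δ (x - μ) * f μ =
      bareMomentum Δ x / (2 * Real.pi)
        - D / (4 * Real.pi) * (shiftedPhase Δ x b + shiftedPhase Δ x a) ↔
    f x = prim (zeta Δ / 2) x - D / 2 * (prim (zeta Δ) (x - b) + prim (zeta Δ) (x - a))
      - ∫ μ in Set.Icc a b, trigKernel.p (zeta Δ) (x - μ) * f μ := by
  have e : D / (4 * Real.pi) * (shiftedPhase Δ x b + shiftedPhase Δ x a) =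
      D / 2 * (prim (zeta Δ) (x - b) + prim (zeta Δ) (x - a)) := by
    change D / (4 * Real.pi) * (barePhase Δ (x - b) + barePhase Δ (x - a)) = _
    rw [barePhase_of_one_lt h, barePhase_of_one_lt h]
    have := Real.pi_pos
    field_simp
    ring
  rw [e, bareMomentum_of_one_lt h, interval_coe]
  simp only [liebKernel_of_one_lt h]
  constructor <;> intro h <;> linarith

lemma eqn_of_solvesLieb (h : 1 < Δ) (hab : a ≤ b)
    (hf : SolvesLieb Δ D (a : EReal) (b : EReal) f) :
    Continuous f ∧ ∀ A, A ≤ a → b ≤ A + Real.pi → ∀ x, f x = source (zeta Δ) D A x -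
      trigKernel.pot (Set.Icc A (A + Real.pi)) (clip (a : EReal) (b : EReal) D f) (zeta Δ) x := by
  have hζ := zeta_pos h
  have hJ : zeta Δ ∈ trigKernel.J := hζ
  have heq := fun x => (solvesLieb_eqn_iff h x).1 (hf.eqn x)
  have hint : IntegrableOn f (Set.Icc a b) := by
    have := hf.memLp
    rw [interval_coe] at this
    exact this.elim (fun h => h.integrable one_le_two) fun h => h.integrable le_top
  have hi : ∀ x, IntegrableOn (fun μ => trigKernel.p (zeta Δ) (x - μ) * f μ) (Set.Icc a b) := fun x =>
    hint.bdd_mul ((continuous_p hζ).comp (continuous_const.sub continuous_id)).aestronglyMeasurable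
      (Eventually.of_forall fun μ => StripKernel.p_le hJ _)
  have hcont : Continuous f := by
    obtain ⟨c, hc0, hc⟩ := trigKernel.abs_p_sub_le hJ
    set P := |trigKernel.N (zeta Δ)| / (2 * Real.pi) * (1 / min 1 (trigKernel.B (zeta Δ)))
    have hP := StripKernel.p_le hJ
    have h1 : Continuous fun x => ∫ μ in Set.Icc a b, trigKernel.p (zeta Δ) (x - μ) * f μ := by
      refine (StripKernel.uniformContinuous_of_abs_sub_le (L := c * P * ∫ μ in Set.Icc a b, |f μ|)
        fun x x' hx => ?_).continuous
      rw [← integral_sub (hi x) (hi x')]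
      calc _ ≤ ∫ μ in Set.Icc a b, |trigKernel.p (zeta Δ) (x - μ) * f μ
            - trigKernel.p (zeta Δ) (x' - μ) * f μ| := abs_integral_le_integral_abs
        _ ≤ ∫ μ in Set.Icc a b, (c * |x - x'| * P) * |f μ| := by
            refine integral_mono_of_nonneg (Eventually.of_forall fun _ => abs_nonneg _)
              (hint.abs.const_mul _) (Eventually.of_forall fun μ => ?_)
            simp only
            rw [← sub_mul, abs_mul]
            refine mul_le_mul_of_nonneg_right ?_ (abs_nonneg _)
            have := hc (x - μ) (x' - μ) (by simpa using hx)
            rw [sub_sub_sub_cancel_right] at this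
            exact this.trans (mul_le_mul_of_nonneg_left (hP _) (by positivity))
        _ = _ := by rw [integral_const_mul]; ring
    have hp := continuous_prim hζ
    rw [show f = _ from funext heq]
    exact ((continuous_prim (half_pos hζ)).sub (continuous_const.mul
      ((hp.comp (continuous_id.sub continuous_const)).add
        (hp.comp (continuous_id.sub continuous_const))))).sub h1
  refine ⟨hcont, fun A hA hb x => ?_⟩
  rw [integral_p_mul_clip hζ hab hA hb hint]
  unfold source
  rw [heq x]
  ring

lemma solvesLieb_of_eqn (h : 1 < Δ) (hab : a ≤ b) (hA : A ≤ a) (hb : b ≤ A + Real.pi)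
    (hcont : Continuous f) (hf : ∀ x, f x = source (zeta Δ) D A x -
      trigKernel.pot (Set.Icc A (A + Real.pi)) (clip (a : EReal) (b : EReal) D f) (zeta Δ) x) :
    SolvesLieb Δ D (a : EReal) (b : EReal) f := by
  have hζ := zeta_pos h
  refine ⟨Or.inr ?_, fun x => (solvesLieb_eqn_iff h x).2 ?_⟩
  · rw [interval_coe]
    obtain ⟨B, hB⟩ := isCompact_Icc.exists_bound_of_continuousOn (hcont.continuousOn (s := Set.Icc a b))
    exact memLp_top_of_bound hcont.aestronglyMeasurable B
      ((ae_restrict_mem measurableSet_Icc).mono hB)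
  · have := hf x
    rw [integral_p_mul_clip hζ hab hA hb hcont.continuousOn.integrableOn_Icc] at this
    unfold source at this
    linarith

/-- Solutions of the equation with the periodic truncation. -/
structure IsTruncated (ζ D : ℝ) (f : ℝ → ℝ) : Prop where
  continuous : Continuous f
  eqn : ∀ x, f x = source ζ D (-(Real.pi / 2)) x -
    trigKernel.pot (Set.Icc (-(Real.pi / 2)) (-(Real.pi / 2) + Real.pi))
      (fun μ => stair (1 - D) D (f μ)) ζ x

lemma IsTruncated.ext (hζ : 0 < ζ) {f₁ f₂ : ℝ → ℝ} (h₁ : IsTruncated ζ D f₁)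
    (h₂ : IsTruncated ζ D f₂) : f₁ = f₂ := by
  have hJ : ζ ∈ trigKernel.J := hζ
  set W := Set.Icc (-(Real.pi / 2)) (-(Real.pi / 2) + Real.pi)
  have hW : trigKernel.IsWindow W := isWindow_Icc _ _
  obtain ⟨c, hc, hcp⟩ := exists_le_p hζ
  set u := fun μ => stair (1 - D) D (f₁ μ) - stair (1 - D) D (f₂ μ)
  have hk : ∀ x, Continuous fun μ => trigKernel.p ζ (x - μ) := fun x =>
    (continuous_p hζ).comp (continuous_const.sub continuous_id)
  have huc : Continuous u :=
    (continuous_stair.comp h₁.continuous).sub (continuous_stair.comp h₂.continuous)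
  have heq : ∀ x, f₁ x - f₂ x = -∫ μ in W, trigKernel.p ζ (x - μ) * u μ := by
    intro x
    have i1 : IntegrableOn (fun μ => trigKernel.p ζ (x - μ) * stair (1 - D) D (f₁ μ)) W :=
      ((hk x).mul (continuous_stair.comp h₁.continuous)).continuousOn.integrableOn_Icc
    have i2 : IntegrableOn (fun μ => trigKernel.p ζ (x - μ) * stair (1 - D) D (f₂ μ)) W :=
      ((hk x).mul (continuous_stair.comp h₂.continuous)).continuousOn.integrableOn_Icc
    rw [h₁.eqn x, h₂.eqn x]
    simp only [u, mul_sub, StripKernel.pot]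
    rw [integral_sub i1 i2]
    ring
  obtain ⟨B, hB⟩ := (isCompact_Icc (a := -(Real.pi / 2))
    (b := -(Real.pi / 2) + Real.pi)).exists_bound_of_continuousOn huc.continuousOn
  have hbd : ∀ x, |f₁ x - f₂ x| ≤ B := by
    intro x
    rw [heq x, abs_neg]
    calc _ ≤ ∫ μ in W, |trigKernel.p ζ (x - μ) * u μ| := abs_integral_le_integral_abs
      _ ≤ ∫ μ in W, trigKernel.p ζ (x - μ) * B := by
          refine integral_mono_of_nonneg (Eventually.of_forall fun _ => abs_nonneg _)
            ((hW.integrableOn_p hJ x).mul_const B)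
            ((ae_restrict_mem measurableSet_Icc).mono fun μ hμ => ?_)
          simp only
          rw [abs_mul, abs_of_pos (p_pos hζ _)]
          exact mul_le_mul_of_nonneg_left (hB μ hμ) (p_pos hζ _).le
      _ = B := by rw [integral_mul_const, integral_p_window hζ, one_mul]
  funext x
  have := eq_zero_of_doeblin (hW.integrableOn_p hJ) measurableSet_Icc
    isCompact_Icc.measure_lt_top.ne hc hcp (integral_p_window hζ _) huc.measurable hbd
    (fun μ _ => between_stair (c := 1 - D) (D := D) (f₁ μ) (f₂ μ)) heq x
  linarith

lemma stair_eq_clip (hD : 0 ≤ D) (hD1 : D ≤ 1 / 2) (hmono : Monotone f) (hab : a ≤ b)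
    (ha : f a = -(D / 2)) (hb : f b = D / 2) {x : ℝ} (h₁ : -((1 - D) / 2) ≤ f x)
    (h₂ : f x ≤ (1 - D) - D / 2) :
    stair (1 - D) D (f x) = clip (a : EReal) (b : EReal) D f x := by
  rw [stair_eq_clamp hD (by linarith) h₁ h₂,
    clip_eq_clamp (EReal.coe_le_coe_iff.2 hab) (EReal.coe_ne_top a) (EReal.coe_ne_bot b) hD hmono
      hb ha]

lemma isTruncated_of_solvesLieb (h : 1 < Δ) (hD : 0 ≤ D) (hD1 : D ≤ 1 / 2) (hab : a ≤ b)
    (hπ : b ≤ a + Real.pi) (hf : SolvesLieb Δ D (a : EReal) (b : EReal) f)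
    (ha : f a = -(D / 2)) (hb : f b = D / 2) :
    IsTruncated (zeta Δ) D f ∧ StrictMono f := by
  have hζ := zeta_pos h
  have hπ0 := Real.pi_pos
  obtain ⟨hcont, heq⟩ := eqn_of_solvesLieb h hab hf
  replace heq := heq a le_rfl hπ
  have hLR : (a : EReal) ≤ b := EReal.coe_le_coe_iff.2 hab
  set g := clip (a : EReal) (b : EReal) D f
  obtain ⟨B, hB⟩ := isCompact_Icc.exists_bound_of_continuousOn (hcont.continuousOn (s := Set.Icc a b))
  have hB0 : 0 ≤ B := (norm_nonneg _).trans (hB a ⟨le_rfl, hab⟩)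
  have hgC : ∀ x, |g x| ≤ B + D / 2 := abs_clip_le_of_mem hD hB0 hB
  obtain ⟨L, hL⟩ := exists_lipschitz hζ (measurable_clip hcont.measurable) hgC heq
  have hgL : LipschitzWith L g := lipschitzWith_clip hLR (EReal.coe_ne_top a) (EReal.coe_ne_bot b)
    hL hb ha
  have hfπ : f (a + Real.pi) = f a + (1 - D) := add_pi_of_eqn hζ heq a
  have hg₁ : g a = -(D / 2) := by
    simp only [g]
    rw [clip_of_mem (by rw [interval_coe]; exact ⟨le_rfl, hab⟩), ha]
  have hg₂ : g (a + Real.pi) = D / 2 := by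
    simp only [g]
    rcases hπ.eq_or_lt with h' | h'
    · rw [← h', clip_of_mem (by rw [interval_coe]; exact ⟨hab, le_rfl⟩), hb]
    · rw [clip_of_gt hLR (EReal.coe_lt_coe_iff.2 h')]
  have hmono : StrictMono f := strictMono hζ hgL hg₁ hg₂ heq (by
    filter_upwards [ae_between_deriv_clip (D := D) (f := f) hLR] with x hx f' h1 _ using hx f' h1)
  refine ⟨⟨hcont, fun x => ?_⟩, hmono⟩
  have hper : ∀ x, stair (1 - D) D (f (x + Real.pi)) = stair (1 - D) D (f x) + D := fun x => by
    rw [add_pi_of_eqn hζ heq x, stair_add hD (by linarith)]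
  rw [source_sub_pot_eq (g := fun μ => stair (1 - D) D (f μ)) hζ (continuous_stair.comp hcont)
    hper _ a x, heq x]
  unfold StripKernel.pot
  rw [setIntegral_congr_fun measurableSet_Icc fun μ hμ => ?_]
  beta_reduce
  have h1 := hmono.monotone hμ.1
  have h2 := hmono.monotone hμ.2
  rw [stair_eq_clip hD hD1 hmono.monotone hab ha hb (by linarith) (by linarith)]

lemma source_neg (hζ : 0 < ζ) (D x : ℝ) :
    source ζ D (-(Real.pi / 2)) (-x) = -source ζ D (-(Real.pi / 2)) x := by
  unfold source
  rw [show -x - -(Real.pi / 2) = -(x - Real.pi / 2) by ring,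
    show x - -(Real.pi / 2) = (x - Real.pi / 2) + Real.pi by ring, prim_neg, prim_neg,
    prim_add_pi hζ]
  ring

lemma integral_symm_window (k u : ℝ → ℝ) (hk : ∀ x, k (-x) = k x) (x : ℝ) :
    ∫ μ in Set.Icc (-(Real.pi / 2)) (-(Real.pi / 2) + Real.pi), k (-x - μ) * u μ =
      ∫ μ in Set.Icc (-(Real.pi / 2)) (-(Real.pi / 2) + Real.pi), k (x - μ) * u (-μ) := by
  rw [integral_Icc_period, integral_Icc_period,
    show -(Real.pi / 2) + Real.pi = Real.pi / 2 by ring]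
  have := intervalIntegral.integral_comp_neg (a := -(Real.pi / 2)) (b := Real.pi / 2)
    (fun μ => k (-x - μ) * u μ)
  rw [neg_neg] at this
  rw [← this]
  congr 1
  funext μ
  rw [← hk (x - μ)]
  congr 2
  ring

/-- Existence of a solution by contraction, after subtraction of the minimum of the kernel. -/
lemma exists_odd_solution (hζ : 0 < ζ) (hD : 0 ≤ D) :
    ∃ f : ℝ → ℝ, Continuous f ∧ (∀ x, f (-x) = -f x) ∧ ∀ x, f x = source ζ D (-(Real.pi / 2)) x -
      trigKernel.pot (Set.Icc (-(Real.pi / 2)) (-(Real.pi / 2) + Real.pi))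
        (fun μ => clamp D (f μ)) ζ x := by
  have hπ := Real.pi_pos
  have hJ : ζ ∈ trigKernel.J := hζ
  obtain ⟨c, hc, hcp⟩ := exists_le_p hζ
  set W := Set.Icc (-(Real.pi / 2)) (-(Real.pi / 2) + Real.pi)
  have hW : trigKernel.IsWindow W := isWindow_Icc _ _
  set k : ℝ → ℝ := fun x => trigKernel.p ζ x - c
  set s := source ζ D (-(Real.pi / 2))
  have hs : Continuous s := by
    obtain ⟨L, hL⟩ := exists_lipschitz_source hζ D (-(Real.pi / 2))
    exact hL.continuous
  have hki : ∀ x, IntegrableOn (fun μ => k (x - μ)) W := fun x =>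
    (hW.integrableOn_p hJ x).sub (integrable_const c)
  have hWc : ∫ _ in W, c = c * Real.pi := by
    simp only [W]
    rw [integral_Icc_period, intervalIntegral.integral_const, smul_eq_mul]
    ring
  have hkκ : ∀ x, ∫ μ in W, |k (x - μ)| = 1 - c * Real.pi := by
    intro x
    have : ∀ μ, |k (x - μ)| = trigKernel.p ζ (x - μ) - c := fun μ =>
      abs_of_nonneg (sub_nonneg.2 (hcp _))
    simp only [this]
    rw [integral_sub (hW.integrableOn_p hJ x) (integrable_const c), integral_p_window hζ, hWc]
  have hκ0 : 0 ≤ 1 - c * Real.pi := by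
    rw [← hkκ 0]
    exact integral_nonneg fun _ => abs_nonneg _
  have hκ1 : 1 - c * Real.pi < 1 := by nlinarith [mul_pos hc hπ]
  have hkpot : ∀ (u : ℝ → ℝ) (C : ℝ), Measurable u → (∀ μ, |u μ| ≤ C) → ∀ x,
      ∫ μ in W, k (x - μ) * u μ = trigKernel.pot W u ζ x - c * ∫ μ in W, u μ := by
    intro u C hu hC x
    have i1 := hW.integrableOn_p_mul hJ hu hC x
    have i2 : IntegrableOn (fun μ => c * u μ) W :=
      (Integrable.of_bound hu.aestronglyMeasurable C (Eventually.of_forall hC)).const_mul c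
    unfold StripKernel.pot
    rw [← integral_const_mul, ← integral_sub i1 i2]
    simp only [k, sub_mul]
  obtain ⟨v, hv, hvD, hveq⟩ := exists_clamp_solution hD hs hki hκ0 hκ1 (fun x => (hkκ x).le)
    (fun u hu hC => by
      simp only [hkpot u _ hu hC]
      exact (hW.continuous_pot hJ hu hC).sub continuous_const)
  set g := fun μ => clamp D (s μ + v μ)
  have hgc : Continuous g := continuous_clamp.comp (hs.add hv)
  have hgD : ∀ μ, |g μ| ≤ D / 2 := fun μ => abs_clamp_le hD _
  have hvodd : ∀ x, v x + v (-x) = 0 := by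
    refine eq_zero_of_contraction (h₂ := fun μ => g μ + g (-μ)) (C := D / 2 + D / 2) hki hκ1 hκ0
      (fun x => (hkκ x).le) (fun x => (abs_add_le _ _).trans (add_le_add (hvD _) (hvD _)))
      (fun μ => ?_) (fun x => ?_)
    · have h1 : g (-μ) = -clamp D (s μ - v (-μ)) := by
        simp only [g, s]
        rw [source_neg hζ, ← clamp_neg hD]
        congr 1
        ring
      rw [h1, ← sub_eq_add_neg]
      refine (abs_clamp_sub_le D _ _).trans (le_of_eq ?_)
      congr 1
      ring
    · have i1 : IntegrableOn (fun μ => k (x - μ) * g μ) W :=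
        (hki x).mul_bdd hgc.aestronglyMeasurable (Eventually.of_forall hgD)
      have i2 : IntegrableOn (fun μ => k (x - μ) * g (-μ)) W :=
        (hki x).mul_bdd (hgc.comp continuous_neg).aestronglyMeasurable
          (Eventually.of_forall fun μ => hgD (-μ))
      rw [hveq x, hveq (-x), integral_symm_window k g (fun x => by simp only [k, p_neg]) x]
      simp only [mul_add]
      rw [integral_add i1 i2]
      ring
  have hodd : ∀ x, s (-x) + v (-x) = -(s x + v x) := by
    intro x
    have := hvodd x
    simp only [s]
    rw [source_neg hζ]
    linarith
  have hg0 : ∫ μ in W, g μ = 0 := by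
    have h1 := integral_symm_window (fun _ => 1) g (fun _ => rfl) 0
    have h2 : ∀ μ, g (-μ) = -g μ := fun μ => by
      simp only [g]
      rw [hodd, clamp_neg hD]
    simp only [one_mul, h2] at h1
    rw [integral_neg] at h1
    linarith
  refine ⟨fun x => s x + v x, hs.add hv, hodd, fun x => ?_⟩
  have := hveq x
  rw [hkpot g _ hgc.measurable hgD, hg0] at this
  simp only
  rw [this]
  ring

lemma exists_isTruncated (hζ : 0 < ζ) (hD : 0 ≤ D) (hD1 : D ≤ 1 / 2) :
    ∃ f : ℝ → ℝ, IsTruncated ζ D f ∧ StrictMono f ∧ (∀ x, f (-x) = -f x) ∧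
      f (Real.pi / 2) = (1 - D) / 2 := by
  have hπ := Real.pi_pos
  obtain ⟨f, hcont, hodd, heq⟩ := exists_odd_solution hζ hD
  have hg : Continuous fun μ => clamp D (f μ) := continuous_clamp.comp hcont
  have hper := add_pi_of_eqn hζ heq (-(Real.pi / 2))
  rw [show -(Real.pi / 2) + Real.pi = Real.pi / 2 by ring, hodd] at hper
  have hval : f (Real.pi / 2) = (1 - D) / 2 := by linarith
  obtain ⟨L, hL⟩ := exists_lipschitz hζ hg.measurable (fun x => abs_clamp_le hD _) heq
  have hgL : LipschitzWith L fun μ => clamp D (f μ) := LipschitzWith.of_dist_le_mul fun x y =>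
    (abs_clamp_sub_le D _ _).trans (hL.dist_le_mul x y)
  have hmono : StrictMono f := by
    refine strictMono hζ hgL ?_ ?_ heq (Eventually.of_forall fun x f' h1 h2 => ?_)
    · rw [hodd, hval, clamp_of_le (by linarith)]
    · rw [show -(Real.pi / 2) + Real.pi = Real.pi / 2 by ring, hval, clamp_of_ge hD (by linarith)]
    · exact between_of_hasDerivAt h1 h2.hasDerivAt fun y => between_clamp D _ _
  refine ⟨f, ⟨hcont, fun x => ?_⟩, hmono, hodd, hval⟩
  rw [heq x]
  unfold StripKernel.pot
  rw [setIntegral_congr_fun measurableSet_Icc fun μ hμ => ?_]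
  have h1 := hmono.monotone hμ.1
  have h2 := hmono.monotone hμ.2
  rw [hodd, hval] at h1
  rw [show -(Real.pi / 2) + Real.pi = Real.pi / 2 by ring, hval] at h2
  simp only
  rw [stair_eq_clamp_of_abs_le hD (abs_le.2 ⟨h1, h2⟩)]

end trigKernel

lemma SolvesTwoEndpoint.exists_coe {Δ D : ℝ} {QL QR : EReal} {f : ℝ → ℝ} (h : 1 < Δ)
    (hf : SolvesTwoEndpoint Δ D QL QR f) :
    ∃ a b : ℝ, QL = a ∧ QR = b ∧ a ≤ b ∧ b ≤ a + Real.pi := by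
  have hlen := hf.length_le h
  have hle := hf.le
  have hL := hf.left_ne_top
  have hR := hf.right_ne_bot
  induction QL using EReal.rec with
  | top => exact absurd rfl hL
  | bot =>
    rw [sub_eq_add_neg, EReal.neg_bot, EReal.add_top_of_ne_bot hR] at hlen
    exact absurd hlen (by simp)
  | coe a =>
    induction QR using EReal.rec with
    | bot => exact absurd rfl hR
    | top =>
      rw [EReal.top_sub_coe] at hlen
      exact absurd hlen (by simp)
    | coe b =>
      rw [← EReal.coe_sub, EReal.coe_le_coe_iff] at hlen
      exact ⟨a, b, rfl, rfl, EReal.coe_le_coe_iff.1 hle, by linarith⟩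

lemma SolvesFermiBoundary.exists_coe {Δ D : ℝ} {Q : EReal} {g : ℝ → ℝ} (h : 1 < Δ)
    (hg : SolvesFermiBoundary Δ D Q g) : ∃ q : ℝ, Q = q ∧ 0 ≤ q ∧ q ≤ Real.pi / 2 := by
  have h0 := hg.nonneg
  have h1 := hg.le_half_period h
  induction Q using EReal.rec with
  | bot => exact absurd h0 (by simp)
  | top => exact absurd h1 (by simp)
  | coe q => exact ⟨q, rfl, by exact_mod_cast h0, EReal.coe_le_coe_iff.1 h1⟩

namespace trigKernel
variable {Δ D : ℝ} {f : ℝ → ℝ}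

lemma odd_of_solvesFermiBoundary (h : 1 < Δ) (hD : 0 ≤ D) {q : ℝ}
    (hf : SolvesFermiBoundary Δ D (q : EReal) f) (hq0 : 0 ≤ q) (hq : q ≤ Real.pi / 2) (x : ℝ) :
    f (-x) = -f x := by
  have hζ := zeta_pos h
  have hJ : zeta Δ ∈ trigKernel.J := hζ
  have hlieb := hf.lieb
  rw [← EReal.coe_neg] at hlieb
  obtain ⟨hcont, heq⟩ := eqn_of_solvesLieb h (by linarith) hlieb
  replace heq := heq (-(Real.pi / 2)) (by linarith) (by linarith)
  set g := clip ((-q : ℝ) : EReal) (q : EReal) D f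
  have hLR : ((-q : ℝ) : EReal) ≤ q := EReal.coe_le_coe_iff.2 (by linarith)
  set W := Set.Icc (-(Real.pi / 2)) (-(Real.pi / 2) + Real.pi)
  have hW : trigKernel.IsWindow W := isWindow_Icc _ _
  obtain ⟨c, hc, hcp⟩ := exists_le_p hζ
  obtain ⟨B, hB⟩ := isCompact_Icc.exists_bound_of_continuousOn (hcont.continuousOn (s := Set.Icc (-q) q))
  have hB0 : 0 ≤ B := (norm_nonneg _).trans (hB q ⟨by linarith, le_rfl⟩)
  have hgm : Measurable g := measurable_clip hcont.measurable
  have hgC : ∀ x, |g x| ≤ B + D / 2 := abs_clip_le_of_mem hD hB0 hB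
  have hgn : Measurable fun μ => g (-μ) := hgm.comp measurable_neg
  have hb : ∀ μ, Between (g μ + g (-μ)) (f μ + f (-μ)) := by
    intro μ
    rcases lt_or_ge μ (-q) with h | h
    · simp only [g]
      rw [clip_of_lt (EReal.coe_lt_coe_iff.2 h),
        clip_of_gt hLR (EReal.coe_lt_coe_iff.2 (by linarith)), neg_add_cancel]
      exact between_zero _
    · rcases lt_or_ge q μ with h' | h'
      · simp only [g]
        rw [clip_of_gt hLR (EReal.coe_lt_coe_iff.2 h'),
          clip_of_lt (EReal.coe_lt_coe_iff.2 (by linarith)), add_neg_cancel]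
        exact between_zero _
      · simp only [g]
        rw [clip_of_mem (by rw [interval_coe]; exact ⟨h, h'⟩),
          clip_of_mem (by rw [interval_coe]; exact ⟨by linarith, by linarith⟩)]
        exact between_self _
  have heq2 : ∀ x, f x + f (-x) = -∫ μ in W, trigKernel.p (zeta Δ) (x - μ) * (g μ + g (-μ)) := by
    intro x
    have i1 := hW.integrableOn_p_mul hJ hgm hgC x
    have i2 := hW.integrableOn_p_mul hJ hgn (fun μ => hgC (-μ)) x
    have hflip := integral_symm_window (trigKernel.p (zeta Δ)) g (p_neg _) x
    rw [heq x, heq (-x), source_neg hζ]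
    unfold StripKernel.pot
    rw [hflip]
    simp only [mul_add]
    rw [integral_add i1 i2]
    ring
  have hbd : ∀ x, |f x + f (-x)| ≤ (B + D / 2) + (B + D / 2) := by
    intro x
    rw [heq2 x, abs_neg]
    exact abs_pot_window_le hζ
      (fun μ => (abs_add_le _ _).trans (add_le_add (hgC μ) (hgC (-μ)))) x
  have := eq_zero_of_doeblin (h := fun x => f x + f (-x)) (hW.integrableOn_p hJ) measurableSet_Icc
    isCompact_Icc.measure_lt_top.ne hc hcp (integral_p_window hζ _) (hgm.add hgn) hbd
    (fun μ _ => hb μ) heq2 x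
  linarith

theorem main (h : 1 < Δ) (hD : D ∈ Set.Icc (0 : ℝ) (1 / 2)) :
    ∃ (q : EReal) (p : ℝ → ℝ),
      (∀ (Q : EReal) (g : ℝ → ℝ), SolvesFermiBoundary Δ D Q g ↔ Q = q ∧ g = p) ∧
      (∀ (QL QR : EReal) (f : ℝ → ℝ), SolvesTwoEndpoint Δ D QL QR f ↔ QL = -q ∧ QR = q ∧ f = p) ∧
      (0 < D → 0 < q) ∧
      (D < 1 / 2 → q < if 1 < Δ then ((Real.pi / 2 : ℝ) : EReal) else ⊤) := by
  obtain ⟨hD0, hD1⟩ := hD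
  have hζ := zeta_pos h
  have hπ := Real.pi_pos
  obtain ⟨f, hf, hmono, hodd, hval⟩ := exists_isTruncated hζ hD0 hD1
  have h0 : f 0 = 0 := by
    have := hodd 0
    rw [neg_zero] at this
    linarith
  obtain ⟨q, hq, hfq⟩ := intermediate_value_Icc (show 0 ≤ Real.pi / 2 by positivity)
    hf.continuous.continuousOn
    (show D / 2 ∈ Set.Icc (f 0) (f (Real.pi / 2)) by rw [h0, hval]; constructor <;> linarith)
  have hfq' : f (-q) = -(D / 2) := by rw [hodd, hfq]
  have hqq : -q ≤ q := by linarith [hq.1]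
  have hsol : SolvesTwoEndpoint Δ D (-(q : EReal)) q f := by
    rw [← EReal.coe_neg]
    refine ⟨EReal.coe_ne_top _, EReal.coe_ne_bot _, EReal.coe_le_coe_iff.2 hqq, fun _ => ?_, ?_,
      hfq, hfq'⟩
    · rw [← EReal.coe_sub, EReal.coe_le_coe_iff]
      linarith [hq.2]
    · refine solvesLieb_of_eqn (A := -(Real.pi / 2)) h hqq (by linarith [hq.2]) (by linarith [hq.2])
        hf.continuous fun x => ?_
      rw [hf.eqn x]
      unfold StripKernel.pot
      rw [setIntegral_congr_fun measurableSet_Icc fun μ hμ => ?_]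
      have h1 := hmono.monotone hμ.1
      have h2 := hmono.monotone hμ.2
      rw [hodd, hval] at h1
      rw [show -(Real.pi / 2) + Real.pi = Real.pi / 2 by ring, hval] at h2
      beta_reduce
      rw [stair_eq_clip hD0 hD1 hmono.monotone hqq hfq' hfq h1 (by linarith)]
  have huniq : ∀ (QL QR : EReal) (g : ℝ → ℝ), SolvesTwoEndpoint Δ D QL QR g →
      QL = -(q : EReal) ∧ QR = q ∧ g = f := by
    intro QL QR g hg
    obtain ⟨a, b, rfl, rfl, hab, hba⟩ := hg.exists_coe h
    have ha : g a = -(D / 2) := hg.boundary_left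
    have hb : g b = D / 2 := hg.boundary_right
    obtain ⟨hg2, -⟩ := isTruncated_of_solvesLieb h hD0 hD1 hab hba hg.lieb ha hb
    have hgf : g = f := hg2.ext hζ hf
    subst hgf
    refine ⟨?_, ?_, rfl⟩
    · rw [← EReal.coe_neg, EReal.coe_eq_coe_iff]
      exact hmono.injective (ha.trans hfq'.symm)
    · rw [EReal.coe_eq_coe_iff]
      exact hmono.injective (hb.trans hfq.symm)
  refine ⟨q, f, fun Q g => ⟨fun hg => ?_, ?_⟩, fun QL QR g => ⟨huniq QL QR g, ?_⟩, fun hD2 => ?_,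
    fun hD2 => ?_⟩
  · obtain ⟨r, rfl, hr0, hr⟩ := hg.exists_coe h
    obtain ⟨-, h1, h2⟩ := huniq _ _ _
      (hg.solvesTwoEndpoint (odd_of_solvesFermiBoundary h hD0 hg hr0 hr))
    exact ⟨h1, h2⟩
  · rintro ⟨rfl, rfl⟩
    exact hsol.solvesFermiBoundary (by exact_mod_cast hq.1) fun _ => EReal.coe_le_coe_iff.2 hq.2
  · rintro ⟨rfl, rfl, rfl⟩
    exact hsol
  · have : 0 < q := by
      refine lt_of_le_of_ne hq.1 fun h' => ?_
      rw [← h', h0] at hfq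
      linarith
    exact_mod_cast this
  · rw [if_pos h, EReal.coe_lt_coe_iff]
    refine lt_of_le_of_ne hq.2 fun h' => ?_
    rw [h', hval] at hfq
    linarith

end trigKernel

end XXZ

end

theorem mainTheorem7 (Δ : ℝ) (hΔ : -1 < Δ) (D : ℝ) (hD : D ∈ Set.Icc (0 : ℝ) (1 / 2)) :
    ∃ (q : EReal) (p : ℝ → ℝ),
      (∀ (Q : EReal) (g : ℝ → ℝ), XXZ.SolvesFermiBoundary Δ D Q g ↔ Q = q ∧ g = p) ∧
      (∀ (QL QR : EReal) (f : ℝ → ℝ),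
        XXZ.SolvesTwoEndpoint Δ D QL QR f ↔ QL = -q ∧ QR = q ∧ f = p) ∧
      (0 < D → 0 < q) ∧
      (D < 1 / 2 → q < if 1 < Δ then ((Real.pi / 2 : ℝ) : EReal) else ⊤) := by
  rcases lt_trichotomy Δ 1 with h | rfl | h
  · exact (XXZ.hyp_lineModel hΔ h).main hD
  · exact XXZ.rat_lineModel.main hD
  · exact XXZ.trigKernel.main h hD
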